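/- Let $E/\mathbb{Q}$ be an elliptic curve with Weierstrass equation $y^2+a_1xy+a_3y=x^3+a_2x^2+a_4x+a_6$, origin $\infty$ and $Y=E\smallsetminus\{\infty\}$. Let $P$ be the $\mathbb{G}_m$-torsor over $E$ of the line bundle $\mathcal{O}(\infty)$, let $f\colon Y\to P$ be the morphism given by the section $1$ of $\mathcal{O}(\infty)$ on $Y$, and let $\tilde\infty\in P(\mathbb{Q})$ be the value at $\infty$ of the section $t^{-1}$, where $t=-x/y$. For $n\ge 1$ put $P_n=P^{\otimes(1+n)}\otimes[-1]^*P^{\otimes(1-n)}$. There are morphisms of $\mathbb{Q}$-varieties $\beta_n\colon P\to P_n$ lying over $[n]\colon E\to E$ and under $[2n^2]\colon\mathbb{G}_m\to\mathbb{G}_m$, and $\beta_{n,m}\colon P_n\to P_{nm}$ lying over $[m]$ and under $[m^2]$, with $\beta_{n,m}\circ\beta_n=\beta_{nm}$. For any such choice let $\beta_\infty\colon P(\overline{\mathbb{Q}})\to\varinjlim_n P_n(\overline{\mathbb{Q}})$ be the induced map to the colimit along the $\beta_{n,m}$, and let $f_\infty=\beta_\infty\circ f\colon Y(\overline{\mathbb{Q}})\to\varinjlim_n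 P_n(\overline{\mathbb{Q}})$. The inclusion $\mathbb{G}_m\hookrightarrow P$, $z\mapsto z\cdot\tilde\infty$, of the fibre over $\infty$ induces a map $\mathbb{Q}\otimes\overline{\mathbb{Q}}^\times\to\varinjlim_n P_n(\overline{\mathbb{Q}})$, sending $1\otimes z$ to $\beta_\infty(z\cdot\tilde\infty)$ and, more generally, $\tfrac{1}{2n^2}\otimes c$ to the class of $c\cdot\beta_n(\tilde\infty)$. This map is injective, and we regard $\mathbb{Q}\otimes\overline{\mathbb{Q}}^\times$ as a subset of the colimit; we write it multiplicatively, so that $b^a$ means $a\otimes b$. Then for every integer $n\ge1$ and every point $Q\in Y(\overline{\mathbb{Q}})$ with $nQ=\infty$, the element $f_\infty(Q)$ lies in $\mathbb{Q}\otimes\overline{\mathbb{Q}}^\times$, the number $(-1)^{n+1}n\cdot\mathrm{Res}_Q(\psi_n^{-1}\omega)$ is nonzero, and $$f_\infty(Q)=\bigl((-1)^{n+1}n\cdot\mathrm{Res}_Q(\psi_n^{-1}\omega)\bigr)^{1/n^2}\quad\text{in }\mathbb{Q}\otimes\overline{\mathbb{Q}}^\times,$$ where $\psi_n$ is the $n$th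 division polynomial and $\omega=\dfrac{dx}{2y+a_1x+a_3}$ is the standard invariant differential. -/

import Mathlib

open scoped TensorProduct Polynomial

noncomputable section

namespace PuncturedElliptic

/-- The field of algebraic numbers. -/
abbrev Qbar : Type := AlgebraicClosure ℚ

instance instDecidableEqQbar : DecidableEq Qbar := Classical.decEq _

/-- The group `E(ℚ̄)` of the elliptic curve `E` with Weierstrass equation `W`. -/
abbrev Pts (W : WeierstrassCurve ℚ) : Type := (W.baseChange Qbar).toAffine.Point

/-! ### The two charts of the elliptic curve -/

/-- `Y` is the affine curve in the coordinates `x, y`, and `U` is the neighbourhood of the origin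
in the coordinates `t = -x/y`, `u = -1/y`, where `t ^ 3 / u` is defined and nonzero. -/
inductive Chart
  | Y
  | U

/-- The open subset of `E` on which a chart is defined. An affine point `(x, y)` lies in `U` iff
`y ≠ 0` and `t ^ 3 / u = x ^ 3 / y ^ 2 ≠ 0`; the origin lies in `U`. -/
def Chart.Mem {W : WeierstrassCurve ℚ} : Chart → Pts W → Prop
  | .Y, .zero => False
  | .Y, .some _ _ _ => True
  | .U, .zero => True
  | .U, .some x y _ => x ≠ 0 ∧ y ≠ 0

/-- The first coordinate, `x` on `Y` and `t = -x/y` on `U` (only used on the chart domain). -/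
def Chart.fst {W : WeierstrassCurve ℚ} : Chart → Pts W → Qbar
  | _, .zero => 0
  | .Y, .some x _ _ => x
  | .U, .some x y _ => -x / y

/-- The second coordinate, `y` on `Y` and `u = -1/y` on `U` (only used on the chart domain). -/
def Chart.snd {W : WeierstrassCurve ℚ} : Chart → Pts W → Qbar
  | _, .zero => 0
  | .Y, .some _ y _ => y
  | .U, .some _ y _ => -1 / y

/-! ### Torsors under the multiplicative group -/

/-- A presentation of a `𝔾ₘ`-torsor over `E` (equivalently, of a line bundle on `E`) by local
frames. Each fibre over a point of `E(ℚ̄)` is given a coordinate in `ℚ̄ˣ`; the algebraic structure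
is carried by local frames: the frame `i` is a generating section of the line bundle over the open
subset `dom i`, and `frame i x` is the coordinate of its value at `x` (meaningful for `x ∈ dom i`
only). -/
structure Torsor (W : WeierstrassCurve ℚ) where
  Idx : Type
  dom : Idx → Set (Pts W)
  frame : Idx → Pts W → Qbar

namespace Torsor

variable {W : WeierstrassCurve ℚ}

/-- The `ℚ̄`-points of the torsor: a point of `E(ℚ̄)` and the coordinate in the fibre over it. -/
@[ext] structure Pt (T : Torsor W) where
  base : Pts W
  coord : Qbarˣ

/-- The action of `𝔾ₘ`. -/
instance (T : Torsor W) : SMul Qbarˣ T.Pt := ⟨fun c p => ⟨p.base, c * p.coord⟩⟩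

/-- The tensor product of torsors (contracted product): the coordinate of `p ⊗ q` is the product
of the coordinates, and the frames are the products of frames. -/
def tensor (T T' : Torsor W) : Torsor W where
  Idx := T.Idx × T'.Idx
  dom i := T.dom i.1 ∩ T'.dom i.2
  frame i x := T.frame i.1 x * T'.frame i.2 x

/-- The tensor power `T^{⊗ a}`, the pushout of `T` along `[a] : 𝔾ₘ → 𝔾ₘ`. -/
def pow (T : Torsor W) (a : ℤ) : Torsor W where
  Idx := T.Idx
  dom := T.dom
  frame i x := T.frame i x ^ a

/-- The pullback of a torsor along `φ : E → E`: its fibre over `x` is the fibre of `T` over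
`φ x`. -/
def pullback (φ : Pts W → Pts W) (T : Torsor W) : Torsor W where
  Idx := T.Idx
  dom i := φ ⁻¹' T.dom i
  frame i x := T.frame i (φ x)

/-- The charts of the total space of a torsor: over the intersection of the domain of a chart of
`E` with the domain of a frame, the total space is a product with `𝔾ₘ`. -/
abbrev ChartIdx (T : Torsor W) : Type := Chart × T.Idx

/-- The domain of a chart of the total space. -/
def chartDom (T : Torsor W) (i : T.ChartIdx) : Set T.Pt :=
  {p | i.1.Mem p.base ∧ p.base ∈ T.dom i.2}

/-- The three coordinates in a chart of the total space: two coordinates of the point of `E`, and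
the scalar `z` with `p = z • frame`. They identify the domain of the chart with a locally closed
subvariety of affine space. -/
def chartCoord (T : Torsor W) (i : T.ChartIdx) (p : T.Pt) : Fin 3 → Qbar :=
  ![i.1.fst p.base, i.1.snd p.base, p.coord / T.frame i.2 p.base]

/-- A map between the `ℚ̄`-points of the total spaces is a morphism of varieties over `ℚ` if,
locally for the Zariski topology, it is given in coordinates by fractions of polynomials with
rational coefficients. -/
def IsRegular {T T' : Torsor W} (φ : T.Pt → T'.Pt) : Prop :=
  ∀ p : T.Pt, ∃ (i : T.ChartIdx) (j : T'.ChartIdx)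
    (num : Fin 3 → MvPolynomial (Fin 3) ℚ) (den : MvPolynomial (Fin 3) ℚ),
    p ∈ T.chartDom i ∧ MvPolynomial.aeval (T.chartCoord i p) den ≠ 0 ∧
    ∀ q ∈ T.chartDom i, MvPolynomial.aeval (T.chartCoord i q) den ≠ 0 →
      φ q ∈ T'.chartDom j ∧ ∀ l, T'.chartCoord j (φ q) l =
        MvPolynomial.aeval (T.chartCoord i q) (num l) / MvPolynomial.aeval (T.chartCoord i q) den

/-- A morphism of varieties over `ℚ` between torsors, lying over `[a] : E → E` and under
`[d] : 𝔾ₘ → 𝔾ₘ`. -/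
structure IsMorphism {T T' : Torsor W} (a d : ℕ) (φ : T.Pt → T'.Pt) : Prop where
  regular : IsRegular φ
  map_base : ∀ p, (φ p).base = a • p.base
  map_smul : ∀ (c : Qbarˣ) (p : T.Pt), φ (c • p) = c ^ d • φ p

end Torsor

/-! ### The torsor of `𝒪(∞)` and its system of isogenies -/

variable (W : WeierstrassCurve ℚ)

/-- The `𝔾ₘ`-torsor `P` of the line bundle `𝒪(∞)`. It is trivialised by the section `1` on `Y` and
by the section `t⁻¹` on `U`. The coordinate in a fibre is taken with respect to the section `1`
over the points of `Y`, and with respect to `t⁻¹` over the origin; so over `Y ∩ U` the frame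
`t⁻¹ = -y/x` has coordinate `-y/x`, and the coordinates `z` and `w` for the two frames are related
by `w = t z`. -/
def P : Torsor W where
  Idx := Chart
  dom i := {x | i.Mem x}
  frame
    | .Y, _ => 1
    | .U, .zero => 1
    | .U, .some x y _ => -y / x

/-- The base point of `P`: the value of `t⁻¹` at the origin, `(t, u, w) = (0, 0, 1)`. -/
def basePt : (P W).Pt := ⟨0, 1⟩

/-- The map `f : Y → P` given by the section `1` of `𝒪(∞)` on `Y = E ∖ {∞}`. -/
def f (x y : Qbar) (h : (W.baseChange Qbar).toAffine.Nonsingular x y) : (P W).Pt :=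
  ⟨.some x y h, 1⟩

/-- `P_n = P^{⊗(1 + n)} ⊗ [-1]^* P^{⊗(1 - n)}`. -/
def Pn (n : ℕ+) : Torsor W :=
  ((P W).pow (1 + (n : ℤ))).tensor (((P W).pullback (fun x => -x)).pow (1 - (n : ℤ)))

/-- A choice of the morphisms `β_n : P → P_n` over `[n]` and under `[2 n²]`, together with the
morphisms `β_{n,m} : P_n → P_{nm}` over `[m]` and under `[m²]` determined by them through
`β_{n,m} ∘ β_n = β_{nm}`. -/
structure IsogenySystem where
  β : ∀ n : ℕ+, (P W).Pt → (Pn W n).Pt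
  β_isMorphism : ∀ n : ℕ+, Torsor.IsMorphism (n : ℕ) (2 * (n : ℕ) ^ 2) (β n)
  trans : ∀ n m : ℕ+, (Pn W n).Pt → (Pn W (n * m)).Pt
  trans_isMorphism : ∀ n m : ℕ+, Torsor.IsMorphism (m : ℕ) ((m : ℕ) ^ 2) (trans n m)
  trans_β : ∀ (n m : ℕ+) (p : (P W).Pt), trans n m (β n p) = β (n * m) p

/-- The group `ℚ ⊗ ℚ̄ˣ`. -/
abbrev QTensorUnits : Type := ℚ ⊗[ℤ] Additive Qbarˣ

lemma QTensorUnits.tmul_zpow (r : ℚ) (c : Qbarˣ) (k : ℤ) :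
    (r ⊗ₜ[ℤ] Additive.ofMul (c ^ k) : QTensorUnits) = ((k : ℚ) * r) ⊗ₜ[ℤ] Additive.ofMul c := by
  rw [← zsmul_eq_mul]
  exact (TensorProduct.smul_tmul k r (Additive.ofMul c)).symm

/-- Every element of `ℚ ⊗ ℚ̄ˣ` is of the form `c ^ (1 / (2 n²))`. -/
lemma QTensorUnits.exists_rep (τ : QTensorUnits) :
    ∃ (n : ℕ+) (c : Qbarˣ), τ = (2 * (n : ℚ) ^ 2)⁻¹ ⊗ₜ[ℤ] Additive.ofMul c := by
  induction τ using TensorProduct.induction_on with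
  | zero => exact ⟨1, 1, by simp⟩
  | tmul r z =>
    refine ⟨r.pnatDen, z.toMul ^ (2 * r.num * r.den), ?_⟩
    rw [QTensorUnits.tmul_zpow, ofMul_toMul]
    congr 1
    have h : (r.den : ℚ) ≠ 0 := by exact_mod_cast r.pos.ne'
    simp only [Rat.coe_pnatDen]
    push_cast
    nth_rewrite 1 [← Rat.num_div_den r]
    field_simp
  | add a b ha hb =>
    obtain ⟨n, c, rfl⟩ := ha
    obtain ⟨m, d, rfl⟩ := hb
    refine ⟨n * m, c ^ ((m : ℤ) ^ 2) * d ^ ((n : ℤ) ^ 2), ?_⟩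
    rw [ofMul_mul, TensorProduct.tmul_add, QTensorUnits.tmul_zpow, QTensorUnits.tmul_zpow]
    have hn : (n : ℚ) ≠ 0 := by exact_mod_cast n.ne_zero
    have hm : (m : ℚ) ≠ 0 := by exact_mod_cast m.ne_zero
    congr 2 <;>
    · simp only [PNat.mul_coe]
      push_cast
      field_simp

/-- Two representatives of the same element of `ℚ ⊗ ℚ̄ˣ` agree up to a power. -/
lemma QTensorUnits.eq_rep {n m : ℕ+} {c d : Qbarˣ}
    (h : (2 * (n : ℚ) ^ 2)⁻¹ ⊗ₜ[ℤ] Additive.ofMul c =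
      ((2 * (m : ℚ) ^ 2)⁻¹ ⊗ₜ[ℤ] Additive.ofMul d : QTensorUnits)) :
    ∃ N : ℕ+, c ^ ((m : ℕ) * N) ^ 2 = d ^ ((n : ℕ) * N) ^ 2 := by
  have hn : (n : ℚ) ≠ 0 := by exact_mod_cast n.ne_zero
  have hm : (m : ℚ) ≠ 0 := by exact_mod_cast m.ne_zero
  have h1 := congrArg (fun τ : QTensorUnits => (2 * (n : ℤ) ^ 2 * (m : ℤ) ^ 2) • τ) h
  simp only [TensorProduct.smul_tmul', zsmul_eq_mul] at h1
  have e1 : ((2 * (n : ℤ) ^ 2 * (m : ℤ) ^ 2 : ℤ) : ℚ) * (2 * (n : ℚ) ^ 2)⁻¹ =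
      ((m : ℤ) ^ 2) • (1 : ℚ) := by
    simp only [zsmul_eq_mul]; push_cast; field_simp
  have e2 : ((2 * (n : ℤ) ^ 2 * (m : ℤ) ^ 2 : ℤ) : ℚ) * (2 * (m : ℚ) ^ 2)⁻¹ =
      ((n : ℤ) ^ 2) • (1 : ℚ) := by
    simp only [zsmul_eq_mul]; push_cast; field_simp
  rw [e1, e2, TensorProduct.smul_tmul, TensorProduct.smul_tmul] at h1
  obtain ⟨⟨N, hN⟩, hs⟩ := (IsLocalizedModule.eq_iff_exists (nonZeroDivisors ℤ)
    (TensorProduct.mk ℤ ℚ (Additive Qbarˣ) 1)).mp h1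
  have hN0 : N ≠ 0 := nonZeroDivisors.ne_zero hN
  refine ⟨⟨N.natAbs, Int.natAbs_pos.mpr hN0⟩, ?_⟩
  rw [Submonoid.mk_smul, Submonoid.mk_smul] at hs
  have hz : c ^ ((m : ℤ) ^ 2 * N) = d ^ ((n : ℤ) ^ 2 * N) := by
    rw [zpow_mul, zpow_mul]
    exact congrArg Additive.toMul hs
  have key : ∀ (e : Qbarˣ) (k : ℕ), e ^ (k * N.natAbs) ^ 2 = (e ^ ((k : ℤ) ^ 2 * N)) ^ N := by
    intro e k
    rw [← zpow_mul, ← zpow_natCast]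
    congr 1
    push_cast
    rw [mul_pow, sq_abs]
    ring
  simp only [PNat.mk_coe]
  rw [key, key, hz]

namespace IsogenySystem

variable {W} (S : IsogenySystem W)

/-- The colimit of the sets `P_n(ℚ̄)` along the maps `β_{n,m}`, over the positive integers ordered
by divisibility. -/
def Colim : Type :=
  Quot fun a b : (Σ n : ℕ+, (Pn W n).Pt) => ∃ m : ℕ+, b = ⟨a.1 * m, S.trans a.1 m a.2⟩

/-- The class of a point of `P_n(ℚ̄)` in the colimit. -/
def cls (n : ℕ+) (p : (Pn W n).Pt) : S.Colim := Quot.mk _ ⟨n, p⟩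

/-- The map `β_∞ : P(ℚ̄) → colim P_n(ℚ̄)` induced by the `β_n`; see `betaInfty_eq`. -/
def betaInfty (p : (P W).Pt) : S.Colim := S.cls 1 (S.β 1 p)

lemma cls_trans (n m : ℕ+) (p : (Pn W n).Pt) : S.cls (n * m) (S.trans n m p) = S.cls n p :=
  (Quot.sound ⟨m, rfl⟩).symm

lemma betaInfty_eq (n : ℕ+) (p : (P W).Pt) : S.betaInfty p = S.cls n (S.β n p) := by
  have h := S.cls_trans 1 n (S.β 1 p)
  rw [S.trans_β] at h
  rw [betaInfty, ← h, one_mul]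

/-- `f_∞ = β_∞ ∘ f`. -/
def fInfty (x y : Qbar) (h : (W.baseChange Qbar).toAffine.Nonsingular x y) : S.Colim :=
  S.betaInfty (f W x y h)

/-- The map `ℚ ⊗ ℚ̄ˣ → colim P_n(ℚ̄)` induced by the inclusion `z ↦ z • ∞̃` of `𝔾ₘ` in `P` as the
fibre over the origin. It sends `c ^ (1 / (2 n²))` to the class of `c • β_n(∞̃)`, see `incl_tmul`;
in particular `z` is sent to `β_∞(z • ∞̃)`, see `incl_one_tmul`. -/
def incl (τ : QTensorUnits) : S.Colim :=
  S.cls τ.exists_rep.choose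
    (τ.exists_rep.choose_spec.choose • S.β τ.exists_rep.choose (basePt W))

lemma cls_smul (n m : ℕ+) (c : Qbarˣ) (p : (P W).Pt) :
    S.cls n (c • S.β n p) = S.cls (n * m) (c ^ (m : ℕ) ^ 2 • S.β (n * m) p) := by
  rw [← S.cls_trans n m, (S.trans_isMorphism n m).map_smul, S.trans_β]

lemma incl_tmul (n : ℕ+) (c : Qbarˣ) :
    S.incl ((2 * (n : ℚ) ^ 2)⁻¹ ⊗ₜ[ℤ] Additive.ofMul c) = S.cls n (c • S.β n (basePt W)) := by
  set τ : QTensorUnits := (2 * (n : ℚ) ^ 2)⁻¹ ⊗ₜ[ℤ] Additive.ofMul c with hτ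
  have hspec := τ.exists_rep.choose_spec.choose_spec
  unfold incl
  generalize τ.exists_rep.choose_spec.choose = d at hspec ⊢
  generalize τ.exists_rep.choose = m at hspec ⊢
  rw [hτ] at hspec
  obtain ⟨N, hN⟩ := QTensorUnits.eq_rep hspec
  rw [S.cls_smul m (n * N), S.cls_smul n (m * N), PNat.mul_coe, PNat.mul_coe, hN,
    mul_left_comm m n N]

lemma incl_one_tmul (z : Qbarˣ) :
    S.incl (1 ⊗ₜ[ℤ] Additive.ofMul z) = S.betaInfty (z • basePt W) := by
  have h := S.incl_tmul 1 (z ^ 2)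
  rw [S.betaInfty_eq 1, (S.β_isMorphism 1).map_smul]
  convert h using 2
  · rw [← zpow_natCast z 2, QTensorUnits.tmul_zpow]
    norm_num
  · simp

end IsogenySystem

/-! ### Residues -/

/-- A local parametrisation of a Weierstrass curve at the affine point `(x₀, y₀)`: power series
`(X(s), Y(s))` on the curve with constant terms `(x₀, y₀)`, such that `s` is a local parameter
(the linear terms of `X` and `Y` do not both vanish). Equivalently, an isomorphism of the completed
local ring of the curve at the point with the ring of power series in `s`. -/
structure LocalParam {k : Type*} [Field k] (V : WeierstrassCurve k) (x₀ y₀ : k) where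
  X : PowerSeries k
  Y : PowerSeries k
  equation : (V.baseChange (PowerSeries k)).toAffine.Equation X Y
  constantCoeff_X : PowerSeries.constantCoeff X = x₀
  constantCoeff_Y : PowerSeries.constantCoeff Y = y₀
  linear : PowerSeries.coeff 1 X ≠ 0 ∨ PowerSeries.coeff 1 Y ≠ 0

namespace LocalParam

variable {k : Type*} [Field k] {V : WeierstrassCurve k} {x₀ y₀ : k}

/-- The Laurent expansion in `s` of the function on the affine curve given by a polynomial in
`x, y`. -/
def eval (γ : LocalParam V x₀ y₀) (g : Polynomial (Polynomial k)) : LaurentSeries k :=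
  HahnSeries.ofPowerSeries ℤ k
    ((g.map (Polynomial.mapRingHom (algebraMap k (PowerSeries k)))).evalEval γ.X γ.Y)

/-- The Laurent expansion of `ω / ds`, where `ω = dx / (2 y + a₁ x + a₃)`. -/
def omega (γ : LocalParam V x₀ y₀) : LaurentSeries k :=
  HahnSeries.ofPowerSeries ℤ k (PowerSeries.derivative k γ.X) /
    γ.eval (Polynomial.C (Polynomial.C 2) * Polynomial.X +
      Polynomial.C (Polynomial.C V.a₁ * Polynomial.X + Polynomial.C V.a₃))

/-- The residue at `(x₀, y₀)` of the differential `h ω`, for a function with Laurent expansion `h`: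
the coefficient of `s⁻¹ ds`. -/
def residue (γ : LocalParam V x₀ y₀) (h : LaurentSeries k) : k :=
  (h * γ.omega).coeff (-1)

/-- Every nonsingular affine point has a local parametrisation. -/
theorem exists_of_nonsingular (h : V.toAffine.Nonsingular x₀ y₀) :
    Nonempty (LocalParam V x₀ y₀) := by
  have hens : ∀ p : Polynomial (PowerSeries k), p.Monic → ∀ a : k,
      PowerSeries.constantCoeff (p.eval (PowerSeries.C a)) = 0 →
      PowerSeries.constantCoeff (p.derivative.eval (PowerSeries.C a)) ≠ 0 →
      ∃ F : PowerSeries k, p.eval F = 0 ∧ PowerSeries.constantCoeff F = a := by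
    intro p hp a h0 h1
    obtain ⟨F, hF, hF'⟩ := HenselianRing.is_henselian
      (I := Ideal.span {(PowerSeries.X : PowerSeries k)}) p hp (PowerSeries.C a)
      (by rwa [Ideal.mem_span_singleton, PowerSeries.X_dvd_iff])
      ((PowerSeries.isUnit_iff_constantCoeff.mpr (isUnit_iff_ne_zero.mpr h1)).map _)
    rw [Ideal.mem_span_singleton, PowerSeries.X_dvd_iff, map_sub, sub_eq_zero] at hF'
    exact ⟨F, hF, by simpa using hF'⟩
  have h2 : PowerSeries.constantCoeff (2 : PowerSeries k) = 2 := map_ofNat _ 2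
  have h3 : PowerSeries.constantCoeff (3 : PowerSeries k) = 3 := map_ofNat _ 3
  rw [WeierstrassCurve.Affine.nonsingular_iff', WeierstrassCurve.Affine.equation_iff'] at h
  obtain ⟨heq, hx | hy⟩ := h
  · obtain ⟨F, hF, hF0⟩ := hens
      (.X ^ 3 + .C (.C V.a₂) * .X ^ 2 +
        .C (.C V.a₄ - .C V.a₁ * (.C y₀ + PowerSeries.X)) * .X +
        .C (.C V.a₆ - (.C y₀ + PowerSeries.X) ^ 2 - .C V.a₃ * (.C y₀ + PowerSeries.X)))
      (by monicity!) x₀ (by simp; linear_combination -heq)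
      (by
        simp only [Polynomial.derivative_add, Polynomial.derivative_mul,
          Polynomial.derivative_C, Polynomial.derivative_X_pow, Polynomial.derivative_X]
        simp
        intro h
        apply hx
        linear_combination -h + V.a₂ * x₀ * h2 + x₀ ^ 2 * h3)
    refine ⟨⟨F, .C y₀ + .X, ?_, hF0, by simp, .inr (by simp)⟩⟩
    rw [WeierstrassCurve.Affine.equation_iff']
    simp at hF
    change _ + PowerSeries.C V.a₁ * _ * _ + PowerSeries.C V.a₃ * _ - (_ + PowerSeries.C V.a₂ * _ +
      PowerSeries.C V.a₄ * _ + PowerSeries.C V.a₆) = 0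
    linear_combination -hF
  · obtain ⟨F, hF, hF0⟩ := hens
      (.X ^ 2 + .C (.C V.a₁ * (.C x₀ + PowerSeries.X) + .C V.a₃) * .X -
        .C ((.C x₀ + PowerSeries.X) ^ 3 + .C V.a₂ * (.C x₀ + PowerSeries.X) ^ 2 +
          .C V.a₄ * (.C x₀ + PowerSeries.X) + .C V.a₆))
      (by monicity!) y₀ (by simp; linear_combination heq)
      (by
        simp only [Polynomial.derivative_add, Polynomial.derivative_sub, Polynomial.derivative_mul,
          Polynomial.derivative_C, Polynomial.derivative_X_pow, Polynomial.derivative_X]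
        simp
        intro h
        apply hy
        linear_combination h - y₀ * h2)
    refine ⟨⟨.C x₀ + .X, F, ?_, by simp, hF0, .inl (by simp)⟩⟩
    rw [WeierstrassCurve.Affine.equation_iff']
    simp at hF
    change _ + PowerSeries.C V.a₁ * _ * _ + PowerSeries.C V.a₃ * _ - (_ + PowerSeries.C V.a₂ * _ +
      PowerSeries.C V.a₄ * _ + PowerSeries.C V.a₆) = 0
    linear_combination hF

end LocalParam

end PuncturedElliptic

end

/-!
Write `ψₙ`, `φₙ`, `ωₙ` for the division polynomials, so that `nP = (φₙ / ψₙ², ωₙ / ψₙ³)`.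

*Isogenies of torsors.* In the frame of `P` given by the section `1`, a morphism `P → P_n` over
`[n]` and under `[2 n²]` is a rational function on `E` with prescribed divisor, and `ψₙ⁻²` is one:
with `t = -x/y` one has `t(nP) = ± t ^ n² ψₙ` to leading order at the origin, and
`t(nP) = -ψₙ φₙ / ωₙ` near an affine point killed by `n`, so that `ψₙ⁻²` becomes a unit in the local
frames (`isMorphism_isog_P`, `isMorphism_isog_Pn`). Such a morphism is unique up to a scalar
(`Torsor.IsMorphism.exists_eq_smul`), because a nowhere vanishing regular function on `E` is
constant: by the Nullstellensatz it is a unit of the affine coordinate ring, whose norm to `k[x]`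
has degree zero (`exists_const_of_regE`). Hence the compositions required of a system of isogenies
hold up to a scalar, which is found to be `1` at the base point (`divisionSystem`).

*Injectivity.* If a point of `P` is a multiple by `c` of the base point after applying `β_N`, then
`c ^ (1 / (2 N²))` depends only on its image in the colimit, as the `β_n` are surjective on points
(`colimValues`).

*The formula.* By uniqueness it suffices to compute `β_n ∘ f` with the section `ψₙ⁻²`. Where
`nQ = ∞`, the value relative to `β_n(∞̃)` is the limit `φₙ(Q)⁻¹`
(`IsogenySystem.β_f_of_nsmul_eq_zero`). On the other hand `[n]^* ω = n ω` gives the Wronskian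
identity `φₙ' ψₙ - 2 φₙ ψₙ' = 2 n ωₙ` at `Q`, where `'` is the derivative with respect to
`ω`. So the zero of `ψₙ` at `Q` is simple and `n Res_Q (ψₙ⁻¹ ω) = -φₙ / ωₙ`; as `ωₙ² = φₙ³` at `Q`,
the square of the residue expression is `φₙ(Q)⁻¹` (`LocalParam.residue_psi_inv_sq_mul`). The
residue is therefore determined up to sign by `f_∞(Q)`, and the sign is trivial in `ℚ ⊗ ℚ̄ˣ`.

*Division polynomials.* The multiples of a point are first found where no `ψₙ` vanishes
(`nsmul_psiAt_of_generic`), which applies to the generic point of a local parametrisation. The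
resulting polynomial identities specialise to all points (`divisionIdentities`), and give the
coordinates of `nP` for every `P`, including the torsion points (`hasX_nsmul`, `nsmul_twoY`).
-/

namespace WeierstrassCurve

/-! ### Addition formulas for the `x`-coordinate -/

section PointFormulas

section Defs

variable {R : Type*} [CommRing R] (V : WeierstrassCurve R)

/-- The value `2 y + a₁ x + a₃` of the `2`-division polynomial. -/
def twoY (x y : R) : R := 2 * y + V.a₁ * x + V.a₃

/-- The numerator of `x(A + B) + x(A - B)` as a function of the `x`-coordinates of `A, B`. -/
def addSubSum (a b : R) : R := 2 * a * b * (a + b) + V.b₂ * a * b + V.b₄ * (a + b) + V.b₆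

/-- The numerator of `x(A + B) * x(A - B)` as a function of the `x`-coordinates of `A, B`. -/
def addSubProd (a b : R) : R := a ^ 2 * b ^ 2 - V.b₄ * a * b - V.b₆ * (a + b) - V.b₈

/-- The cubic in `x` that equals the square of `twoY` on the curve. -/
def twoYSq (x : R) : R := 4 * x ^ 3 + V.b₂ * x ^ 2 + 2 * V.b₄ * x + V.b₆

end Defs

variable {F : Type*} [Field F] {V : WeierstrassCurve F}

lemma twoY_sq {x y : F} (h : V.toAffine.Equation x y) : V.twoY x y ^ 2 = V.twoYSq x := by
  rw [Affine.equation_iff] at h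
  simp only [twoY, twoYSq, b₂, b₄, b₆]
  linear_combination 4 * h

lemma twoY_eq_sub_negY (x y : F) : V.twoY x y = y - V.toAffine.negY x y := by
  simp only [twoY, Affine.negY]; ring

lemma twoY_negY (x y : F) : V.twoY x (V.toAffine.negY x y) = -V.twoY x y := by
  simp only [twoY, Affine.negY]; ring

variable [DecidableEq F]

/-- The sum, the product and the difference of `x(A + B)` and `x(A - B)`. -/
lemma exists_add_sub_of_X_ne {a a' b b' : F} (hA : V.toAffine.Nonsingular a a')
    (hB : V.toAffine.Nonsingular b b') (hab : a ≠ b) :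
    ∃ (x y : F) (h : V.toAffine.Nonsingular x y) (x' y' : F) (h' : V.toAffine.Nonsingular x' y'),
      Affine.Point.some a a' hA + .some b b' hB = .some x y h ∧
      Affine.Point.some a a' hA - .some b b' hB = .some x' y' h' ∧
      (x + x') * (a - b) ^ 2 = V.addSubSum a b ∧ x * x' * (a - b) ^ 2 = V.addSubProd a b ∧
      (x - x') * (a - b) ^ 2 = - (V.twoY a a' * V.twoY b b') := by
  have h0 : a - b ≠ 0 := sub_ne_zero.mpr hab
  have eA := (Affine.equation_iff ..).mp hA.1
  have eB := (Affine.equation_iff ..).mp hB.1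
  refine ⟨_, _, _, _, _, _, Affine.Point.add_of_X_ne hab, by
    rw [sub_eq_add_neg, Affine.Point.neg_some, Affine.Point.add_of_X_ne hab], ?_, ?_, ?_⟩
  · rw [Affine.slope_of_X_ne hab, Affine.slope_of_X_ne hab]
    simp only [Affine.addX, Affine.negY, addSubSum, b₂, b₄, b₆]
    field_simp
    linear_combination 2 * eA + 2 * eB
  · rw [Affine.slope_of_X_ne hab, Affine.slope_of_X_ne hab]
    simp only [Affine.addX, Affine.negY, addSubProd, b₄, b₆, b₈]
    field_simp
    grind
  · rw [Affine.slope_of_X_ne hab, Affine.slope_of_X_ne hab]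
    simp only [Affine.addX, Affine.negY, twoY]
    field_simp
    ring

/-- The duplication formulas. -/
lemma exists_add_self {a a' : F} (hA : V.toAffine.Nonsingular a a') (h2 : V.twoY a a' ≠ 0) :
    ∃ (x y : F) (h : V.toAffine.Nonsingular x y),
      Affine.Point.some a a' hA + .some a a' hA = .some x y h ∧
      x * V.twoY a a' ^ 2 = V.addSubProd a a ∧
      V.twoY x y * V.twoY a a' ^ 3 = V.preΨ₄.eval a := by
  have eA := (Affine.equation_iff ..).mp hA.1
  have hy : a' ≠ V.toAffine.negY a a' := by rwa [twoY_eq_sub_negY, sub_ne_zero] at h2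
  refine ⟨_, _, _, Affine.Point.add_self_of_Y_ne hy, ?_, ?_⟩
  · rw [Affine.slope_of_Y_ne rfl hy, ← twoY_eq_sub_negY]
    simp only [Affine.addX, addSubProd]
    field_simp
    simp only [twoY, b₄, b₆, b₈]
    grind
  · rw [Affine.slope_of_Y_ne rfl hy, ← twoY_eq_sub_negY]
    generalize hd : V.twoY a a' = d at *
    simp only [Affine.addX, Affine.addY, Affine.negAddY, Affine.negY, preΨ₄, twoY]
    field_simp
    subst hd
    simp only [twoY, b₂, b₄, b₆, b₈]
    simp
    grind

end PointFormulas

/-! ### Projective `x`-coordinates -/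

section HasX

variable {F : Type*} [Field F] {V : WeierstrassCurve F}

/-- The numerator and the denominator of `x(2P)` have no common zero. -/
lemma addSubProd_self_ne_zero [V.IsElliptic] {b : F} (h : V.twoYSq b = 0) :
    V.addSubProd b b ≠ 0 := by
  have key := V.addSubMap_ne_zero (x := ![b ^ 2, 2 * b, 1]) (by
    intro h; simpa using congrFun h 2)
  contrapose! key
  simp only [twoYSq, addSubProd] at h key
  ext i
  fin_cases i
  · simp [addSubMap]; linear_combination key
  · simp [addSubMap]; linear_combination h
  · simp [addSubMap]; ring

variable (V) in
/-- The `x`-coordinate of a point is `u / v`, where `u ≠ 0` and `v = 0` at the origin. -/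
def HasX : V.toAffine.Point → F → F → Prop
  | .zero, u, v => v = 0 ∧ u ≠ 0
  | .some x _ _, u, v => v ≠ 0 ∧ x * v = u

@[simp] lemma hasX_zero {u v : F} : V.HasX 0 u v ↔ v = 0 ∧ u ≠ 0 := Iff.rfl

@[simp] lemma hasX_some {x y u v : F} {h : V.toAffine.Nonsingular x y} :
    V.HasX (.some x y h) u v ↔ v ≠ 0 ∧ x * v = u := Iff.rfl

variable [DecidableEq F]

/-- If `A` and `A - B` have `x`-coordinates `u / v` and `u' / v'`, then `A + B` has `x`-coordinate
`u'' / v''` as soon as the symmetric functions of `(u'' : v'')` and `(u' : v')` are the ones given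
by the addition-and-subtraction map; this includes all degenerate positions of `A` and `B`. -/
lemma HasX.add [V.IsElliptic] {A : V.toAffine.Point} {b b' : F} {hB : V.toAffine.Nonsingular b b'}
    {u v u' v' u'' v'' : F}
    (hA : V.HasX A u v) (hsub : V.HasX (A - .some b b' hB) u' v')
    (h1 : u'' * u' = u ^ 2 * b ^ 2 - V.b₄ * u * v * b - V.b₆ * (u + v * b) * v - V.b₈ * v ^ 2)
    (h2 : u'' * v' + u' * v'' = 2 * u * b * (u + b * v) + V.b₂ * u * v * b +
      V.b₄ * (u + b * v) * v + V.b₆ * v ^ 2)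
    (h3 : v'' * v' = (u - b * v) ^ 2) : V.HasX (A + .some b b' hB) u'' v'' := by
  rcases A with _ | ⟨a, a', hA'⟩
  · change V.HasX (0 - _) _ _ at hsub
    change V.HasX (0 + _) _ _
    rw [zero_sub, Affine.Point.neg_some] at hsub
    rw [zero_add]
    obtain ⟨rfl, hu⟩ := hA
    obtain ⟨hv, rfl⟩ := hsub
    refine ⟨fun h => ?_, mul_right_cancel₀ hv ?_⟩
    · rw [h] at h3; simp at h3; exact hu (pow_eq_zero_iff two_ne_zero |>.mp h3.symm)
    · linear_combination -h2 + 2 * b * h3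
  · obtain ⟨hv, rfl⟩ := hA
    by_cases hab : a = b
    · subst hab
      have hY : a' = b' ∨ a' = V.toAffine.negY a b' := Affine.Y_eq_of_X_eq hA'.1 hB.1 rfl
      have h2' : u'' * v' + u' * v'' = v ^ 2 * V.twoYSq a := by
        rw [h2, twoYSq]; ring
      have h1' : u'' * u' = v ^ 2 * V.addSubProd a a := by
        rw [h1, addSubProd]; ring
      have h3' : v'' * v' = 0 := by rw [h3]; ring
      -- If `2 B = 0` then `A = B`; otherwise `A = B` and `A - B = 0`, or `A = -B` and
      -- `A - B = -2 B`.
      by_cases ht : V.twoY a b' = 0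
      · have ht' : b' = V.toAffine.negY a b' := by rwa [twoY_eq_sub_negY, sub_eq_zero] at ht
        have : a' = b' := by rcases hY with h | h; exacts [h, h.trans ht'.symm]
        subst this
        rw [sub_self] at hsub
        rw [Affine.Point.add_self_of_Y_eq ht']
        obtain ⟨rfl, hu⟩ := hsub
        have hs : V.twoYSq a = 0 := by rw [← twoY_sq hA'.1, ht]; ring
        rw [hs] at h2'
        have := addSubProd_self_ne_zero hs
        refine ⟨by simpa [hu] using h2', fun h => ?_⟩
        rw [h] at h1'; simp [hv, this] at h1'
      · have hs : V.twoYSq a ≠ 0 := by rw [← twoY_sq hB.1]; exact pow_ne_zero 2 ht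
        rcases hY with rfl | rfl
        · rw [sub_self] at hsub
          obtain ⟨rfl, hu⟩ := hsub
          obtain ⟨x, y, h, e, hx, -⟩ := exists_add_self hA' ht
          rw [e]
          rw [twoY_sq hA'.1] at hx
          refine ⟨fun h => ?_, ?_⟩
          · rw [h] at h2'; simp [hv, hs] at h2'
          · have : x * v'' * (u' * V.twoYSq a) = u'' * (u' * V.twoYSq a) := by
              linear_combination -V.twoYSq a * h1' + v ^ 2 * V.twoYSq a * hx +
                x * V.twoYSq a * h2'
            exact mul_right_cancel₀ (mul_ne_zero hu hs) this
        · rw [Affine.Point.add_of_Y_eq rfl rfl]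
          have e0 : Affine.Point.some a _ hA' = - Affine.Point.some a b' hB := by
            rw [Affine.Point.neg_some]
          obtain ⟨x, y, h, e, -, -⟩ := exists_add_self hB ht
          have e2 : Affine.Point.some a _ hA' - Affine.Point.some a b' hB = - .some x y h := by
            rw [e0, ← e]; abel
          rw [e2, Affine.Point.neg_some] at hsub
          have hv' := hsub.1
          have : v'' = 0 := by simpa [hv'] using h3'
          refine ⟨this, fun h => ?_⟩
          rw [this, h] at h2'; simp [hv, hs] at h2'
    · obtain ⟨x, y, h, x', y', h', e, e', hs, hp, -⟩ := exists_add_sub_of_X_ne hA' hB hab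
      have h0 : a - b ≠ 0 := sub_ne_zero.mpr hab
      rw [e]
      rw [e'] at hsub
      obtain ⟨hv', rfl⟩ := hsub
      have hv'' : v'' ≠ 0 := by
        rintro rfl
        have : (a - b) ^ 2 * v ^ 2 = 0 := by linear_combination -h3
        simp [h0, hv] at this
      refine ⟨hv'', ?_⟩
      have : (x * v'' - u'') * v' = 0 := by
        simp only [addSubSum] at hs
        linear_combination -h2 + (x + x') * h3 + v ^ 2 * hs
      exact sub_eq_zero.mp ((mul_eq_zero.mp this).resolve_right hv')

end HasX

/-! ### The invariant differential -/

section Deriv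

variable {R : Type*} [CommRing R]

/-- For a derivation `D` that kills the coefficients of the curve, the value `s` of the invariant
differential on the tangent vector `(D x, D y)` at the point `(x, y)`. -/
structure HasSpeed (V : WeierstrassCurve R) (D : Derivation ℤ R R) (x y s : R) : Prop where
  dx : D x = s * V.twoY x y
  dy : D y = s * (3 * x ^ 2 + 2 * V.a₂ * x + V.a₄ - V.a₁ * y)

/-- A derivation kills the coefficients of the curve. -/
structure IsConstFor (V : WeierstrassCurve R) (D : Derivation ℤ R R) : Prop where
  a₁ : D V.a₁ = 0
  a₂ : D V.a₂ = 0
  a₃ : D V.a₃ = 0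
  a₄ : D V.a₄ = 0
  a₆ : D V.a₆ = 0

lemma IsConstFor.twoY_mul {V : WeierstrassCurve R} {D : Derivation ℤ R R} (hD : V.IsConstFor D)
    {x y : R} (h : V.toAffine.Equation x y) :
    V.twoY x y * D y = (3 * x ^ 2 + 2 * V.a₂ * x + V.a₄ - V.a₁ * y) * D x := by
  rw [Affine.equation_iff] at h
  have := congrArg D h
  simp only [map_add, Derivation.leibniz, Derivation.leibniz_pow, hD.a₁, hD.a₂, hD.a₃, hD.a₄,
    hD.a₆, smul_eq_mul, nsmul_eq_mul] at this
  simp only [twoY]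
  push_cast at this
  linear_combination this

variable {F : Type*} [Field F] {V : WeierstrassCurve F} {D : Derivation ℤ F F}

lemma IsConstFor.hasSpeed (hD : V.IsConstFor D) {x y s : F} (h : V.toAffine.Equation x y)
    (h0 : V.twoY x y ≠ 0) (hx : D x = s * V.twoY x y) : V.HasSpeed D x y s := by
  refine ⟨hx, mul_left_cancel₀ h0 ?_⟩
  rw [hD.twoY_mul h, hx]; ring

variable [DecidableEq F]

/-- Additivity of the invariant differential, in the `x`-coordinate, for points with distinct
`x`-coordinates. -/
lemma IsConstFor.deriv_addX (hD : V.IsConstFor D) {a a' b b' s t : F}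
    (hA : V.toAffine.Equation a a') (hB : V.toAffine.Equation b b') (hab : a ≠ b)
    (hs : V.HasSpeed D a a' s)
    (ht : V.HasSpeed D b b' t) :
    D (V.toAffine.addX a b (V.toAffine.slope a b a' b')) =
      (s + t) * V.twoY (V.toAffine.addX a b (V.toAffine.slope a b a' b'))
        (V.toAffine.addY a b a' (V.toAffine.slope a b a' b')) := by
  have h0 : a - b ≠ 0 := sub_ne_zero.mpr hab
  rw [Affine.equation_iff] at hA hB
  have hl : V.toAffine.slope a b a' b' * (a - b) = a' - b' := by
    rw [Affine.slope_of_X_ne hab, div_mul_cancel₀ _ h0]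
  generalize V.toAffine.slope a b a' b' = l at *
  have hDl := congrArg D hl
  simp only [Derivation.leibniz, map_sub, smul_eq_mul, hs.dx, hs.dy, ht.dx, ht.dy] at hDl
  simp only [Affine.addX, Affine.addY, Affine.negAddY, Affine.negY, map_add, map_sub,
    Derivation.leibniz, Derivation.leibniz_pow, hD.a₁, hD.a₂, smul_eq_mul, nsmul_eq_mul,
    hs.dx, ht.dx, twoY] at hDl ⊢
  obtain rfl : a' = l * (a - b) + b' := by linear_combination -hl
  apply mul_left_cancel₀ h0
  push_cast
  generalize D l = m at *
  have hE : l * (l * (a - b) + 2 * b') + V.a₁ * (a * l + b') + V.a₃ * l =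
      a ^ 2 + a * b + b ^ 2 + V.a₂ * (a + b) + V.a₄ := by
    apply mul_left_cancel₀ h0
    linear_combination hA - hB
  linear_combination (2 * l + V.a₁) * hDl + (t - s) * (2 * l + V.a₁) * hE

/-- Duplication multiplies the invariant differential by two. -/
lemma IsConstFor.deriv_dblX (hD : V.IsConstFor D) {a a' s : F}
    (h0 : V.twoY a a' ≠ 0) (hs : V.HasSpeed D a a' s) :
    D (V.toAffine.addX a a (V.toAffine.slope a a a' a')) =
      (2 * s) * V.twoY (V.toAffine.addX a a (V.toAffine.slope a a a' a'))
        (V.toAffine.addY a a a' (V.toAffine.slope a a a' a')) := by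
  have hy : a' ≠ V.toAffine.negY a a' := by rwa [twoY_eq_sub_negY, sub_ne_zero] at h0
  have hl : V.toAffine.slope a a a' a' * V.twoY a a' =
      3 * a ^ 2 + 2 * V.a₂ * a + V.a₄ - V.a₁ * a' := by
    rw [Affine.slope_of_Y_ne rfl hy, ← twoY_eq_sub_negY, div_mul_cancel₀ _ h0]
  generalize V.toAffine.slope a a a' a' = l at *
  have hDl := congrArg D hl
  have two : D (2 : F) = 0 := by simpa using D.map_natCast 2
  have three : D (3 : F) = 0 := by simpa using D.map_natCast 3
  simp only [Derivation.leibniz, map_sub, map_add, smul_eq_mul, twoY, Derivation.leibniz_pow,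
    hD.a₁, hD.a₂, hD.a₃, hD.a₄, nsmul_eq_mul, hs.dx, hs.dy, two, three] at hDl
  simp only [Affine.addX, Affine.addY, Affine.negAddY, Affine.negY, map_add, map_sub,
    Derivation.leibniz, Derivation.leibniz_pow, hD.a₁, hD.a₂, smul_eq_mul, nsmul_eq_mul,
    hs.dx, twoY] at hDl ⊢
  apply mul_left_cancel₀ h0
  simp only [twoY] at *
  push_cast at *
  generalize D l = m at *
  grind

end Deriv

/-! ### Division polynomials and multiples of a point of infinite order -/

section PsiAt

variable {R : Type*} [CommRing R] (V : WeierstrassCurve R) (x y : R)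

/-- The value at `(x, y)` of the division polynomial `ψₙ`. -/
noncomputable def psiAt (n : ℤ) : R := (V.ψ n).evalEval x y

/-- The value at `(x, y)` of the polynomial `φₙ`. -/
noncomputable def phiAt (n : ℤ) : R :=
  x * V.psiAt x y n ^ 2 - V.psiAt x y (n + 1) * V.psiAt x y (n - 1)

@[simp] lemma psiAt_zero : V.psiAt x y 0 = 0 := by simp [psiAt]

@[simp] lemma psiAt_one : V.psiAt x y 1 = 1 := by simp [psiAt]

@[simp] lemma psiAt_neg (n : ℤ) : V.psiAt x y (-n) = -V.psiAt x y n := by simp [psiAt]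

lemma evalEval_ψ₂ : V.ψ₂.evalEval x y = V.twoY x y := by
  simp [ψ₂, twoY, Affine.evalEval_polynomialY]

@[simp] lemma psiAt_two : V.psiAt x y 2 = V.twoY x y := by simp [psiAt, evalEval_ψ₂]

lemma psiAt_three : V.psiAt x y 3 = V.Ψ₃.eval x := by simp [psiAt, Polynomial.evalEval_C]

lemma psiAt_four : V.psiAt x y 4 = V.preΨ₄.eval x * V.twoY x y := by
  simp [psiAt, evalEval_ψ₂, Polynomial.evalEval_C]

lemma psiAt_even (m : ℤ) : V.psiAt x y (2 * m) * V.twoY x y =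
    V.psiAt x y (m - 1) ^ 2 * V.psiAt x y m * V.psiAt x y (m + 2) -
      V.psiAt x y (m - 2) * V.psiAt x y m * V.psiAt x y (m + 1) ^ 2 := by
  have := congrArg (Polynomial.evalEval x y) (V.ψ_even m)
  simpa [psiAt, Polynomial.evalEval_mul, Polynomial.evalEval_sub, Polynomial.evalEval_pow,
    evalEval_ψ₂] using this

lemma psiAt_odd (m : ℤ) : V.psiAt x y (2 * m + 1) =
    V.psiAt x y (m + 2) * V.psiAt x y m ^ 3 - V.psiAt x y (m - 1) * V.psiAt x y (m + 1) ^ 3 := by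
  have := congrArg (Polynomial.evalEval x y) (V.ψ_odd m)
  simpa [psiAt, Polynomial.evalEval_mul, Polynomial.evalEval_sub, Polynomial.evalEval_pow]
    using this

end PsiAt

section Generic

variable {F : Type*} [Field F] {V : WeierstrassCurve F} [DecidableEq F]

variable {x y : F} {h : V.toAffine.Nonsingular x y}

/-- The multiples of a point at which no division polynomial vanishes have the expected
coordinates. For `n = 2 m` the coordinates of `nP` are found from those of `(m - 1) P, m P` and
`(m + 1) P`, and for `n = 2 m + 1` from those of `m P` and `(m + 1) P`. -/
lemma nsmul_psiAt_of_generic (h : V.toAffine.Nonsingular x y)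
    (h0 : ∀ n : ℕ, 0 < n → V.psiAt x y n ≠ 0) (n : ℕ) (hn : 0 < n) :
    ∃ (X Y : F) (hX : V.toAffine.Nonsingular X Y), n • Affine.Point.some x y h = .some X Y hX ∧
      (x - X) * V.psiAt x y n ^ 2 = V.psiAt x y (n + 1) * V.psiAt x y (n - 1) ∧
      V.twoY X Y * V.psiAt x y n ^ 4 = V.psiAt x y (2 * n) := by
  set P := Affine.Point.some x y h with hP
  set e : ℤ → F := V.psiAt x y with he
  -- The formulas for `x(nP)` and for `y(nP)`.
  let SX : ℕ → Prop := fun n => ∃ (X Y : F) (hX : V.toAffine.Nonsingular X Y),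
    n • P = .some X Y hX ∧ (x - X) * e n ^ 2 = e (n + 1) * e (n - 1)
  let SY : ℕ → Prop := fun n => ∀ (X Y : F) (hX : V.toAffine.Nonsingular X Y),
    n • P = .some X Y hX → V.twoY X Y * e n ^ 4 = e (2 * n)
  have e1 : e 1 = 1 := V.psiAt_one x y
  have e2 : e 2 = V.twoY x y := V.psiAt_two x y
  have hy0 : V.twoY x y ≠ 0 := by rw [← e2]; exact h0 2 two_pos
  have SX1 : SX 1 := ⟨x, y, h, one_smul ℕ P, by simp [he]⟩
  have SY1 : SY 1 := by
    intro X Y hX hE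
    rw [one_smul, hP, Affine.Point.some.injEq] at hE
    obtain ⟨rfl, rfl⟩ := hE
    simp [he]
  have SXY2 : SX 2 ∧ SY 2 := by
    obtain ⟨X, Y, hX, hE, hx, hy⟩ := exists_add_self h hy0
    rw [← two_nsmul] at hE
    refine ⟨⟨X, Y, hX, hE, ?_⟩, ?_⟩
    · push_cast
      rw [e1, e2, he, psiAt_three]
      have := twoY_sq h.1
      simp only [addSubProd, twoYSq, Ψ₃] at *
      simp
      linear_combination x * this - hx
    · intro X' Y' hX' hE'
      rw [hE, Affine.Point.some.injEq] at hE'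
      obtain ⟨rfl, rfl⟩ := hE'
      push_cast
      rw [e2, he, psiAt_four, ← hy]; ring
  have hne : ∀ n : ℤ, 0 < n → e n ≠ 0 := by
    intro n hn
    lift n to ℕ using hn.le
    exact h0 n (by exact_mod_cast hn)
  -- `y(nP)` is found by comparing `x(nP + P)` with `x(nP - P)`.
  have hSY : ∀ j : ℕ, SX (j + 1) → SX (j + 2) → SX (j + 3) → SY (j + 2) := by
    intro j ⟨X1, Y1, hX1, hE1, hx1⟩ ⟨X, Y, hX, hE, hx⟩ ⟨X2, Y2, hX2, hE2, hx2⟩ X' Y' hX' hE'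
    rw [hE, Affine.Point.some.injEq] at hE'
    obtain ⟨rfl, rfl⟩ := hE'
    have ev := V.psiAt_even x y (j + 2)
    push_cast at hx1 hx hx2 ⊢
    simp only [add_sub_assoc, add_assoc] at hx1 hx hx2 ev
    norm_num at hx1 hx hx2 ev
    have ha := hne (j + 1) (by omega)
    have hb := hne (j + 2) (by omega)
    have hc := hne (j + 3) (by omega)
    have hXx : X ≠ x := by
      rintro rfl
      rw [sub_self, zero_mul] at hx
      exact mul_ne_zero hc ha hx.symm
    obtain ⟨x3, y3, h3, x4, y4, h4, hs, hd, -, -, hI⟩ := exists_add_sub_of_X_ne hX h hXx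
    rw [← hE, ← hP, ← succ_nsmul, hE2, Affine.Point.some.injEq] at hs
    rw [← hE, ← hP, succ_nsmul, add_sub_cancel_right, hE1, Affine.Point.some.injEq] at hd
    obtain ⟨rfl, rfl⟩ := hs
    obtain ⟨rfl, rfl⟩ := hd
    apply mul_right_cancel₀ (mul_ne_zero hy0 (pow_ne_zero 2 (mul_ne_zero ha hc)))
    linear_combination (e (j + 2) ^ 4 * (e (j + 1) * e (j + 3)) ^ 2) * hI -
      (e (j + 1) * e (j + 3)) ^ 2 * ev -
      (X2 - X1) * (e (j + 1) * e (j + 3)) ^ 2 * (e (j + 3) * e (j + 1) + (x - X) * e (j + 2) ^ 2)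
       * hx + e (j + 1) ^ 4 * e (j + 3) ^ 2 * hx2 - e (j + 1) ^ 2 * e (j + 3) ^ 4 * hx1
  have hdiff : ∀ (m : ℕ) (X X' : F), (x - X) * e m ^ 2 = e (m + 1) * e (m - 1) →
      (x - X') * e (m + 1) ^ 2 = e (m + 2) * e m →
      (X - X') * (e m ^ 2 * e (m + 1) ^ 2) = e (2 * m + 1) := by
    intro m X X' hX hX'
    have od := V.psiAt_odd x y m
    linear_combination e m ^ 2 * hX' - e (m + 1) ^ 2 * hX - od
  have key : ∀ n : ℕ, 0 < n → SX n := by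
    intro n
    induction n using Nat.strong_induction_on with
    | _ n ih =>
    intro hn
    rcases n with _ | _ | _ | n
    · omega
    · exact SX1
    · exact SXY2.1
    have hY : ∀ m : ℕ, 0 < m → m ≤ 2 ∨ m + 1 < n + 3 → SY m := by
      intro m hm hm'
      rcases m with _ | _ | j
      · omega
      · exact SY1
      rcases j with _ | j
      · exact SXY2.2
      · exact hSY (j + 1) (ih _ (by omega) (by omega)) (ih _ (by omega) (by omega))
          (ih _ (by omega) (by omega))
    -- For even indices `nP` is found by duplication, for odd ones from `(m + 1)P + mP` and
    -- `(m + 1)P - mP = P`.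
    obtain ⟨m, hm⟩ := Nat.even_or_odd' (n + 3)
    rcases hm with hm | hm
    · obtain ⟨j, rfl⟩ : ∃ j, m = j + 2 := ⟨m - 2, by omega⟩
      have hYm := hY (j + 2) (by omega) (by omega)
      obtain ⟨X4, Y4, hX4, hE4, hx4⟩ := ih (j + 1) (by omega) (by omega)
      obtain ⟨X, Y, hX, hE, hx⟩ := ih (j + 2) (by omega) (by omega)
      obtain ⟨X3, Y3, hX3, hE3, hx3⟩ := ih (j + 3) (by omega) (by omega)
      replace hYm := hYm X Y hX hE
      rw [hm]
      have d1 := hdiff (j + 1) X4 X hx4 (by convert hx using 3 <;> push_cast <;> ring_nf)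
      have d2 := hdiff (j + 2) X X3 hx (by convert hx3 using 3 <;> push_cast <;> ring_nf)
      push_cast at hx4 hx hx3 hYm d1 d2
      simp only [add_sub_assoc, add_assoc, mul_add] at hx4 hx hx3 d1 d2 hYm
      norm_num at hx4 hx hx3 d1 d2 hYm
      have ha := hne (j + 1) (by omega)
      have hb := hne (j + 2) (by omega)
      have hc := hne (j + 3) (by omega)
      have hd := hne (2 * j + 4) (by omega)
      have hXx : X ≠ x := by
        rintro rfl
        rw [sub_self, zero_mul] at hx
        exact mul_ne_zero hc ha hx.symm
      have hA0 : V.twoY X Y ≠ 0 := by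
        intro h; rw [h, zero_mul] at hYm; exact hd hYm.symm
      obtain ⟨x3, y3, h3, x4, y4, h4, hs, hd, hS, hPr, -⟩ := exists_add_sub_of_X_ne hX h hXx
      rw [← hE, ← hP, ← succ_nsmul, hE3, Affine.Point.some.injEq] at hs
      rw [← hE, ← hP, succ_nsmul, add_sub_cancel_right, hE4, Affine.Point.some.injEq] at hd
      obtain ⟨rfl, rfl⟩ := hs
      obtain ⟨rfl, rfl⟩ := hd
      obtain ⟨x5, y5, h5, hE5, hx5, -⟩ := exists_add_self hX hA0
      refine ⟨x5, y5, h5, by rw [← hE5, ← hE, two_mul, add_nsmul], ?_⟩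
      push_cast
      simp only [add_sub_assoc, add_assoc, mul_add]
      norm_num
      have t2 := twoY_sq hX.1
      have I2 : (X3 - X) * (X4 - X) * (X - x) ^ 2 = (x5 - x) * V.twoY X Y ^ 2 := by
        simp only [addSubSum, addSubProd, twoYSq] at hS hPr hx5 t2
        linear_combination hPr - X * hS - hx5 + x * t2
      rw [← d1, ← d2, ← hYm]
      linear_combination e (j + 2) ^ 8 * I2 - (X3 - X) * (X4 - X) * e (j + 2) ^ 4 *
        (e (j + 3) * e (j + 1) + (x - X) * e (j + 2) ^ 2) * hx
    · obtain ⟨j, rfl⟩ : ∃ j, m = j + 1 := ⟨m - 1, (by omega)⟩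
      obtain ⟨X, Y, hX, hE, hx⟩ := ih (j + 1) (by omega) (by omega)
      obtain ⟨X2, Y2, hX2, hE2, hx2⟩ := ih (j + 2) (by omega) (by omega)
      have hY1 := hY (j + 1) (by omega) (by omega) X Y hX hE
      have hY2 := hY (j + 2) (by omega) (by omega) X2 Y2 hX2 hE2
      rw [hm]
      have d := hdiff (j + 1) X X2 hx (by convert hx2 using 3 <;> push_cast <;> ring_nf)
      push_cast at hx hx2 hY1 hY2 d
      simp only [add_sub_assoc, add_assoc, mul_add] at hx hx2 hY1 hY2 d
      norm_num at hx hx2 hY1 hY2 d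
      have hd := hne (2 * j + 3) (by omega)
      have hXx : X2 ≠ X := by
        rintro rfl
        rw [sub_self, zero_mul] at d
        exact hd d.symm
      obtain ⟨x3, y3, h3, x4, y4, h4, hs, hd, -, -, hI⟩ := exists_add_sub_of_X_ne hX2 hX hXx
      rw [← hE, ← hE2, succ_nsmul P (j + 1), add_sub_cancel_left, hP,
        Affine.Point.some.injEq] at hd
      obtain ⟨rfl, rfl⟩ := hd
      refine ⟨x3, y3, h3, by rw [← hs, ← hE, ← hE2, ← add_nsmul]; congr 1; omega, ?_⟩
      push_cast
      simp only [add_sub_assoc, add_assoc, mul_add]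
      norm_num
      rw [← d, ← hY1, ← hY2]
      linear_combination -(e (j + 1) ^ 4 * e (j + 2) ^ 4) * hI
  obtain ⟨X, Y, hX, hE, hx⟩ := key n hn
  refine ⟨X, Y, hX, hE, hx, ?_⟩
  rcases n with _ | _ | j
  · omega
  · exact SY1 X Y hX hE
  · exact hSY j (key _ (by omega)) (key _ (by omega)) (key _ (by omega)) X Y hX hE

end Generic
/-! ### Division polynomials at points of the curve -/

section OnCurve

variable {R : Type*} [CommRing R] (V : WeierstrassCurve R)

/-- The univariate polynomial `preΨ₂ₙ / preΨₙ`. -/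
noncomputable def complΨ (n : ℤ) : R[X] :=
  V.preΨ (n - 1) ^ 2 * V.preΨ (n + 2) - V.preΨ (n - 2) * V.preΨ (n + 1) ^ 2

lemma preΨ_two_mul (n : ℤ) : V.preΨ (2 * n) = V.preΨ n * V.complΨ n := by
  rw [preΨ_even, complΨ]; ring

/-- The value at `(x, y)` of `ψ₂ₙ / ψₙ`. -/
noncomputable def psicAt (x y : R) (n : ℤ) : R :=
  (V.complΨ n).eval x * if Even n then 1 else V.twoY x y

variable {V} {x y : R}

lemma evalEval_eq_of_mk_eq (h : V.toAffine.Equation x y) {p q : R[X][X]}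
    (hpq : Affine.CoordinateRing.mk V p = Affine.CoordinateRing.mk V q) :
    p.evalEval x y = q.evalEval x y := by
  obtain ⟨r, hr⟩ := AdjoinRoot.mk_eq_mk.mp hpq
  have := congrArg (Polynomial.evalEval x y) hr
  rwa [Polynomial.evalEval_mul, show V.toAffine.polynomial.evalEval x y = 0 from h, zero_mul,
    Polynomial.evalEval_sub, sub_eq_zero] at this

lemma psiAt_eq_preΨ (h : V.toAffine.Equation x y) (n : ℤ) :
    V.psiAt x y n = (V.preΨ n).eval x * if Even n then V.twoY x y else 1 := by
  rw [psiAt, evalEval_eq_of_mk_eq h (Affine.CoordinateRing.mk_ψ V n), WeierstrassCurve.Ψ,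
    Polynomial.evalEval_mul, Polynomial.evalEval_C]
  split_ifs <;> simp [evalEval_ψ₂]

lemma psiAt_sq (h : V.toAffine.Equation x y) (n : ℤ) :
    V.psiAt x y n ^ 2 = (V.ΨSq n).eval x := by
  rw [psiAt, ← Polynomial.evalEval_pow, evalEval_eq_of_mk_eq h (q := Polynomial.C (V.ΨSq n)),
    Polynomial.evalEval_C]
  rw [map_pow, Affine.CoordinateRing.mk_ψ, Affine.CoordinateRing.mk_Ψ_sq]

lemma phiAt_eq_Φ (h : V.toAffine.Equation x y) (n : ℤ) : V.phiAt x y n = (V.Φ n).eval x := by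
  have := evalEval_eq_of_mk_eq h (Affine.CoordinateRing.mk_φ V n)
  rw [Polynomial.evalEval_C] at this
  rw [← this, WeierstrassCurve.φ, phiAt]
  simp [psiAt, Polynomial.evalEval_sub, Polynomial.evalEval_mul, Polynomial.evalEval_pow,
    Polynomial.evalEval_C]

lemma psiAt_two_mul (h : V.toAffine.Equation x y) (n : ℤ) :
    V.psiAt x y (2 * n) = V.psiAt x y n * V.psicAt x y n := by
  rw [psiAt_eq_preΨ h, psiAt_eq_preΨ h, preΨ_two_mul, psicAt, Polynomial.eval_mul]
  split_ifs with h1 h2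
  · ring
  · ring
  all_goals exact absurd (even_two_mul n) h1

/-- The relation that defines the numerator of the `y`-coordinate classically. -/
lemma psicAt_mul_twoY (h : V.toAffine.Equation x y) (n : ℤ) :
    V.psicAt x y n * V.twoY x y = V.psiAt x y (n + 2) * V.psiAt x y (n - 1) ^ 2 -
      V.psiAt x y (n - 2) * V.psiAt x y (n + 1) ^ 2 := by
  simp only [psiAt_eq_preΨ h, psicAt, complΨ, Int.even_add, Int.even_sub, even_two, iff_true,
    Int.not_even_one, iff_false]
  split_ifs <;> simp <;> ring

/-- The polynomial relations between `φₙ₋₁, φₙ, φₙ₊₁, ψₙ₋₁, ψₙ, ψₙ₊₁` and `ψ₂ₙ / ψₙ` at a point that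
express that `x(nP ± P)` are given by the addition-and-subtraction map and that `nP` lies on the
curve. -/
structure DivisionIdentities (V : WeierstrassCurve R) (x y : R) (n : ℤ) : Prop where
  prod : V.phiAt x y (n + 1) * V.phiAt x y (n - 1) = V.phiAt x y n ^ 2 * x ^ 2 -
    V.b₄ * V.phiAt x y n * V.psiAt x y n ^ 2 * x -
    V.b₆ * (V.phiAt x y n + V.psiAt x y n ^ 2 * x) * V.psiAt x y n ^ 2 - V.b₈ * V.psiAt x y n ^ 4
  sum : V.phiAt x y (n + 1) * V.psiAt x y (n - 1) ^ 2 +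
      V.phiAt x y (n - 1) * V.psiAt x y (n + 1) ^ 2 =
    2 * V.phiAt x y n * x * (V.phiAt x y n + x * V.psiAt x y n ^ 2) +
    V.b₂ * V.phiAt x y n * V.psiAt x y n ^ 2 * x +
    V.b₄ * (V.phiAt x y n + x * V.psiAt x y n ^ 2) * V.psiAt x y n ^ 2 +
    V.b₆ * V.psiAt x y n ^ 4
  sq : V.psicAt x y n ^ 2 = 4 * V.phiAt x y n ^ 3 +
    V.b₂ * V.phiAt x y n ^ 2 * V.psiAt x y n ^ 2 + 2 * V.b₄ * V.phiAt x y n * V.psiAt x y n ^ 4 +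
    V.b₆ * V.psiAt x y n ^ 6

section Map

variable {S : Type*} [CommRing S] (f : R →+* S)

lemma twoY_map (x y : R) : (V.map f).twoY (f x) (f y) = f (V.twoY x y) := by simp [twoY, map_ofNat]

lemma psiAt_map (x y : R) (n : ℤ) : (V.map f).psiAt (f x) (f y) n = f (V.psiAt x y n) := by
  rw [psiAt, map_ψ, Polynomial.map_mapRingHom_evalEval, psiAt]

lemma phiAt_map (x y : R) (n : ℤ) : (V.map f).phiAt (f x) (f y) n = f (V.phiAt x y n) := by
  simp [phiAt, psiAt_map]

lemma complΨ_map (n : ℤ) : (V.map f).complΨ n = (V.complΨ n).map f := by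
  simp [complΨ]

lemma psicAt_map (x y : R) (n : ℤ) : (V.map f).psicAt (f x) (f y) n = f (V.psicAt x y n) := by
  simp only [psicAt, complΨ_map, twoY_map, map_mul, Polynomial.eval_map_apply]
  split_ifs <;> simp

lemma DivisionIdentities.map {x y : R} {n : ℤ} (h : V.DivisionIdentities x y n) :
    (V.map f).DivisionIdentities (f x) (f y) n where
  prod := by simpa [map_ofNat, phiAt_map, psiAt_map] using congrArg f h.prod
  sum := by simpa [map_ofNat, phiAt_map, psiAt_map] using congrArg f h.sum
  sq := by simpa [map_ofNat, phiAt_map, psiAt_map, psicAt_map] using congrArg f h.sq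

lemma DivisionIdentities.of_map {f : R →+* S} (hf : Function.Injective f) {x y : R} {n : ℤ}
    (h : (V.map f).DivisionIdentities (f x) (f y) n) : V.DivisionIdentities x y n where
  prod := hf (by simpa [map_ofNat, phiAt_map, psiAt_map] using h.prod)
  sum := hf (by simpa [map_ofNat, phiAt_map, psiAt_map] using h.sum)
  sq := hf (by simpa [map_ofNat, phiAt_map, psiAt_map, psicAt_map] using h.sq)

end Map

end OnCurve

section Generic

variable {F : Type*} [Field F] {V : WeierstrassCurve F} {x y : F}

/-- Where no division polynomial vanishes, the identities follow from the addition formulas for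
`nP ± P`. -/
lemma divisionIdentities_of_generic (h : V.toAffine.Nonsingular x y)
    (h0 : ∀ n : ℕ, 0 < n → V.psiAt x y n ≠ 0) (n : ℕ) (hn : 0 < n) :
    V.DivisionIdentities x y n := by
  classical
  obtain ⟨X, Y, hX, hE, hx, hY⟩ := nsmul_psiAt_of_generic h h0 n hn
  have hphi : V.phiAt x y n = X * V.psiAt x y n ^ 2 := by rw [phiAt]; linear_combination hx
  have hsq : V.psicAt x y n = V.twoY X Y * V.psiAt x y n ^ 3 := by
    rw [psiAt_two_mul h.1] at hY
    apply mul_left_cancel₀ (h0 n hn)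
    linear_combination -hY
  have t2 := twoY_sq hX.1
  have sq : V.psicAt x y n ^ 2 = 4 * V.phiAt x y n ^ 3 +
      V.b₂ * V.phiAt x y n ^ 2 * V.psiAt x y n ^ 2 + 2 * V.b₄ * V.phiAt x y n * V.psiAt x y n ^ 4 +
      V.b₆ * V.psiAt x y n ^ 6 := by
    rw [hsq, hphi]
    simp only [twoYSq] at t2
    linear_combination V.psiAt x y n ^ 6 * t2
  obtain rfl | ⟨j, rfl⟩ : n = 1 ∨ ∃ j, n = j + 2 := by
    rcases n with _ | _ | j
    · omega
    · exact .inl rfl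
    · exact .inr ⟨j, rfl⟩
  · have t := twoY_sq h.1
    refine ⟨?_, ?_, sq⟩
    all_goals
      simp only [phiAt, twoYSq, Nat.cast_one, sub_self, psiAt_zero, psiAt_one, zero_add, zero_sub,
        psiAt_neg, one_add_one_eq_two, psiAt_two, show (2 + 1 : ℤ) = 3 from rfl,
        show (2 - 1 : ℤ) = 1 from rfl, psiAt_three, Ψ₃] at t ⊢
      simp
    · linear_combination x * t
    · linear_combination t
  · obtain ⟨X1, Y1, hX1, hE1, hx1, -⟩ := nsmul_psiAt_of_generic h h0 (j + 1) (by omega)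
    obtain ⟨X2, Y2, hX2, hE2, hx2, -⟩ := nsmul_psiAt_of_generic h h0 (j + 3) (by omega)
    have hphi1 : V.phiAt x y (j + 1 : ℕ) = X1 * V.psiAt x y (j + 1 : ℕ) ^ 2 := by
      rw [phiAt]; linear_combination hx1
    have hphi2 : V.phiAt x y (j + 3 : ℕ) = X2 * V.psiAt x y (j + 3 : ℕ) ^ 2 := by
      rw [phiAt]; linear_combination hx2
    have ha := h0 (j + 1) (by omega)
    have hc := h0 (j + 3) (by omega)
    have i1 : ((j + 2 : ℕ) : ℤ) + 1 = (j + 3 : ℕ) := by push_cast; ring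
    have i2 : ((j + 2 : ℕ) : ℤ) - 1 = (j + 1 : ℕ) := by push_cast; ring
    rw [i1, i2] at hx
    have hXx : X ≠ x := by
      rintro rfl
      rw [sub_self, zero_mul] at hx
      exact mul_ne_zero hc ha hx.symm
    obtain ⟨x3, y3, h3, x4, y4, h4, hs, hd, hS, hP, -⟩ := exists_add_sub_of_X_ne hX h hXx
    rw [← hE, ← succ_nsmul, hE2, Affine.Point.some.injEq] at hs
    rw [← hE, succ_nsmul, add_sub_cancel_right, hE1, Affine.Point.some.injEq] at hd
    obtain ⟨rfl, rfl⟩ := hs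
    obtain ⟨rfl, rfl⟩ := hd
    simp only [addSubSum, addSubProd] at hS hP
    refine ⟨?_, ?_, sq⟩
    · rw [i1, i2, hphi, hphi1, hphi2]
      linear_combination V.psiAt x y (j + 2 : ℕ) ^ 4 * hP - X1 * X2 *
        (V.psiAt x y (j + 3 : ℕ) * V.psiAt x y (j + 1 : ℕ) +
          (x - X) * V.psiAt x y (j + 2 : ℕ) ^ 2) * hx
    · rw [i1, i2, hphi, hphi1, hphi2]
      linear_combination V.psiAt x y (j + 2 : ℕ) ^ 4 * hS - (X1 + X2) *
        (V.psiAt x y (j + 3 : ℕ) * V.psiAt x y (j + 1 : ℕ) +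
          (x - X) * V.psiAt x y (j + 2 : ℕ) ^ 2) * hx

end Generic
end WeierstrassCurve

/-! ### Derivations of fraction fields and of power series -/

/-- A derivation extends to the field of fractions. -/
lemma Derivation.exists_extend_fractionRing {A K : Type*} [CommRing A] [IsDomain A] [Field K]
    [Algebra A K] [IsFractionRing A K] (D : Derivation ℤ A A) :
    ∃ D' : Derivation ℤ K K, ∀ a, D' (algebraMap A K a) = algebraMap A K (D a) := by
  -- The derivation is the `ε`-part of the extension to `K` of the ring map `a ↦ a + D a ε`.
  let u : A → TrivSqZeroExt K K := fun a =>
    TrivSqZeroExt.inl (algebraMap A K a) + TrivSqZeroExt.inr (algebraMap A K (D a))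
  have hu1 : ∀ a, (u a).fst = algebraMap A K a := fun a => by
    rw [TrivSqZeroExt.fst_add, TrivSqZeroExt.fst_inl, TrivSqZeroExt.fst_inr, add_zero]
  have hu2 : ∀ a, (u a).snd = algebraMap A K (D a) := fun a => by
    rw [TrivSqZeroExt.snd_add, TrivSqZeroExt.snd_inl, TrivSqZeroExt.snd_inr, zero_add]
  clear_value u
  let g : A →+* TrivSqZeroExt K K :=
    { toFun := u
      map_one' := TrivSqZeroExt.ext (by rw [hu1, map_one, TrivSqZeroExt.fst_one])
        (by rw [hu2, D.map_one_eq_zero, map_zero, TrivSqZeroExt.snd_one])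
      map_zero' := TrivSqZeroExt.ext (by rw [hu1, map_zero, TrivSqZeroExt.fst_zero])
        (by rw [hu2, map_zero, map_zero, TrivSqZeroExt.snd_zero])
      map_add' := fun a b => TrivSqZeroExt.ext
        (by rw [TrivSqZeroExt.fst_add, hu1, hu1, hu1, map_add])
        (by rw [TrivSqZeroExt.snd_add, hu2, hu2, hu2, map_add, map_add])
      map_mul' := fun a b => TrivSqZeroExt.ext
        (by rw [TrivSqZeroExt.fst_mul, hu1, hu1, hu1, map_mul])
        (by rw [TrivSqZeroExt.snd_mul, hu2, hu2, hu2, hu1, hu1, D.leibniz, map_add, smul_eq_mul,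
          smul_eq_mul, map_mul, map_mul, op_smul_eq_smul, smul_eq_mul, smul_eq_mul]) }
  have hg1 : ∀ a, (g a).fst = algebraMap A K a := hu1
  have hg2 : ∀ a, (g a).snd = algebraMap A K (D a) := hu2
  have hg : ∀ y : nonZeroDivisors A, IsUnit (g y) := fun y => by
    rw [TrivSqZeroExt.isUnit_iff_isUnit_fst, hg1]
    exact IsLocalization.map_units K y
  let G : K →+* TrivSqZeroExt K K := IsLocalization.lift hg
  have hG : ∀ a, G (algebraMap A K a) = g a := IsLocalization.lift_eq hg
  clear_value G g
  have hfst : ∀ x, (G x).fst = x := by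
    have : (TrivSqZeroExt.fstHom K K K).toRingHom.comp G = RingHom.id K := by
      apply IsLocalization.ringHom_ext (nonZeroDivisors A)
      ext a
      change (G (algebraMap A K a)).fst = algebraMap A K a
      rw [hG, hg1]
    intro x
    exact congrArg (fun f : K →+* K => f x) this
  refine ⟨Derivation.mk' (AddMonoidHom.toIntLinearMap
    { toFun := fun x => (G x).snd
      map_zero' := by rw [map_zero, TrivSqZeroExt.snd_zero]
      map_add' := fun x y => by rw [map_add, TrivSqZeroExt.snd_add] }) ?_, ?_⟩
  · intro a b
    change (G (a * b)).snd = a • (G b).snd + b • (G a).snd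
    rw [map_mul, TrivSqZeroExt.snd_mul, hfst, hfst, op_smul_eq_smul]
  · intro a
    change (G (algebraMap A K a)).snd = _
    rw [hG, hg2]

/-- The derivations of a commutative ring over the integers. -/
abbrev IntDerivation (R : Type*) [CommRing R] : Type _ := Derivation ℤ R R

/-- An additive map satisfying the Leibniz rule, as a derivation. -/
def IntDerivation.mk {R : Type*} [CommRing R] (f : R →+ R)
    (hf : ∀ a b, f (a * b) = a * f b + b * f a) : IntDerivation R :=
  Derivation.mk' f.toIntLinearMap hf

/-- The derivative of power series, as a derivation over the integers. -/
noncomputable def PowerSeries.intDerivation (k : Type*) [CommRing k] :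
    IntDerivation (PowerSeries k) :=
  IntDerivation.mk (PowerSeries.derivative k).toLinearMap.toAddMonoidHom
    fun a b => (PowerSeries.derivative k).leibniz a b

@[simp] lemma PowerSeries.intDerivation_apply {k : Type*} [CommRing k] (f : PowerSeries k) :
    PowerSeries.intDerivation k f = PowerSeries.derivative k f := rfl

namespace PuncturedElliptic.LocalParam

/-! ### Local parametrisations -/

open WeierstrassCurve PowerSeries

variable {k : Type*} [Field k] {V : WeierstrassCurve k} {x₀ y₀ : k}

lemma isConstFor_intDerivation (V : WeierstrassCurve k) :
    (V.baseChange (PowerSeries k)).IsConstFor (intDerivation k) := by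
  have : ∀ c : k, PowerSeries.derivative k (algebraMap k (PowerSeries k) c) = 0 :=
    fun c => Derivation.map_algebraMap _ c
  constructor <;> exact this _

lemma map_constantCoeff (V : WeierstrassCurve k) :
    (V.baseChange (PowerSeries k)).map (constantCoeff (R := k)) = V := by
  rw [baseChange, WeierstrassCurve.map_map]
  convert V.map_id
  ext; simp

variable (γ : LocalParam V x₀ y₀)

lemma eval_ψ (n : ℤ) : γ.eval (V.ψ n) =
    algebraMap _ (LaurentSeries k) ((V.baseChange (PowerSeries k)).psiAt γ.X γ.Y n) := by
  rw [eval, psiAt, baseChange, map_ψ]; rfl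

lemma eval_twoY : γ.eval (Polynomial.C (Polynomial.C 2) * Polynomial.X +
      Polynomial.C (Polynomial.C V.a₁ * Polynomial.X + Polynomial.C V.a₃)) =
    algebraMap _ (LaurentSeries k) ((V.baseChange (PowerSeries k)).twoY γ.X γ.Y) := by
  have : V.ψ₂ = Polynomial.C (Polynomial.C 2) * Polynomial.X +
      Polynomial.C (Polynomial.C V.a₁ * Polynomial.X + Polynomial.C V.a₃) := by
    rw [WeierstrassCurve.ψ₂, Affine.polynomialY]
  rw [← this, ← WeierstrassCurve.ψ_two, eval_ψ, psiAt_two]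

lemma constantCoeff_psiAt (n : ℤ) :
    constantCoeff ((V.baseChange (PowerSeries k)).psiAt γ.X γ.Y n) = V.psiAt x₀ y₀ n := by
  rw [← psiAt_map, map_constantCoeff, γ.constantCoeff_X, γ.constantCoeff_Y]

lemma constantCoeff_phiAt (n : ℤ) :
    constantCoeff ((V.baseChange (PowerSeries k)).phiAt γ.X γ.Y n) = V.phiAt x₀ y₀ n := by
  rw [← phiAt_map, map_constantCoeff, γ.constantCoeff_X, γ.constantCoeff_Y]

lemma constantCoeff_psicAt (n : ℤ) :
    constantCoeff ((V.baseChange (PowerSeries k)).psicAt γ.X γ.Y n) = V.psicAt x₀ y₀ n := by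
  rw [← psicAt_map, map_constantCoeff, γ.constantCoeff_X, γ.constantCoeff_Y]

lemma constantCoeff_twoY :
    constantCoeff ((V.baseChange (PowerSeries k)).twoY γ.X γ.Y) = V.twoY x₀ y₀ := by
  rw [← twoY_map, map_constantCoeff, γ.constantCoeff_X, γ.constantCoeff_Y]

/-- The invariant differential is `w ds` for a power series `w` with `w(0) ≠ 0`. -/
lemma exists_hasSpeed (h : V.toAffine.Nonsingular x₀ y₀) : ∃ w : PowerSeries k,
    constantCoeff w ≠ 0 ∧
    (V.baseChange (PowerSeries k)).HasSpeed (intDerivation k) γ.X γ.Y w := by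
  have key := (isConstFor_intDerivation V).twoY_mul γ.equation
  set t := (V.baseChange (PowerSeries k)).twoY γ.X γ.Y with ht
  set g := 3 * γ.X ^ 2 + 2 * (V.baseChange (PowerSeries k)).a₂ * γ.X +
    (V.baseChange (PowerSeries k)).a₄ - (V.baseChange (PowerSeries k)).a₁ * γ.Y with hg
  have hg0 : constantCoeff g = 3 * x₀ ^ 2 + 2 * V.a₂ * x₀ + V.a₄ - V.a₁ * y₀ := by
    have e : ∀ c : k, constantCoeff (algebraMap k (PowerSeries k) c) = c := fun c => by simp
    have e1 := e V.a₂
    have e2 := e V.a₄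
    have e3 := e V.a₁
    simp only [hg, baseChange, map_a₁, map_a₂, map_a₄, map_add, map_sub, map_mul, map_pow,
      map_ofNat, γ.constantCoeff_X, γ.constantCoeff_Y, e1, e2, e3]
  have hX : constantCoeff (PowerSeries.derivative k γ.X) = coeff 1 γ.X := by
    rw [← coeff_zero_eq_constantCoeff_apply]; simp [coeff_derivative]
  have hY : constantCoeff (PowerSeries.derivative k γ.Y) = coeff 1 γ.Y := by
    rw [← coeff_zero_eq_constantCoeff_apply]; simp [coeff_derivative]
  simp only [intDerivation_apply] at key
  have key0 := congrArg constantCoeff key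
  simp only [map_mul, hX, hY] at key0
  -- The differential is `dX / t` or `dY / g`, according to which of `t, g` is a unit.
  by_cases h2 : constantCoeff t = 0
  · have hgne : constantCoeff g ≠ 0 := by
      rw [constantCoeff_twoY] at h2
      rw [hg0]
      intro h0
      rw [Affine.nonsingular_iff'] at h
      rcases h.2 with h' | h'
      · exact h' (by linear_combination -h0)
      · exact h' (by rw [twoY] at h2; linear_combination h2)
    obtain ⟨g', hg'⟩ := isUnit_iff_exists_inv.mp
      (isUnit_iff_constantCoeff.mpr (isUnit_iff_ne_zero.mpr hgne))
    rw [h2, zero_mul, eq_comm, mul_eq_zero, or_iff_right hgne] at key0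
    refine ⟨derivative k γ.Y * g', ?_, ?_, ?_⟩
    · rw [map_mul, hY]
      refine mul_ne_zero (γ.linear.resolve_left (not_not.mpr key0)) fun h0 => ?_
      simpa [h0] using congrArg constantCoeff hg'
    · simp only [intDerivation_apply]
      linear_combination (-derivative k γ.X) * hg' - g' * key
    · simp only [intDerivation_apply]
      linear_combination (-derivative k γ.Y) * hg'
  · obtain ⟨t', ht'⟩ := isUnit_iff_exists_inv.mp
      (isUnit_iff_constantCoeff.mpr (isUnit_iff_ne_zero.mpr h2))
    refine ⟨derivative k γ.X * t', ?_, ?_, ?_⟩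
    · rw [map_mul, hX]
      refine mul_ne_zero (fun h0 => ?_) fun h0 => ?_
      · rw [h0, mul_zero] at key0
        exact (γ.linear.resolve_left (not_not.mpr h0)) ((mul_eq_zero.mp key0).resolve_left h2)
      · simpa [h0] using congrArg constantCoeff ht'
    · simp only [intDerivation_apply]
      linear_combination (-derivative k γ.X) * ht'
    · simp only [intDerivation_apply]
      linear_combination (-derivative k γ.Y) * ht' + t' * key

end PuncturedElliptic.LocalParam

namespace WeierstrassCurve

/-! ### The invariant differential under multiplication by `n` -/

section

variable {F : Type*} [Field F] {V : WeierstrassCurve F} {D : Derivation ℤ F F}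

/-- Multiplication by `n` multiplies the invariant differential by `n`. -/
lemma IsConstFor.hasSpeed_nsmul [DecidableEq F] (hD : V.IsConstFor D) {x y w : F}
    (h : V.toAffine.Nonsingular x y)
    (h0 : ∀ n : ℕ, 0 < n → V.psiAt x y n ≠ 0) (hw : V.HasSpeed D x y w) (n : ℕ) (hn : 0 < n)
    (X Y : F) (hX : V.toAffine.Nonsingular X Y)
    (hE : n • Affine.Point.some x y h = .some X Y hX) : V.HasSpeed D X Y (n * w) := by
  have hy0 : ∀ n : ℕ, 0 < n → ∀ (X Y : F) (hX : V.toAffine.Nonsingular X Y),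
      n • Affine.Point.some x y h = .some X Y hX → V.twoY X Y ≠ 0 := by
    intro n hn X Y hX hE h2
    obtain ⟨X', Y', hX', hE', -, hY⟩ := nsmul_psiAt_of_generic h h0 n hn
    rw [hE, Affine.Point.some.injEq] at hE'
    obtain ⟨rfl, rfl⟩ := hE'
    rw [h2, zero_mul] at hY
    exact h0 (2 * n) (by omega) (by push_cast; exact hY.symm)
  induction n, hn using Nat.le_induction generalizing X Y with
  | base =>
    rw [Nat.succ_eq_add_one] at *
    rw [zero_add, one_smul, Affine.Point.some.injEq] at hE
    obtain ⟨rfl, rfl⟩ := hE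
    simpa using hw
  | succ n hn ih =>
    obtain ⟨X', Y', hX', hE', hx', -⟩ := nsmul_psiAt_of_generic h h0 n hn
    have hs := ih X' Y' hX' hE'
    have h2 := hy0 _ (Nat.succ_pos n) X Y hX hE
    refine hD.hasSpeed hX.1 h2 ?_
    rcases Nat.lt_or_ge 1 n with hn1 | hn1
    · have hXx : X' ≠ x := by
        rintro rfl
        rw [sub_self, zero_mul] at hx'
        have := h0 (n - 1) (by omega)
        rw [Nat.cast_sub hn] at this
        exact mul_ne_zero (h0 (n + 1) (by omega)) this (by push_cast; exact hx'.symm)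
      rw [succ_nsmul, hE', Affine.Point.add_of_X_ne hXx, Affine.Point.some.injEq] at hE
      obtain ⟨rfl, rfl⟩ := hE
      rw [hD.deriv_addX hX'.1 h.1 hXx hs hw]
      push_cast; ring
    · obtain rfl : n = 1 := by omega
      have ht := hy0 1 one_pos x y h (one_smul ..)
      rw [succ_nsmul, one_smul, Affine.Point.add_self_of_Y_ne
        (by rwa [twoY_eq_sub_negY, sub_ne_zero] at ht), Affine.Point.some.injEq] at hE
      obtain ⟨rfl, rfl⟩ := hE
      rw [hD.deriv_dblX ht hw]
      push_cast; ring

/-- The Wronskian of `φₙ` and `ψₙ`: with `x(nP) = φₙ / ψₙ²`, it expresses that multiplication by `n`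
multiplies the invariant differential by `n`. -/
lemma IsConstFor.wronskian_of_generic (hD : V.IsConstFor D) {x y w : F}
    (h : V.toAffine.Nonsingular x y)
    (h0 : ∀ n : ℕ, 0 < n → V.psiAt x y n ≠ 0) (hw : V.HasSpeed D x y w) (n : ℕ) (hn : 0 < n) :
    D (V.phiAt x y n) * V.psiAt x y n - 2 * V.phiAt x y n * D (V.psiAt x y n) =
      n * w * V.psicAt x y n := by
  classical
  obtain ⟨X, Y, hX, hE, hx, hY⟩ := nsmul_psiAt_of_generic h h0 n hn
  have hphi : V.phiAt x y n = X * V.psiAt x y n ^ 2 := by rw [phiAt]; linear_combination hx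
  have hsq : V.psicAt x y n = V.twoY X Y * V.psiAt x y n ^ 3 := by
    rw [psiAt_two_mul h.1] at hY
    apply mul_left_cancel₀ (h0 n hn)
    linear_combination -hY
  have hs := hD.hasSpeed_nsmul h h0 hw n hn X Y hX hE
  rw [hphi, hsq, Derivation.leibniz, Derivation.leibniz_pow, hs.dx]
  simp only [smul_eq_mul, nsmul_eq_mul]
  push_cast; ring

end

end WeierstrassCurve

lemma IntDerivation.map_two {R : Type*} [CommRing R] (D : IntDerivation R) : D 2 = 0 := by
  simpa using D.map_natCast 2

lemma charZero_powerSeries (k : Type*) [Field k] [CharZero k] : CharZero (PowerSeries k) :=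
  charZero_of_injective_algebraMap (algebraMap k (PowerSeries k)).injective

namespace PuncturedElliptic.LocalParam

/-! ### The generic point of a local parametrisation -/

open WeierstrassCurve PowerSeries

variable {k : Type*} [Field k] {V : WeierstrassCurve k} {x₀ y₀ : k}
  (γ : LocalParam V x₀ y₀)

section

/-- A local parametrisation defines a point over the field of fractions of the power series, which
plays the role of the generic point of the curve. -/
lemma nonsingular_fractionRing [V.IsElliptic] :
    ((V.baseChange (PowerSeries k)).map
      (algebraMap (PowerSeries k) (FractionRing (PowerSeries k)))).toAffine.Nonsingular
      (algebraMap _ _ γ.X) (algebraMap _ _ γ.Y) := by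
  have : ((V.map (algebraMap k (PowerSeries k))).map
      (algebraMap (PowerSeries k) (FractionRing (PowerSeries k)))).IsElliptic := inferInstance
  refine (@Affine.equation_iff_nonsingular _ _ _ _ this _ _).mp ?_
  exact Affine.Equation.map _ γ.equation

variable [CharZero k]

/-- The `x`-coordinate of a local parametrisation is not constant. -/
lemma X_ne_C (h : V.toAffine.Nonsingular x₀ y₀) (r : k) : γ.X ≠ algebraMap k (PowerSeries k) r := by
  intro hr
  obtain ⟨w, hw0, hw⟩ := γ.exists_hasSpeed h
  have hw1 : w ≠ 0 := by rintro rfl; simp at hw0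
  have hDX : intDerivation k γ.X = 0 := by
    rw [hr]; exact Derivation.map_algebraMap (PowerSeries.derivative k) r
  have ht : (V.baseChange (PowerSeries k)).twoY γ.X γ.Y = 0 := by
    have := hw.dx
    rw [hDX, eq_comm, mul_eq_zero] at this
    exact this.resolve_left hw1
  have hD := isConstFor_intDerivation V
  have hDt := congrArg (intDerivation k) ht
  have two := IntDerivation.map_two (intDerivation k)
  have := charZero_powerSeries k
  simp only [twoY, map_add, Derivation.leibniz, hD.a₁, hD.a₃, hDX, two, smul_eq_mul, mul_zero,
    add_zero, map_zero] at hDt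
  have hDY := (mul_eq_zero.mp hDt).resolve_left two_ne_zero
  have c : ∀ f : PowerSeries k, intDerivation k f = 0 → coeff 1 f = 0 := by
    intro f hf
    have := congrArg (coeff 0) hf
    simpa [coeff_derivative] using this
  exact γ.linear.elim (fun h => h (c _ hDX)) (fun h => h (c _ hDY))

variable [IsAlgClosed k]

/-- The `x`-coordinate of a local parametrisation is transcendental over the constants. -/
lemma aeval_X_ne_zero (h : V.toAffine.Nonsingular x₀ y₀) {p : k[X]} (hp : p ≠ 0) :
    Polynomial.aeval γ.X p ≠ 0 := by
  intro h0
  have hint : IsIntegral k γ.X := (isAlgebraic_iff_isIntegral).mp ⟨p, hp, h0⟩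
  have hdeg := IsAlgClosed.degree_eq_one_of_irreducible k (minpoly.irreducible hint)
  obtain ⟨r, hr⟩ := minpoly.mem_range_of_degree_eq_one k γ.X hdeg
  exact γ.X_ne_C h r hr.symm

lemma psiAt_ne_zero (h : V.toAffine.Nonsingular x₀ y₀) (n : ℕ) (hn : 0 < n) :
    (V.baseChange (PowerSeries k)).psiAt γ.X γ.Y n ≠ 0 := by
  intro h0
  have := psiAt_sq γ.equation n
  rw [h0, baseChange, map_ΨSq, zero_pow two_ne_zero, Polynomial.eval_map_algebraMap] at this
  exact γ.aeval_X_ne_zero h (V.ΨSq_ne_zero (by exact_mod_cast hn.ne')) this.symm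

lemma psiAt_fractionRing_ne_zero (h : V.toAffine.Nonsingular x₀ y₀) (n : ℕ) (hn : 0 < n) :
    ((V.baseChange (PowerSeries k)).map
      (algebraMap (PowerSeries k) (FractionRing (PowerSeries k)))).psiAt
      (algebraMap _ _ γ.X) (algebraMap _ _ γ.Y) n ≠ 0 := by
  rw [psiAt_map]
  exact (map_ne_zero_iff _ (IsFractionRing.injective _ _)).mpr (γ.psiAt_ne_zero h n hn)

/-- The Wronskian of `φₙ` and `ψₙ` along a local parametrisation. -/
lemma wronskian [V.IsElliptic] (h : V.toAffine.Nonsingular x₀ y₀) {w : PowerSeries k}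
    (hw : (V.baseChange (PowerSeries k)).HasSpeed (intDerivation k) γ.X γ.Y w)
    (n : ℕ) (hn : 0 < n) :
    PowerSeries.derivative k ((V.baseChange (PowerSeries k)).phiAt γ.X γ.Y n) *
        (V.baseChange (PowerSeries k)).psiAt γ.X γ.Y n -
      2 * (V.baseChange (PowerSeries k)).phiAt γ.X γ.Y n *
        PowerSeries.derivative k ((V.baseChange (PowerSeries k)).psiAt γ.X γ.Y n) =
      n * w * (V.baseChange (PowerSeries k)).psicAt γ.X γ.Y n := by
  obtain ⟨D, hD⟩ := Derivation.exists_extend_fractionRing (K := FractionRing (PowerSeries k))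
    (intDerivation k)
  have hc := isConstFor_intDerivation V
  have hDc : ((V.baseChange (PowerSeries k)).map (algebraMap (PowerSeries k)
      (FractionRing (PowerSeries k)))).IsConstFor D := by
    constructor <;> simp only [map_a₁, map_a₂, map_a₃, map_a₄, map_a₆, hD, hc.a₁, hc.a₂,
      hc.a₃, hc.a₄, hc.a₆, map_zero]
  have := charZero_powerSeries k
  have : CharZero (FractionRing (PowerSeries k)) := charZero_of_injective_algebraMap
    (IsFractionRing.injective (PowerSeries k) (FractionRing (PowerSeries k)))
  have hsp : ((V.baseChange (PowerSeries k)).map (algebraMap (PowerSeries k)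
      (FractionRing (PowerSeries k)))).HasSpeed D (algebraMap _ _ γ.X) (algebraMap _ _ γ.Y)
      (algebraMap _ _ w) := by
    constructor
    · rw [hD, hw.dx, map_mul, twoY_map]
    · rw [hD, hw.dy]
      simp [map_ofNat]
  have := hDc.wronskian_of_generic γ.nonsingular_fractionRing
    (γ.psiAt_fractionRing_ne_zero h) hsp n hn
  rw [psiAt_map, phiAt_map, psicAt_map, hD, hD] at this
  apply IsFractionRing.injective (PowerSeries k) (FractionRing (PowerSeries k))
  simpa [map_ofNat] using this

end

end PuncturedElliptic.LocalParam

namespace WeierstrassCurve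

open PuncturedElliptic PowerSeries

variable {k : Type*} [Field k] [CharZero k] [IsAlgClosed k] {V : WeierstrassCurve k} [V.IsElliptic]
  {x y : k}

/-- The identities between division polynomials hold at the generic point of the curve, hence
at every point. -/
lemma divisionIdentities (h : V.toAffine.Nonsingular x y) (n : ℕ) (hn : 0 < n) :
    V.DivisionIdentities x y n := by
  obtain ⟨γ⟩ := LocalParam.exists_of_nonsingular h
  have := (divisionIdentities_of_generic γ.nonsingular_fractionRing
    (γ.psiAt_fractionRing_ne_zero h) n hn).of_map (IsFractionRing.injective _ _)
  have := this.map (constantCoeff (R := k))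
  rwa [LocalParam.map_constantCoeff, γ.constantCoeff_X, γ.constantCoeff_Y] at this

end WeierstrassCurve

namespace WeierstrassCurve

/-! ### Multiples of an arbitrary point -/

variable {k : Type*} [Field k] {V : WeierstrassCurve k} {x y : k}

variable (V x y) in
/-- The value at `(x, y)` of the numerator `ωₙ` of the `y`-coordinate of the `n`-th multiple. -/
noncomputable def omegaAt (n : ℤ) : k :=
  (V.psicAt x y n - V.a₁ * V.phiAt x y n * V.psiAt x y n - V.a₃ * V.psiAt x y n ^ 3) / 2

lemma exists_equation [IsAlgClosed k] (x : k) : ∃ y, V.toAffine.Equation x y := by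
  obtain ⟨y, hy⟩ := IsAlgClosed.exists_root
    ((Polynomial.X ^ 2 + Polynomial.C (V.a₁ * x + V.a₃) * Polynomial.X -
      Polynomial.C (x ^ 3 + V.a₂ * x ^ 2 + V.a₄ * x + V.a₆) : k[X])) (by
        have : (Polynomial.X ^ 2 + Polynomial.C (V.a₁ * x + V.a₃) * Polynomial.X -
          Polynomial.C (x ^ 3 + V.a₂ * x ^ 2 + V.a₄ * x + V.a₆) : k[X]).natDegree = 2 := by
          compute_degree!
        intro h
        rw [Polynomial.natDegree_eq_of_degree_eq_some h] at this
        exact absurd this (by norm_num))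
  refine ⟨y, ?_⟩
  rw [Affine.equation_iff]
  simp at hy
  linear_combination hy

lemma phiAt_add_one_mul (n : ℤ) : V.phiAt x y (n + 1) =
    x * V.psiAt x y (n + 1) ^ 2 - V.psiAt x y (n + 2) * V.psiAt x y n := by
  rw [phiAt]; ring_nf

lemma phiAt_sub_one_mul (n : ℤ) : V.phiAt x y (n - 1) =
    x * V.psiAt x y (n - 1) ^ 2 - V.psiAt x y n * V.psiAt x y (n - 2) := by
  rw [phiAt]; ring_nf

variable [CharZero k] [IsAlgClosed k] [V.IsElliptic]

lemma omegaAt_sq_of_psiAt_eq_zero (h : V.toAffine.Nonsingular x y) {n : ℕ} (hn : 0 < n)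
    (h0 : V.psiAt x y n = 0) : V.omegaAt x y n ^ 2 = V.phiAt x y n ^ 3 := by
  have := (divisionIdentities h n hn).sq
  rw [h0] at this
  rw [omegaAt, h0]
  field_simp
  linear_combination this

variable [DecidableEq k]

/-- `x(nP) = φₙ / ψₙ²`, for every point `P` of the affine curve: by induction, `x((n + 2)P)` is
determined by `x((n + 1)P)`, `x(nP)` and `x(P)`. -/
lemma hasX_nsmul (h : V.toAffine.Nonsingular x y) (n : ℕ) :
    V.HasX (n • Affine.Point.some x y h) (V.phiAt x y n) (V.psiAt x y n ^ 2) := by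
  induction n using Nat.strong_induction_on with
  | _ n ih =>
    rcases n with _ | _ | n
    · simp [phiAt]
    · simp [phiAt]
    · have h1 := ih (n + 1) (by omega)
      have h0 := ih n (by omega)
      have hd := divisionIdentities h (n + 1) (by omega)
      rw [succ_nsmul]
      have e1 : ((n + 1 : ℕ) : ℤ) - 1 = n := by push_cast; ring
      have e2 : ((n + 1 : ℕ) : ℤ) + 1 = (n + 1 + 1 : ℕ) := by push_cast; ring
      refine h1.add (u' := V.phiAt x y n) (v' := V.psiAt x y n ^ 2) ?_ ?_ ?_ ?_
      · rwa [succ_nsmul, add_sub_cancel_right]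
      · have := hd.prod
        rw [e1, e2] at this
        linear_combination this
      · have := hd.sum
        rw [e1, e2] at this
        linear_combination this
      · rw [phiAt, e1, e2]; ring

lemma nsmul_eq_zero_iff_psiAt (h : V.toAffine.Nonsingular x y) (n : ℕ) :
    n • Affine.Point.some x y h = 0 ↔ V.psiAt x y n = 0 := by
  have hx := hasX_nsmul h n
  rcases hE : n • Affine.Point.some x y h with _ | ⟨X, Y, hX⟩
  · rw [hE] at hx
    exact ⟨fun _ => by simpa using hx.1, fun _ => rfl⟩
  · rw [hE] at hx
    exact ⟨fun h => by simp at h, fun h => absurd h (by simpa using hx.1)⟩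

lemma phiAt_ne_zero_of_psiAt_eq_zero (h : V.toAffine.Nonsingular x y) (n : ℕ)
    (h0 : V.psiAt x y n = 0) : V.phiAt x y n ≠ 0 := by
  have := hasX_nsmul h n
  rw [(nsmul_eq_zero_iff_psiAt h n).mpr h0] at this
  exact this.2

lemma nsmul_X (h : V.toAffine.Nonsingular x y) {n : ℕ} {X Y : k} {hX : V.toAffine.Nonsingular X Y}
    (hE : n • Affine.Point.some x y h = .some X Y hX) :
    X * V.psiAt x y n ^ 2 = V.phiAt x y n := by
  have := hasX_nsmul h n
  rw [hE] at this
  exact this.2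

lemma nsmul_psiAt_ne_zero (h : V.toAffine.Nonsingular x y) {n : ℕ} {X Y : k}
    {hX : V.toAffine.Nonsingular X Y}
    (hE : n • Affine.Point.some x y h = .some X Y hX) : V.psiAt x y n ≠ 0 := by
  have := hasX_nsmul h n
  rw [hE] at this
  simpa using this.1

/-- The `y`-coordinate of `nP`, up to sign from the equation of the curve; the sign is found by
comparing `x((n + 1)P)` with `x((n - 1)P)`. -/
lemma nsmul_twoY (h : V.toAffine.Nonsingular x y) {n : ℕ} (hn : 0 < n) {X Y : k}
    {hX : V.toAffine.Nonsingular X Y} (hE : n • Affine.Point.some x y h = .some X Y hX) :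
    V.twoY X Y * V.psiAt x y n ^ 3 = V.psicAt x y n := by
  have hx := nsmul_X h hE
  have h0 := nsmul_psiAt_ne_zero h hE
  have hd := divisionIdentities h n hn
  have hc := psicAt_mul_twoY h.1 n
  have tX := twoY_sq hX.1
  have tx := twoY_sq h.1
  simp only [twoYSq] at tX tx
  have hp := phiAt_add_one_mul (V := V) (x := x) (y := y) n
  have hm := phiAt_sub_one_mul (V := V) (x := x) (y := y) n
  have hphi : V.phiAt x y n = x * V.psiAt x y n ^ 2 -
    V.psiAt x y (n + 1) * V.psiAt x y (n - 1) := rfl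
  -- If `2 P = 0` both sides vanish.
  by_cases ht : V.twoY x y = 0
  · have hneg : - Affine.Point.some x y h = Affine.Point.some x y h := by
      rw [Affine.Point.neg_some, Affine.Point.some.injEq]
      rw [twoY_eq_sub_negY, sub_eq_zero] at ht
      exact ⟨rfl, ht.symm⟩
    have h2 : 2 • Affine.Point.some x y h = 0 := by
      rw [two_nsmul]; nth_rewrite 1 [← hneg]; exact neg_add_cancel _
    have hn' : n • Affine.Point.some x y h = Affine.Point.some x y h := by
      rcases Nat.even_or_odd' n with ⟨m, rfl | rfl⟩
      · rw [mul_comm, mul_nsmul', h2] at hE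
        simp at hE
      · rw [succ_nsmul, mul_comm, mul_nsmul', h2]; simp
    rw [hE, Affine.Point.some.injEq] at hn'
    obtain ⟨rfl, rfl⟩ := hn'
    have : V.psicAt X Y n ^ 2 = 0 := by
      rw [hd.sq, ← hx]
      linear_combination -V.psiAt X Y n ^ 6 * tX + V.psiAt X Y n ^ 6 * V.twoY X Y * ht
    rw [ht, zero_mul, eq_comm]
    exact pow_eq_zero_iff two_ne_zero |>.mp this
  · by_cases hXx : X = x
    -- Here `nP = ± P`, so that `(n - 1)P = 0` or `(n + 1)P = 0`.
    · subst hXx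
      rcases Affine.Y_eq_of_X_eq hX.1 h.1 rfl with rfl | rfl
      · have h1 : (n - 1) • Affine.Point.some X Y h = 0 := by
          have : (n - 1 + 1) • Affine.Point.some X Y h = .some X Y h := by
            rw [Nat.sub_add_cancel hn]; exact hE
          rwa [succ_nsmul, add_eq_right] at this
        rw [nsmul_eq_zero_iff_psiAt, Nat.cast_sub hn, Nat.cast_one] at h1
        have hs := hd.sum
        rw [h1] at hs hc
        apply mul_left_cancel₀ (mul_ne_zero h0 ht)
        rw [hm, h1, ← hx] at hs
        linear_combination V.psiAt X Y n ^ 4 * tX - hs - V.psiAt X Y n * hc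
      · have h1 : (n + 1) • Affine.Point.some X y h = 0 := by
          rw [succ_nsmul, hE]
          exact Affine.Point.add_of_Y_eq rfl rfl
        rw [nsmul_eq_zero_iff_psiAt, Nat.cast_add, Nat.cast_one] at h1
        have hs := hd.sum
        rw [h1] at hs hc
        apply mul_left_cancel₀ (mul_ne_zero h0 ht)
        rw [hp, h1, ← hx] at hs
        rw [twoY_negY]
        linear_combination -V.psiAt X y n ^ 4 * tx + hs - V.psiAt X y n * hc
    · obtain ⟨x1, y1, g1, x2, y2, g2, e1, e2, -, -, hd⟩ := exists_add_sub_of_X_ne hX h hXx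
      rw [← hE, ← succ_nsmul] at e1
      have e2' : (n - 1) • Affine.Point.some x y h = .some x2 y2 g2 := by
        rw [← e2, ← hE, eq_sub_iff_add_eq, ← succ_nsmul, Nat.sub_add_cancel hn]
      have hx1 := nsmul_X h e1
      have hx2 := nsmul_X h e2'
      rw [Nat.cast_sub hn, Nat.cast_one] at hx2
      rw [Nat.cast_add, Nat.cast_one] at hx1
      apply mul_left_cancel₀ (mul_ne_zero h0 ht)
      have hdiff : (X - x) * V.psiAt x y n ^ 2 = -V.psiAt x y (n + 1) * V.psiAt x y (n - 1) := by
        linear_combination hx + hphi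
      rw [hp] at hx1
      rw [hm] at hx2
      linear_combination V.psiAt x y n ^ 4 * hd - (x1 - x2) * ((X - x) * V.psiAt x y n ^ 2 -
        V.psiAt x y (n + 1) * V.psiAt x y (n - 1)) * hdiff - V.psiAt x y (n - 1) ^ 2 * hx1 +
        V.psiAt x y (n + 1) ^ 2 * hx2 - V.psiAt x y n * hc

lemma nsmul_Y (h : V.toAffine.Nonsingular x y) {n : ℕ} (hn : 0 < n) {X Y : k}
    {hX : V.toAffine.Nonsingular X Y} (hE : n • Affine.Point.some x y h = .some X Y hX) :
    Y * V.psiAt x y n ^ 3 = V.omegaAt x y n := by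
  have h1 := nsmul_twoY h hn hE
  have h2 := nsmul_X h hE
  rw [omegaAt, ← h1, ← h2, twoY]
  field_simp
  ring

/-- Multiplication by a positive integer is surjective on an elliptic curve over an algebraically
closed field. -/
lemma nsmul_surjective {n : ℕ} (hn : 0 < n) :
    Function.Surjective (fun P : V.toAffine.Point => n • P) := by
  intro R
  rcases R with _ | ⟨X, Y, hX⟩
  · exact ⟨0, smul_zero n⟩
  have hn0 : (n : k) ≠ 0 := by exact_mod_cast hn.ne'
  have hdeg : (V.Φ n - Polynomial.C X * V.ΨSq n).natDegree = n ^ 2 := by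
    have h1 : (Polynomial.C X * V.ΨSq n).natDegree < (V.Φ n).natDegree := by
      rw [V.natDegree_Φ]
      refine (Polynomial.natDegree_C_mul_le _ _).trans_lt ((V.natDegree_ΨSq_le n).trans_lt ?_)
      simp
      positivity
    rw [Polynomial.natDegree_sub_eq_left_of_natDegree_lt h1, V.natDegree_Φ]
    simp
  -- A root of `φₙ - X ψₙ²` is the `x`-coordinate of a point `P` with `nP = ± R`.
  obtain ⟨x, hx⟩ := IsAlgClosed.exists_root (V.Φ n - Polynomial.C X * V.ΨSq n)
    (fun h => by rw [Polynomial.natDegree_eq_of_degree_eq_some h] at hdeg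
                 exact (pow_ne_zero 2 hn.ne') hdeg.symm)
  obtain ⟨y, hy⟩ := exists_equation (V := V) x
  have h : V.toAffine.Nonsingular x y := Affine.equation_iff_nonsingular.mp hy
  have hX' := hasX_nsmul h n
  rw [Polynomial.IsRoot, Polynomial.eval_sub, Polynomial.eval_mul, Polynomial.eval_C,
    ← phiAt_eq_Φ hy, ← psiAt_sq hy] at hx
  rcases hP : n • Affine.Point.some x y h with _ | ⟨X', Y', h'⟩
  · rw [hP] at hX'
    obtain ⟨h1, h2⟩ := hX'
    rw [h1] at hx
    exact absurd (by linear_combination hx) h2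
  · have h1 := nsmul_X h hP
    have h2 := nsmul_psiAt_ne_zero h hP
    have : X' = X := by
      apply mul_right_cancel₀ (pow_ne_zero 2 h2)
      linear_combination h1 + hx
    subst this
    rcases Affine.Y_eq_of_X_eq h'.1 hX.1 rfl with rfl | rfl
    · exact ⟨_, hP⟩
    · refine ⟨-Affine.Point.some x y h, ?_⟩
      change n • (-Affine.Point.some x y h) = _
      rw [smul_neg, hP, neg_eq_iff_eq_neg, Affine.Point.neg_some]

end WeierstrassCurve

namespace PuncturedElliptic.LocalParam

/-! ### Residues at torsion points -/

open WeierstrassCurve PowerSeries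

variable {k : Type*} [Field k] {V : WeierstrassCurve k} {x₀ y₀ : k}
  (γ : LocalParam V x₀ y₀)

lemma omega_eq [CharZero k] [IsAlgClosed k] (h : V.toAffine.Nonsingular x₀ y₀) {w : PowerSeries k}
    (hw : (V.baseChange (PowerSeries k)).HasSpeed (intDerivation k) γ.X γ.Y w) :
    γ.omega = HahnSeries.ofPowerSeries ℤ k w := by
  have h2 : (V.baseChange (PowerSeries k)).twoY γ.X γ.Y ≠ 0 := by
    have := γ.psiAt_ne_zero h 2 two_pos
    rwa [Nat.cast_ofNat, psiAt_two] at this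
  have h2' : algebraMap (PowerSeries k) (LaurentSeries k)
      ((V.baseChange (PowerSeries k)).twoY γ.X γ.Y) ≠ 0 :=
    (map_ne_zero_iff _ (IsFractionRing.injective _ _)).mpr h2
  rw [omega, eval_twoY, div_eq_iff h2']
  change algebraMap (PowerSeries k) (LaurentSeries k) _ =
    algebraMap (PowerSeries k) (LaurentSeries k) _ * _
  rw [← map_mul, ← hw.dx]
  rfl

/-- The coefficient of `s⁻¹` in `w / (s g)` is `w(0) / g(0)`. -/
lemma coeff_neg_one_inv_mul {k : Type*} [Field k] (g w : PowerSeries k) (hg : constantCoeff g ≠ 0) :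
    ((algebraMap (PowerSeries k) (LaurentSeries k) (PowerSeries.X * g))⁻¹ *
      algebraMap (PowerSeries k) (LaurentSeries k) w).coeff (-1) =
      constantCoeff w / constantCoeff g := by
  have hg' : g * g⁻¹ = 1 := PowerSeries.mul_inv_cancel g hg
  have hX : algebraMap (PowerSeries k) (LaurentSeries k) PowerSeries.X = HahnSeries.single 1 1 :=
    HahnSeries.ofPowerSeries_X
  have e : (algebraMap (PowerSeries k) (LaurentSeries k) (PowerSeries.X * g))⁻¹ *
      algebraMap (PowerSeries k) (LaurentSeries k) w =
      HahnSeries.single (-1) 1 * algebraMap (PowerSeries k) (LaurentSeries k) (g⁻¹ * w) := by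
    rw [map_mul, hX, mul_inv, HahnSeries.inv_single, inv_one, map_mul, mul_assoc]
    congr 2
    rw [inv_eq_iff_eq_inv, eq_comm, inv_eq_iff_eq_inv, eq_comm]
    apply inv_eq_of_mul_eq_one_left
    rw [← map_mul, mul_comm, hg', map_one]
  rw [e]
  have := HahnSeries.coeff_single_mul_add (r := (1 : k))
    (x := algebraMap (PowerSeries k) (LaurentSeries k) (g⁻¹ * w)) (a := (0 : ℤ)) (b := -1)
  rw [zero_add] at this
  rw [this, one_mul]
  change (HahnSeries.ofPowerSeries ℤ k (g⁻¹ * w)).coeff ((0 : ℕ) : ℤ) = _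
  rw [HahnSeries.ofPowerSeries_apply_coeff, coeff_zero_eq_constantCoeff_apply, map_mul,
    constantCoeff_inv]
  ring

/-- The residue at an `n`-torsion point of `ψₙ⁻¹ ω`. As `ψₙ` vanishes to first order there, with
derivative found from the Wronskian of `φₙ` and `ψₙ`, it is `-φₙ / (n ωₙ)`. -/
lemma residue_psi_inv [CharZero k] [IsAlgClosed k] [V.IsElliptic]
    (h : V.toAffine.Nonsingular x₀ y₀) {n : ℕ} (hn : 0 < n)
    (h0 : V.psiAt x₀ y₀ n = 0) :
    n * γ.residue (γ.eval (V.ψ n))⁻¹ * V.omegaAt x₀ y₀ n = -V.phiAt x₀ y₀ n := by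
  classical
  obtain ⟨w, hw0, hw⟩ := γ.exists_hasSpeed h
  have hW := congrArg constantCoeff (γ.wronskian h hw n hn)
  obtain ⟨g, hg⟩ := PowerSeries.X_dvd_iff.mpr ((γ.constantCoeff_psiAt n).trans h0)
  have hD : constantCoeff (derivative k ((V.baseChange (PowerSeries k)).psiAt γ.X γ.Y n)) =
      constantCoeff g := by
    rw [← coeff_zero_eq_constantCoeff_apply, coeff_derivative, hg]
    simp [coeff_succ_X_mul]
  have hn0 : (n : k) ≠ 0 := by exact_mod_cast hn.ne'
  have two : constantCoeff (2 : PowerSeries k) = 2 := map_ofNat _ 2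
  have hnn : constantCoeff (n : PowerSeries k) = n := map_natCast _ n
  simp only [map_sub, map_mul, constantCoeff_psiAt, h0, mul_zero, constantCoeff_phiAt, hD,
    constantCoeff_psicAt, two, hnn, zero_sub] at hW
  have hphi := phiAt_ne_zero_of_psiAt_eq_zero h n h0
  have hom := omegaAt_sq_of_psiAt_eq_zero h hn h0
  have ho : V.omegaAt x₀ y₀ n ≠ 0 := by
    intro h
    rw [h, zero_pow two_ne_zero, eq_comm, pow_eq_zero_iff three_ne_zero] at hom
    exact hphi hom
  have hpc : V.psicAt x₀ y₀ n = 2 * V.omegaAt x₀ y₀ n := by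
    rw [omegaAt, h0]; ring
  rw [hpc] at hW
  have hg0 : constantCoeff g ≠ 0 := by
    intro h
    rw [h] at hW
    simp [hn0, hw0, ho] at hW
  rw [residue, γ.omega_eq h hw, eval_ψ, hg]
  rw [show HahnSeries.ofPowerSeries ℤ k w = algebraMap _ (LaurentSeries k) w from rfl,
    coeff_neg_one_inv_mul _ _ hg0]
  field_simp
  linear_combination -hW / 2

/-- The square of `n Res (ψₙ⁻¹ ω)` is `φₙ⁻¹`, since `ωₙ² = φₙ³` at a zero of `ψₙ`. -/
lemma residue_psi_inv_sq_mul [CharZero k] [IsAlgClosed k] [V.IsElliptic]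
    (h : V.toAffine.Nonsingular x₀ y₀) {n : ℕ} (hn : 0 < n) (h0 : V.psiAt x₀ y₀ n = 0) :
    ((-1) ^ (n + 1) * n * γ.residue (γ.eval (V.ψ n))⁻¹) ^ 2 * V.phiAt x₀ y₀ n = 1 := by
  classical
  have hr := γ.residue_psi_inv h hn h0
  have hom := omegaAt_sq_of_psiAt_eq_zero h hn h0
  have hphi := phiAt_ne_zero_of_psiAt_eq_zero h n h0
  apply mul_right_cancel₀ (pow_ne_zero 2 hphi)
  have hs : ((-1 : k) ^ (n + 1)) ^ 2 = 1 := by rw [← pow_mul, mul_comm, pow_mul]; simp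
  set r := γ.residue (γ.eval (V.ψ n))⁻¹
  linear_combination (n * r) ^ 2 * V.phiAt x₀ y₀ n ^ 3 * hs - (n * r) ^ 2 * hom +
    (n * r * V.omegaAt x₀ y₀ n - V.phiAt x₀ y₀ n) * hr

end PuncturedElliptic.LocalParam

namespace PuncturedElliptic

/-! ### Functions that are locally fractions of polynomials -/

section RegAt

variable {α β σ τ : Type*} (κ : α → σ → Qbar) (D : Set α) (p : α)

/-- The trace on `D` of the Zariski neighbourhoods of `p`, for a set `α` with coordinate functions
`κ`. A basis is given by the loci where a polynomial with rational coefficients that does not vanish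
at `p` does not vanish. -/
def zariskiNhds : Filter α where
  sets := {S | ∃ b : MvPolynomial σ ℚ, MvPolynomial.aeval (κ p) b ≠ 0 ∧
    ∀ q ∈ D, MvPolynomial.aeval (κ q) b ≠ 0 → q ∈ S}
  univ_sets := ⟨1, by simp, fun _ _ _ => trivial⟩
  sets_of_superset := fun ⟨b, hb, h⟩ hS => ⟨b, hb, fun q hq hq' => hS (h q hq hq')⟩
  inter_sets := fun ⟨b, hb, h⟩ ⟨b', hb', h'⟩ => ⟨b * b', by simpa using ⟨hb, hb'⟩,
    fun q hq hq' => by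
    rw [map_mul] at hq'
    exact ⟨h q hq (left_ne_zero_of_mul hq'), h' q hq (right_ne_zero_of_mul hq')⟩⟩

/-- A function is given by a fraction of polynomials with rational coefficients near `p`. -/
def RegAt (f : α → Qbar) : Prop :=
  ∃ a b : MvPolynomial σ ℚ, MvPolynomial.aeval (κ p) b ≠ 0 ∧
    ∀ᶠ q in zariskiNhds κ D p, f q = MvPolynomial.aeval (κ q) a / MvPolynomial.aeval (κ q) b

variable {κ D p}

lemma eventually_mem_domain : ∀ᶠ q in zariskiNhds κ D p, q ∈ D :=
  ⟨1, by simp, fun _ hq _ => hq⟩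

lemma eventually_aeval_ne_zero {b : MvPolynomial σ ℚ} (hb : MvPolynomial.aeval (κ p) b ≠ 0) :
    ∀ᶠ q in zariskiNhds κ D p, MvPolynomial.aeval (κ q) b ≠ 0 :=
  ⟨b, hb, fun _ _ hq => hq⟩

lemma eventually_self (hp : p ∈ D) {S : α → Prop} (h : ∀ᶠ q in zariskiNhds κ D p, S q) : S p := by
  obtain ⟨b, hb, h⟩ := h
  exact h p hp hb

namespace RegAt

variable {f g : α → Qbar}

lemma congr (hf : RegAt κ D p f) (h : ∀ᶠ q in zariskiNhds κ D p, g q = f q) : RegAt κ D p g := by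
  obtain ⟨a, b, hb, hf⟩ := hf
  exact ⟨a, b, hb, by filter_upwards [hf, h] with q h1 h2 using h2.trans h1⟩

lemma const (c : ℚ) : RegAt κ D p fun _ => algebraMap ℚ Qbar c :=
  ⟨MvPolynomial.C c, 1, by simp, .of_forall fun q => by simp⟩

lemma one : RegAt κ D p fun _ => 1 := by simpa using const (κ := κ) (D := D) (p := p) 1

lemma coord (l : σ) : RegAt κ D p fun q => κ q l :=
  ⟨MvPolynomial.X l, 1, by simp, .of_forall fun q => by simp⟩

lemma add (hf : RegAt κ D p f) (hg : RegAt κ D p g) : RegAt κ D p fun q => f q + g q := by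
  obtain ⟨a, b, hb, hf⟩ := hf
  obtain ⟨a', b', hb', hg⟩ := hg
  refine ⟨a * b' + b * a', b * b', by simpa using ⟨hb, hb'⟩, ?_⟩
  filter_upwards [hf, hg, eventually_aeval_ne_zero hb, eventually_aeval_ne_zero hb']
    with q h1 h2 h3 h4
  rw [h1, h2, div_add_div _ _ h3 h4]
  simp

lemma mul (hf : RegAt κ D p f) (hg : RegAt κ D p g) : RegAt κ D p fun q => f q * g q := by
  obtain ⟨a, b, hb, hf⟩ := hf
  obtain ⟨a', b', hb', hg⟩ := hg
  refine ⟨a * a', b * b', by simpa using ⟨hb, hb'⟩, ?_⟩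
  filter_upwards [hf, hg] with q h1 h2
  rw [h1, h2, div_mul_div_comm]
  simp

lemma neg (hf : RegAt κ D p f) : RegAt κ D p fun q => -f q := by
  simpa using (const (-1)).mul hf

lemma sub (hf : RegAt κ D p f) (hg : RegAt κ D p g) : RegAt κ D p fun q => f q - g q := by
  simpa only [sub_eq_add_neg] using hf.add hg.neg

lemma pow (hf : RegAt κ D p f) (n : ℕ) : RegAt κ D p fun q => f q ^ n := by
  induction n with
  | zero => simpa using one
  | succ n ih => simpa only [pow_succ] using ih.mul hf

lemma sum {ι : Type*} (s : Finset ι) {f : ι → α → Qbar} (hf : ∀ i ∈ s, RegAt κ D p (f i)) :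
    RegAt κ D p fun q => ∑ i ∈ s, f i q := by
  classical
  induction s using Finset.induction_on with
  | empty => simpa using const (κ := κ) (D := D) (p := p) 0
  | insert i s hi ih =>
    simp only [Finset.sum_insert hi]
    exact (hf i (Finset.mem_insert_self i s)).add
      (ih fun j hj => hf j (Finset.mem_insert_of_mem hj))

lemma aeval_polynomial (hf : RegAt κ D p f) (a : ℚ[X]) :
    RegAt κ D p fun q => Polynomial.aeval (f q) a := by
  simp only [Polynomial.aeval_eq_sum_range, Algebra.smul_def]
  exact sum _ fun i _ => (const _).mul (hf.pow i)

lemma aeval_mvPolynomial {g : α → τ → Qbar} (hg : ∀ l, RegAt κ D p fun q => g q l)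
    (a : MvPolynomial τ ℚ) : RegAt κ D p fun q => MvPolynomial.aeval (g q) a := by
  induction a using MvPolynomial.induction_on with
  | C c => simpa using const c
  | add a b ha hb => simpa using ha.add hb
  | mul_X a l ha => simpa using ha.mul (hg l)

lemma eventually_ne (hf : RegAt κ D p f) (hp : p ∈ D) (h0 : f p ≠ 0) :
    ∀ᶠ q in zariskiNhds κ D p, f q ≠ 0 := by
  obtain ⟨a, b, hb, hf⟩ := hf
  have h1 := eventually_self hp hf
  have ha : MvPolynomial.aeval (κ p) a ≠ 0 := by
    intro h
    rw [h, zero_div] at h1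
    exact h0 h1
  filter_upwards [hf, eventually_aeval_ne_zero hb, eventually_aeval_ne_zero ha] with q h1 h2 h3
  rw [h1]
  exact div_ne_zero h3 h2

lemma inv (hf : RegAt κ D p f) (hp : p ∈ D) (h0 : f p ≠ 0) : RegAt κ D p fun q => (f q)⁻¹ := by
  obtain ⟨a, b, hb, hf⟩ := hf
  have h1 := eventually_self hp hf
  refine ⟨b, a, fun h => ?_, ?_⟩
  · rw [h, zero_div] at h1
    exact h0 h1
  · filter_upwards [hf] with q h1
    rw [h1, inv_div]

lemma div (hf : RegAt κ D p f) (hg : RegAt κ D p g) (hp : p ∈ D) (h0 : g p ≠ 0) :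
    RegAt κ D p fun q => f q / g q := by
  simpa only [div_eq_mul_inv] using hf.mul (hg.inv hp h0)

lemma zpow (hf : RegAt κ D p f) (hp : p ∈ D) (h0 : f p ≠ 0) (n : ℤ) :
    RegAt κ D p fun q => f q ^ n := by
  rcases n with n | n
  · simpa using hf.pow n
  · simpa using (hf.inv hp h0).pow (n + 1)

end RegAt

variable {κ' : β → τ → Qbar} {D' : Set β} {φ : α → β}

lemma tendsto_zariskiNhds (hp : p ∈ D) (hφ : ∀ l, RegAt κ D p fun q => κ' (φ q) l)
    (hD : ∀ᶠ q in zariskiNhds κ D p, φ q ∈ D') :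
    Filter.Tendsto φ (zariskiNhds κ D p) (zariskiNhds κ' D' (φ p)) := by
  intro S ⟨b, hb, h⟩
  have := (RegAt.aeval_mvPolynomial hφ b).eventually_ne hp hb
  change ∀ᶠ q in zariskiNhds κ D p, φ q ∈ S
  filter_upwards [hD, this] with q h1 h2 using h _ h1 h2

lemma RegAt.comp {f : β → Qbar} (hf : RegAt κ' D' (φ p) f) (hp : p ∈ D)
    (hφ : ∀ l, RegAt κ D p fun q => κ' (φ q) l)
    (hD : ∀ᶠ q in zariskiNhds κ D p, φ q ∈ D') : RegAt κ D p fun q => f (φ q) := by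
  obtain ⟨a, b, hb, hf⟩ := hf
  have h1 : RegAt κ D p fun q => MvPolynomial.aeval (κ' (φ q)) a /
      MvPolynomial.aeval (κ' (φ q)) b :=
    (RegAt.aeval_mvPolynomial hφ a).div (RegAt.aeval_mvPolynomial hφ b) hp hb
  exact h1.congr ((tendsto_zariskiNhds hp hφ hD).eventually hf)

end RegAt

/-! ### Regular maps between torsors in terms of local coordinates -/

namespace Torsor

variable {W : WeierstrassCurve ℚ} {T T' : Torsor W}

/-- A map that is regular in some charts around every point is regular. -/
lemma isRegular_of_regAt {φ : T.Pt → T'.Pt}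
    (h : ∀ p : T.Pt, ∃ (i : T.ChartIdx) (j : T'.ChartIdx), p ∈ T.chartDom i ∧
      (∀ᶠ q in zariskiNhds (T.chartCoord i) (T.chartDom i) p, φ q ∈ T'.chartDom j) ∧
      ∀ l, RegAt (T.chartCoord i) (T.chartDom i) p fun q => T'.chartCoord j (φ q) l) :
    IsRegular φ := by
  intro p
  obtain ⟨i, j, hp, hD, hl⟩ := h p
  choose a b hb hab using hl
  obtain ⟨d, hd, hd'⟩ := hD.and (Filter.eventually_all.mpr hab)
  -- A common denominator, which also cuts out a neighbourhood on which all fractions are valid.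
  refine ⟨i, j, fun l => a l * d * ∏ m ∈ Finset.univ.erase l, b m, d * ∏ m, b m, hp, ?_, ?_⟩
  · rw [map_mul, map_prod]
    exact mul_ne_zero hd (Finset.prod_ne_zero_iff.mpr fun m _ => hb m)
  · intro q hq hq0
    rw [map_mul] at hq0
    obtain ⟨h1, h2⟩ := hd' q hq (left_ne_zero_of_mul hq0)
    refine ⟨h1, fun l => ?_⟩
    have hq1 := right_ne_zero_of_mul hq0
    have h3 := h2 l
    simp only at h3 ⊢
    rw [h3, ← Finset.mul_prod_erase _ b (Finset.mem_univ l)]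
    rw [← Finset.mul_prod_erase _ b (Finset.mem_univ l), map_mul] at hq1
    simp only [map_mul]
    have := left_ne_zero_of_mul hq0
    have := left_ne_zero_of_mul hq1
    have := right_ne_zero_of_mul hq1
    field_simp

lemma IsRegular.exists_regAt {φ : T.Pt → T'.Pt} (h : IsRegular φ) (p : T.Pt) :
    ∃ (i : T.ChartIdx) (j : T'.ChartIdx), p ∈ T.chartDom i ∧
      (∀ᶠ q in zariskiNhds (T.chartCoord i) (T.chartDom i) p, φ q ∈ T'.chartDom j) ∧
      ∀ l, RegAt (T.chartCoord i) (T.chartDom i) p fun q => T'.chartCoord j (φ q) l := by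
  obtain ⟨i, j, a, b, hp, hb, h⟩ := h p
  exact ⟨i, j, hp, ⟨b, hb, fun q hq hq0 => (h q hq hq0).1⟩, fun l =>
    ⟨a l, b, hb, ⟨b, hb, fun q hq hq0 => (h q hq hq0).2 l⟩⟩⟩

end Torsor

end PuncturedElliptic

namespace PuncturedElliptic

open WeierstrassCurve

/-! ### Regular functions on the curve -/

variable {W : WeierstrassCurve ℚ}

/-- The coordinates of a chart of the curve. -/
noncomputable def Chart.coord (c : Chart) (P : Pts W) : Fin 2 → Qbar := ![c.fst P, c.snd P]

/-- A choice of a chart around a given point: `Y` for an affine point, and `U` for the origin. -/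
def chartAt : Pts W → Chart
  | .zero => .U
  | .some _ _ _ => .Y

/-- The Zariski neighbourhoods of a point of the curve. -/
noncomputable abbrev nhdsE (P₀ : Pts W) : Filter (Pts W) :=
  zariskiNhds (chartAt P₀).coord {P | (chartAt P₀).Mem P} P₀

/-- A function on the curve is regular at a point. -/
abbrev RegE (P₀ : Pts W) (f : Pts W → Qbar) : Prop :=
  RegAt (chartAt P₀).coord {P | (chartAt P₀).Mem P} P₀ f

lemma mem_chartAt (P₀ : Pts W) : P₀ ∈ {P : Pts W | (chartAt P₀).Mem P} := by
  cases P₀ <;> exact trivial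

lemma chartAt_of_ne_zero {P₀ : Pts W} (h : P₀ ≠ 0) : chartAt P₀ = .Y := by
  cases P₀
  · exact absurd rfl h
  · rfl

lemma Chart.mem_Y_iff {P : Pts W} : Chart.Y.Mem P ↔ P ≠ 0 := by
  cases P
  · exact ⟨fun h => h.elim, fun h => (h rfl).elim⟩
  · exact ⟨fun _ h => by simp at h, fun _ => trivial⟩

lemma eventually_ne_zero {P₀ : Pts W} (h : P₀ ≠ 0) : ∀ᶠ P in nhdsE P₀, P ≠ 0 := by
  filter_upwards [eventually_mem_domain] with P hP
  rw [chartAt_of_ne_zero h] at hP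
  exact Chart.mem_Y_iff.mp hP

lemma eventually_mem_U : ∀ᶠ P in nhdsE (0 : Pts W), Chart.U.Mem P := eventually_mem_domain

lemma regE_chartAt_fst (P₀ : Pts W) : RegE P₀ (chartAt P₀).fst := RegAt.coord 0

lemma regE_chartAt_snd (P₀ : Pts W) : RegE P₀ (chartAt P₀).snd := RegAt.coord 1

lemma regE_x {P₀ : Pts W} (h : P₀ ≠ 0) : RegE P₀ Chart.Y.fst := by
  have := regE_chartAt_fst P₀
  rwa [show (chartAt P₀).fst = Chart.Y.fst by rw [chartAt_of_ne_zero h]] at this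

lemma regE_y {P₀ : Pts W} (h : P₀ ≠ 0) : RegE P₀ Chart.Y.snd := by
  have := regE_chartAt_snd P₀
  rwa [show (chartAt P₀).snd = Chart.Y.snd by rw [chartAt_of_ne_zero h]] at this

lemma regE_t : RegE (0 : Pts W) Chart.U.fst := regE_chartAt_fst 0

lemma regE_u : RegE (0 : Pts W) Chart.U.snd := regE_chartAt_snd 0

/-- The coordinates of any chart are regular on its domain, which is open. -/
lemma Chart.regE_coord (c : Chart) {P₀ : Pts W} (h : c.Mem P₀) :
    (∀ᶠ P in nhdsE P₀, c.Mem P) ∧ RegE P₀ c.fst ∧ RegE P₀ c.snd := by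
  by_cases h0 : P₀ = 0
  · subst h0
    rcases c with _ | _
    · exact h.elim
    · exact ⟨eventually_mem_U, regE_t, regE_u⟩
  · rcases c with _ | _
    · refine ⟨?_, regE_x h0, regE_y h0⟩
      filter_upwards [eventually_ne_zero h0] with P hP using Chart.mem_Y_iff.mpr hP
    · obtain ⟨x, y, hxy, rfl⟩ : ∃ x y hxy, P₀ = .some x y hxy := by
        cases P₀
        · exact absurd rfl h0
        · exact ⟨_, _, _, rfl⟩
      have hx := (regE_x h0).eventually_ne (mem_chartAt _) h.1
      have hy := (regE_y h0).eventually_ne (mem_chartAt _) h.2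
      refine ⟨?_, ?_, ?_⟩
      · filter_upwards [eventually_ne_zero h0, hx, hy] with P hP h1 h2
        cases P
        · exact trivial
        · exact ⟨h1, h2⟩
      · refine ((regE_x h0).neg.div (regE_y h0) (mem_chartAt _) h.2).congr ?_
        filter_upwards [eventually_ne_zero h0] with P hP
        cases P
        · exact absurd rfl hP
        · rfl
      · refine ((RegAt.one.neg).div (regE_y h0) (mem_chartAt _) h.2).congr ?_
        filter_upwards [eventually_ne_zero h0] with P hP
        cases P
        · exact absurd rfl hP
        · rfl

/-- A self-map of the curve is a morphism near a point. -/
def RegMapAt (φ : Pts W → Pts W) (P₀ : Pts W) : Prop :=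
  (∀ᶠ P in nhdsE P₀, (chartAt (φ P₀)).Mem (φ P)) ∧
    RegE P₀ (fun P => (chartAt (φ P₀)).fst (φ P)) ∧ RegE P₀ (fun P => (chartAt (φ P₀)).snd (φ P))

lemma RegE.comp {φ : Pts W → Pts W} {P₀ : Pts W} {f : Pts W → Qbar} (hf : RegE (φ P₀) f)
    (hφ : RegMapAt φ P₀) : RegE P₀ fun P => f (φ P) := by
  refine RegAt.comp hf (mem_chartAt P₀) (fun l => ?_) hφ.1
  fin_cases l
  · exact hφ.2.1
  · exact hφ.2.2

lemma RegMapAt.tendsto {φ : Pts W → Pts W} {P₀ : Pts W} (hφ : RegMapAt φ P₀) :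
    Filter.Tendsto φ (nhdsE P₀) (nhdsE (φ P₀)) := by
  refine tendsto_zariskiNhds (mem_chartAt P₀) (fun l => ?_) hφ.1
  fin_cases l
  · exact hφ.2.1
  · exact hφ.2.2

/-! ### Division polynomials as regular functions -/

/-- The values on the curve of a function of the affine coordinates (meaningful on `Y` only). -/
noncomputable def affineFun (g : Qbar → Qbar → Qbar) (P : Pts W) : Qbar :=
  g (Chart.Y.fst P) (Chart.Y.snd P)

@[simp] lemma affineFun_some (g : Qbar → Qbar → Qbar) {x y : Qbar}
    (h : (W.baseChange Qbar).toAffine.Nonsingular x y) :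
    affineFun g (.some x y h : Pts W) = g x y :=
  rfl

lemma eval_baseChange_map (p : ℚ[X]) (x : Qbar) :
    (p.map (algebraMap ℚ Qbar)).eval x = Polynomial.aeval x p := Polynomial.eval_map_algebraMap ..

lemma RegAt.congr_affine {P₀ : Pts W} {f g : Pts W → Qbar}
    (hf : RegAt (chartAt P₀).coord {P | (chartAt P₀).Mem P} P₀ f) (h0 : P₀ ≠ 0)
    (h : ∀ x y hxy, g (.some x y hxy) = f (.some x y hxy)) : RegE P₀ g := by
  refine RegAt.congr hf ?_
  filter_upwards [eventually_ne_zero h0] with P hP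
  cases P
  · exact absurd rfl hP
  · exact h _ _ _

lemma regE_const {P₀ : Pts W} (c : ℚ) : RegE P₀ fun _ => algebraMap ℚ Qbar c := RegAt.const c

lemma regE_twoY {P₀ : Pts W} (h0 : P₀ ≠ 0) :
    RegE P₀ (affineFun (W.baseChange Qbar).twoY) := by
  have := (((regE_const 2).mul (regE_y h0)).add ((regE_const W.a₁).mul (regE_x h0))).add
    (regE_const W.a₃)
  refine this.congr_affine h0 fun x y h => ?_
  simp [twoY, Chart.fst, Chart.snd]

lemma psiAt_baseChange {x y : Qbar} (h : (W.baseChange Qbar).toAffine.Nonsingular x y) (n : ℤ) :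
    (W.baseChange Qbar).psiAt x y n = Polynomial.aeval x (W.preΨ n) *
      if Even n then (W.baseChange Qbar).twoY x y else 1 := by
  rw [psiAt_eq_preΨ h.1, ← eval_baseChange_map, ← map_preΨ, ← baseChange]

lemma phiAt_baseChange {x y : Qbar} (h : (W.baseChange Qbar).toAffine.Nonsingular x y) (n : ℤ) :
    (W.baseChange Qbar).phiAt x y n = Polynomial.aeval x (W.Φ n) := by
  rw [phiAt_eq_Φ h.1, ← eval_baseChange_map, ← map_Φ, ← baseChange]

lemma psicAt_baseChange (x y : Qbar) (n : ℤ) :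
    (W.baseChange Qbar).psicAt x y n = Polynomial.aeval x (W.complΨ n) *
      if Even n then 1 else (W.baseChange Qbar).twoY x y := by
  rw [psicAt, ← eval_baseChange_map, ← complΨ_map, ← baseChange]

lemma regE_psiAt {P₀ : Pts W} (h0 : P₀ ≠ 0) (n : ℤ) :
    RegE P₀ (affineFun fun x y => (W.baseChange Qbar).psiAt x y n) := by
  have h1 := (regE_x h0).aeval_polynomial (W.preΨ n)
  by_cases hn : Even n
  · refine (h1.mul (regE_twoY h0)).congr_affine h0 fun x y h => ?_
    simp only [affineFun_some, psiAt_baseChange h, if_pos hn, Chart.fst]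
  · refine h1.congr_affine h0 fun x y h => ?_
    simp only [affineFun_some, psiAt_baseChange h, if_neg hn, Chart.fst, mul_one]

lemma regE_phiAt {P₀ : Pts W} (h0 : P₀ ≠ 0) (n : ℤ) :
    RegE P₀ (affineFun fun x y => (W.baseChange Qbar).phiAt x y n) := by
  refine ((regE_x h0).aeval_polynomial (W.Φ n)).congr_affine h0 fun x y h => ?_
  simp only [affineFun_some, phiAt_baseChange h, Chart.fst]

lemma regE_psicAt {P₀ : Pts W} (h0 : P₀ ≠ 0) (n : ℤ) :
    RegE P₀ (affineFun fun x y => (W.baseChange Qbar).psicAt x y n) := by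
  have h1 := (regE_x h0).aeval_polynomial (W.complΨ n)
  by_cases hn : Even n
  · refine h1.congr_affine h0 fun x y h => ?_
    simp only [affineFun_some, psicAt_baseChange, if_pos hn, Chart.fst, mul_one]
  · refine (h1.mul (regE_twoY h0)).congr_affine h0 fun x y h => ?_
    simp only [affineFun_some, psicAt_baseChange, if_neg hn, Chart.fst]

lemma regE_omegaAt {P₀ : Pts W} (h0 : P₀ ≠ 0) (n : ℤ) :
    RegE P₀ (affineFun fun x y => (W.baseChange Qbar).omegaAt x y n) := by
  have hψ := regE_psiAt h0 n
  have := (((regE_psicAt h0 n).sub (((regE_const W.a₁).mul (regE_phiAt h0 n)).mul hψ)).sub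
    ((regE_const W.a₃).mul (hψ.pow 3))).mul (regE_const 2⁻¹)
  refine this.congr_affine h0 fun x y h => ?_
  simp [omegaAt, div_eq_mul_inv]

/-! ### Negation -/

/-- The function `t(-P) / -t(P)` near the origin. -/
noncomputable def negFactor (P : Pts W) : Qbar :=
  (1 - algebraMap ℚ Qbar W.a₁ * Chart.U.fst P - algebraMap ℚ Qbar W.a₃ * Chart.U.snd P)⁻¹

@[simp] lemma negFactor_zero : negFactor (0 : Pts W) = 1 := by
  simp [negFactor, Chart.fst, Chart.snd]

lemma regE_negFactor_inv : RegE (0 : Pts W) fun P =>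
    1 - algebraMap ℚ Qbar W.a₁ * Chart.U.fst P - algebraMap ℚ Qbar W.a₃ * Chart.U.snd P :=
  (RegAt.one.sub ((regE_const _).mul regE_t)).sub ((regE_const _).mul regE_u)

lemma regE_negFactor : RegE (0 : Pts W) negFactor := by
  refine regE_negFactor_inv.inv (mem_chartAt _) ?_
  simp [Chart.fst, Chart.snd]

lemma eventually_neg_mem_U : ∀ᶠ P in nhdsE (0 : Pts W), Chart.U.Mem (-P) ∧
    Chart.U.fst (-P) = -Chart.U.fst P * negFactor P ∧
    Chart.U.snd (-P) = -Chart.U.snd P * negFactor P ∧ negFactor P ≠ 0 := by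
  have h := (regE_negFactor (W := W)).eventually_ne (mem_chartAt _) (by simp)
  filter_upwards [eventually_mem_U, h] with P hP hg
  rcases P with _ | ⟨x, y, hxy⟩
  · change Chart.U.Mem (0 : Pts W) ∧ Chart.U.fst (0 : Pts W) = -0 * _ ∧
      Chart.U.snd (0 : Pts W) = -0 * _ ∧ _
    rw [neg_zero, zero_mul]
    exact ⟨trivial, rfl, rfl, hg⟩
  · obtain ⟨hx, hy⟩ := hP
    have hE := inv_ne_zero hg
    have hE' : (negFactor (.some x y hxy : Pts W))⁻¹ =
      -((W.baseChange Qbar).toAffine.negY x y) / y := by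
      simp only [negFactor, Chart.fst, Chart.snd, Affine.negY, baseChange, map_a₁, map_a₃]
      field_simp
      ring
    have hn : (W.baseChange Qbar).toAffine.negY x y ≠ 0 := by
      intro h; rw [hE', h] at hE; simp at hE
    have e : negFactor (.some x y hxy : Pts W) = -y / (W.baseChange Qbar).toAffine.negY x y := by
      rw [← inv_inv (negFactor _), hE', inv_div, div_neg, neg_div]
    refine ⟨⟨hx, hn⟩, ?_, ?_, hg⟩
    · rw [Affine.Point.neg_some, e]
      simp only [Chart.fst]
      field_simp
    · rw [Affine.Point.neg_some, e]
      simp only [Chart.snd]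
      field_simp

lemma regMapAt_neg (P₀ : Pts W) : RegMapAt (fun P => -P) P₀ := by
  by_cases h0 : P₀ = 0
  · subst h0
    refine ⟨?_, ?_, ?_⟩
    · filter_upwards [eventually_neg_mem_U] with P h using h.1
    · refine (regE_t.neg.mul regE_negFactor).congr ?_
      filter_upwards [eventually_neg_mem_U] with P h using h.2.1
    · refine (regE_u.neg.mul regE_negFactor).congr ?_
      filter_upwards [eventually_neg_mem_U] with P h using h.2.2.1
  · have h0' : -P₀ ≠ 0 := neg_ne_zero.mpr h0
    refine ⟨?_, ?_, ?_⟩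
    · filter_upwards [eventually_ne_zero h0] with P h
      rw [chartAt_of_ne_zero h0', Chart.mem_Y_iff]
      exact neg_ne_zero.mpr h
    · rw [chartAt_of_ne_zero h0']
      exact (regE_x h0).congr_affine h0 fun x y h => rfl
    · rw [chartAt_of_ne_zero h0']
      refine (((regE_y h0).neg.sub ((regE_const W.a₁).mul (regE_x h0))).sub
        (regE_const W.a₃)).congr_affine h0 fun x y h => ?_
      simp only [Affine.Point.neg_some]
      simp [Chart.fst, Chart.snd, Affine.negY]

end PuncturedElliptic

namespace PuncturedElliptic

open WeierstrassCurve

variable {W : WeierstrassCurve ℚ}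

/-! ### Division polynomials near the origin -/

lemma baseChange_a₁ : (W.baseChange Qbar).a₁ = algebraMap ℚ Qbar W.a₁ := rfl

lemma baseChange_a₃ : (W.baseChange Qbar).a₃ = algebraMap ℚ Qbar W.a₃ := rfl

instance isElliptic_baseChange [W.IsElliptic] : (W.baseChange Qbar).IsElliptic :=
  inferInstanceAs (W.map (algebraMap ℚ Qbar)).IsElliptic

/-- The function `t³ / u`, expanded through the equation of the curve in terms of the coordinates
`t, u` at the origin. -/
noncomputable def vFun (P : Pts W) : Qbar :=
  1 - algebraMap ℚ Qbar W.a₁ * Chart.U.fst P - algebraMap ℚ Qbar W.a₂ * Chart.U.fst P ^ 2 -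
    algebraMap ℚ Qbar W.a₃ * Chart.U.snd P -
    algebraMap ℚ Qbar W.a₄ * Chart.U.fst P * Chart.U.snd P -
    algebraMap ℚ Qbar W.a₆ * Chart.U.snd P ^ 2

@[simp] lemma U_fst_zero : Chart.U.fst (0 : Pts W) = 0 := rfl

@[simp] lemma U_snd_zero : Chart.U.snd (0 : Pts W) = 0 := rfl

@[simp] lemma vFun_zero : vFun (0 : Pts W) = 1 := by simp [vFun]

lemma regE_vFun : RegE (0 : Pts W) vFun :=
  ((((RegAt.one.sub ((regE_const _).mul regE_t)).sub ((regE_const _).mul (regE_t.pow 2))).sub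
    ((regE_const _).mul regE_u)).sub (((regE_const _).mul regE_t).mul regE_u)).sub
    ((regE_const _).mul (regE_u.pow 2))

section

variable {x y : Qbar} {h : (W.baseChange Qbar).toAffine.Nonsingular x y}

lemma U_fst_ne_zero (hU : Chart.U.Mem (.some x y h : Pts W)) :
    Chart.U.fst (.some x y h : Pts W) ≠ 0 :=
  div_ne_zero (neg_ne_zero.mpr hU.1) hU.2

lemma vFun_some (hU : Chart.U.Mem (.some x y h : Pts W)) :
    vFun (.some x y h : Pts W) = x ^ 3 / y ^ 2 := by
  obtain ⟨hx, hy⟩ := hU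
  have := (Affine.equation_iff ..).mp h.1
  simp only [baseChange, map_a₁, map_a₂, map_a₃, map_a₄, map_a₆] at this
  simp only [vFun, Chart.fst, Chart.snd]
  field_simp
  linear_combination this

lemma x_mul_t_sq (hU : Chart.U.Mem (.some x y h : Pts W)) :
    x * Chart.U.fst (.some x y h : Pts W) ^ 2 = vFun (.some x y h : Pts W) := by
  have hy := hU.2
  rw [vFun_some hU]
  simp only [Chart.fst]
  field_simp

lemma y_mul_t_cube (hU : Chart.U.Mem (.some x y h : Pts W)) :
    y * Chart.U.fst (.some x y h : Pts W) ^ 3 = -vFun (.some x y h : Pts W) := by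
  have hy := hU.2
  rw [vFun_some hU]
  simp only [Chart.fst]
  field_simp

end

/-- The function `t ^ (2 d) * p(x)` near the origin, for a polynomial `p` of degree at most `d`. It
is regular at the origin since `t² x` is the function `vFun`. -/
noncomputable def homogFun (p : ℚ[X]) (d : ℕ) (P : Pts W) : Qbar :=
  ∑ j ∈ Finset.range (d + 1),
    algebraMap ℚ Qbar (p.coeff j) * vFun P ^ j * Chart.U.fst P ^ (2 * (d - j))

lemma regE_homogFun (p : ℚ[X]) (d : ℕ) : RegE (0 : Pts W) (homogFun p d) :=
  RegAt.sum _ fun _ _ => ((regE_const _).mul (regE_vFun.pow _)).mul (regE_t.pow _)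

lemma homogFun_zero (p : ℚ[X]) (d : ℕ) :
    homogFun p d (0 : Pts W) = algebraMap ℚ Qbar (p.coeff d) := by
  rw [homogFun, Finset.sum_eq_single d]
  · simp
  · intro j hj hjd
    have : 2 * (d - j) ≠ 0 := by have := Finset.mem_range.mp hj; omega
    simp [this]
  · simp

lemma homogFun_some {p : ℚ[X]} {d : ℕ} (hd : p.natDegree ≤ d) {x y : Qbar}
    {h : (W.baseChange Qbar).toAffine.Nonsingular x y} (hU : Chart.U.Mem (.some x y h : Pts W)) :
    homogFun p d (.some x y h : Pts W) =
      Polynomial.aeval x p * Chart.U.fst (.some x y h : Pts W) ^ (2 * d) := by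
  rw [homogFun, Polynomial.aeval_eq_sum_range' (Nat.lt_succ_of_le hd), Finset.sum_mul]
  refine Finset.sum_congr rfl fun j hj => ?_
  rw [← x_mul_t_sq hU, Algebra.smul_def]
  have : 2 * d = 2 * j + 2 * (d - j) := by have := Finset.mem_range.mp hj; omega
  rw [this, pow_add, mul_pow, ← pow_mul]
  ring

/-- The function `t³ (2 y + a₁ x + a₃)` near the origin. -/
noncomputable def twoYHat (P : Pts W) : Qbar :=
  -2 * vFun P + algebraMap ℚ Qbar W.a₁ * Chart.U.fst P * vFun P +
    algebraMap ℚ Qbar W.a₃ * Chart.U.fst P ^ 3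

lemma regE_twoYHat : RegE (0 : Pts W) twoYHat := by
  have h2 : RegE (0 : Pts W) fun _ => (-2 : Qbar) := by
    simpa using regE_const (W := W) (P₀ := 0) (-2)
  exact ((h2.mul regE_vFun).add (((regE_const _).mul regE_t).mul regE_vFun)).add
    ((regE_const _).mul (regE_t.pow 3))

lemma twoYHat_some {x y : Qbar} {h : (W.baseChange Qbar).toAffine.Nonsingular x y}
    (hU : Chart.U.Mem (.some x y h : Pts W)) :
    twoYHat (.some x y h : Pts W) =
      (W.baseChange Qbar).twoY x y * Chart.U.fst (.some x y h : Pts W) ^ 3 := by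
  have h1 := x_mul_t_sq hU
  have h2 := y_mul_t_cube hU
  rw [twoYHat, twoY, baseChange_a₁, baseChange_a₃]
  generalize Chart.U.fst (.some x y h : Pts W) = t at *
  linear_combination -2 * h2 - algebraMap ℚ Qbar W.a₁ * t * h1

/-- The degree of the polynomial `preΨₙ`. -/
def preDeg (n : ℕ) : ℕ := (n ^ 2 - if Even n then 4 else 1) / 2

/-- The function `t ^ (n² - 1) ψₙ` near the origin. -/
noncomputable def psiHat (n : ℕ) (P : Pts W) : Qbar :=
  homogFun (W.preΨ n) (preDeg n) P * if Even n then twoYHat P else 1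

/-- The function `t ^ (2 n²) φₙ` near the origin. -/
noncomputable def phiHat (n : ℕ) (P : Pts W) : Qbar := homogFun (W.Φ n) (n ^ 2) P

/-- The function `t ^ (3 n²) ωₙ` near the origin, with `ψ₂ₙ / ψₙ` as the ratio of the functions
`psiHat`. -/
noncomputable def omegaHat (n : ℕ) (P : Pts W) : Qbar :=
  (psiHat (2 * n) P / psiHat n P -
    algebraMap ℚ Qbar W.a₁ * Chart.U.fst P * phiHat n P * psiHat n P -
    algebraMap ℚ Qbar W.a₃ * Chart.U.fst P ^ 3 * psiHat n P ^ 3) / 2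

lemma regE_psiHat (n : ℕ) : RegE (0 : Pts W) (psiHat n) := by
  unfold psiHat
  split_ifs
  · exact (regE_homogFun _ _).mul regE_twoYHat
  · exact (regE_homogFun _ _).mul RegAt.one

lemma regE_phiHat (n : ℕ) : RegE (0 : Pts W) (phiHat n) := regE_homogFun _ _

lemma psiHat_zero (n : ℕ) : psiHat n (0 : Pts W) = (-1) ^ (n + 1) * n := by
  have h := congrArg (algebraMap ℚ Qbar) (W.coeff_preΨ n)
  simp only [Int.natAbs_natCast, Int.even_coe_nat] at h
  rw [psiHat, homogFun_zero, preDeg, h]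
  split_ifs with hn
  · rw [hn.add_one.neg_one_pow]
    obtain ⟨m, rfl⟩ := hn
    have e : ((m + m : ℕ) : ℤ) / 2 = m := by omega
    rw [e]
    simp [twoYHat]
    ring
  · rw [(Nat.not_even_iff_odd.mp hn).add_one.neg_one_pow]
    simp

lemma psiHat_zero_ne_zero {n : ℕ} (hn : 0 < n) : psiHat n (0 : Pts W) ≠ 0 := by
  rw [psiHat_zero]
  exact mul_ne_zero (pow_ne_zero _ (by simp)) (by exact_mod_cast hn.ne')

lemma phiHat_zero (n : ℕ) : phiHat n (0 : Pts W) = 1 := by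
  have h := congrArg (algebraMap ℚ Qbar) (W.coeff_Φ n)
  rw [Int.natAbs_natCast] at h
  rw [phiHat, homogFun_zero, h, map_one]

lemma omegaHat_zero {n : ℕ} (hn : 0 < n) : omegaHat n (0 : Pts W) = (-1) ^ n := by
  have hn0 : (n : Qbar) ≠ 0 := by exact_mod_cast hn.ne'
  have h1 : ((-1 : Qbar) ^ n) ^ 2 = 1 := by rw [← pow_mul, mul_comm, pow_mul]; simp
  have h2 : ((-1 : Qbar) ^ n) ≠ 0 := pow_ne_zero _ (by simp)
  rw [omegaHat, psiHat_zero, psiHat_zero]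
  simp only [U_fst_zero]
  push_cast
  rw [pow_succ, pow_succ, pow_mul]
  field_simp
  simp [h1]

lemma regE_omegaHat {n : ℕ} (hn : 0 < n) : RegE (0 : Pts W) (omegaHat n) := by
  have h2 : RegE (0 : Pts W) fun _ => (2 : Qbar) := by simpa using regE_const (W := W) (P₀ := 0) 2
  exact ((((regE_psiHat _).div (regE_psiHat n) (mem_chartAt _) (psiHat_zero_ne_zero hn)).sub
    ((((regE_const _).mul regE_t).mul (regE_phiHat n)).mul (regE_psiHat n))).sub
    (((regE_const _).mul (regE_t.pow 3)).mul ((regE_psiHat n).pow 3))).div h2 (mem_chartAt _)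
    two_ne_zero

section

variable {x y : Qbar} {h : (W.baseChange Qbar).toAffine.Nonsingular x y}

lemma two_mul_preDeg {n : ℕ} (hn : 0 < n) :
    2 * preDeg n + (if Even n then 3 else 0) = n ^ 2 - 1 := by
  unfold preDeg
  rcases Nat.even_or_odd' n with ⟨m, rfl | rfl⟩
  · rw [if_pos (by simp), if_pos (by simp)]
    obtain ⟨j, rfl⟩ : ∃ j, m = j + 1 := ⟨m - 1, by omega⟩
    have : (2 * (j + 1)) ^ 2 = 2 * (2 * (j ^ 2 + 2 * j)) + 4 := by ring
    omega
  · rw [if_neg (by simp), if_neg (by simp)]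
    have : (2 * m + 1) ^ 2 = 2 * (2 * (m ^ 2 + m)) + 1 := by ring
    omega

lemma psiHat_some {n : ℕ} (hn : 0 < n) (hU : Chart.U.Mem (.some x y h : Pts W)) :
    psiHat n (.some x y h : Pts W) = (W.baseChange Qbar).psiAt x y n *
      Chart.U.fst (.some x y h : Pts W) ^ (n ^ 2 - 1) := by
  have hd : (W.preΨ n).natDegree ≤ preDeg n := by
    simpa only [preDeg, Int.natAbs_natCast, Int.even_coe_nat] using W.natDegree_preΨ_le n
  rw [psiHat, homogFun_some hd hU, twoYHat_some hU, psiAt_baseChange h, ← two_mul_preDeg hn,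
    pow_add]
  simp only [Int.even_coe_nat]
  split_ifs <;> ring

lemma phiHat_some (n : ℕ) (hU : Chart.U.Mem (.some x y h : Pts W)) :
    phiHat n (.some x y h : Pts W) = (W.baseChange Qbar).phiAt x y n *
      Chart.U.fst (.some x y h : Pts W) ^ (2 * n ^ 2) := by
  have hd : (W.Φ n).natDegree ≤ n ^ 2 := W.natDegree_Φ_le n
  rw [phiHat, homogFun_some hd hU, phiAt_baseChange h]

lemma omegaHat_some {n : ℕ} (hn : 0 < n) (hU : Chart.U.Mem (.some x y h : Pts W))
    (hψ : psiHat n (.some x y h : Pts W) ≠ 0) :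
    omegaHat n (.some x y h : Pts W) = (W.baseChange Qbar).omegaAt x y n *
      Chart.U.fst (.some x y h : Pts W) ^ (3 * n ^ 2) := by
  have h2 : psiHat (2 * n) (.some x y h : Pts W) / psiHat n (.some x y h : Pts W) =
      (W.baseChange Qbar).psicAt x y n * Chart.U.fst (.some x y h : Pts W) ^ (3 * n ^ 2) := by
    rw [div_eq_iff hψ, psiHat_some hn hU, psiHat_some (by omega) hU]
    push_cast
    rw [psiAt_two_mul h.1]
    have : (2 * n) ^ 2 - 1 = 3 * n ^ 2 + (n ^ 2 - 1) := by
      have : 0 < n ^ 2 := by positivity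
      have : (2 * n) ^ 2 = 4 * n ^ 2 := by ring
      omega
    rw [this, pow_add]
    ring
  rw [omegaHat, h2, psiHat_some hn hU, phiHat_some n hU, omegaAt]
  obtain ⟨k, hk⟩ : ∃ k, n ^ 2 = k + 1 := Nat.exists_eq_add_one.mpr (by positivity)
  rw [hk, Nat.add_sub_cancel, baseChange_a₁, baseChange_a₃]
  ring

end

/-! ### Multiplication by `n` is a morphism -/

/-- The function `t(nP) / (t(P) ^ n² ψₙ(P))` near the origin. -/
noncomputable def tRatio (n : ℕ) (P : Pts W) : Qbar := -phiHat n P / omegaHat n P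

lemma regE_tRatio {n : ℕ} (hn : 0 < n) : RegE (0 : Pts W) (tRatio n) :=
  (regE_phiHat n).neg.div (regE_omegaHat hn) (mem_chartAt _)
    (by rw [omegaHat_zero hn]; exact pow_ne_zero _ (by simp))

lemma tRatio_zero_sq {n : ℕ} (hn : 0 < n) : tRatio n (0 : Pts W) ^ 2 = 1 := by
  rw [tRatio, phiHat_zero, omegaHat_zero hn, div_pow, ← pow_mul, mul_comm n, pow_mul]
  simp

variable [W.IsElliptic]

/-- The coordinates `t, u` of `nP` for `P` near the origin. -/
lemma eventually_nsmul_zero {n : ℕ} (hn : 0 < n) : ∀ᶠ P in nhdsE (0 : Pts W),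
    Chart.U.Mem (n • P) ∧ tRatio n P ≠ 0 ∧
    Chart.U.fst (n • P) = Chart.U.fst P * psiHat n P * tRatio n P ∧
    Chart.U.snd (n • P) = -Chart.U.fst P ^ 3 * psiHat n P ^ 3 / omegaHat n P ∧
    (P ≠ 0 → n • P ≠ 0) := by
  have hω0 : omegaHat n (0 : Pts W) ≠ 0 := by
    rw [omegaHat_zero hn]; exact pow_ne_zero _ (by simp)
  filter_upwards [eventually_mem_U,
    (regE_psiHat n).eventually_ne (mem_chartAt (0 : Pts W)) (psiHat_zero_ne_zero hn),
    (regE_phiHat n).eventually_ne (mem_chartAt (0 : Pts W)) (by rw [phiHat_zero]; simp),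
    (regE_omegaHat hn).eventually_ne (mem_chartAt (0 : Pts W)) hω0] with P hU hψ hφ hω
  have hr : tRatio n P ≠ 0 := div_ne_zero (neg_ne_zero.mpr hφ) hω
  rcases P with _ | ⟨x, y, h⟩
  · change Chart.U.Mem (n • (0 : Pts W)) ∧ _ ∧ Chart.U.fst (n • (0 : Pts W)) = 0 * _ * _ ∧
      Chart.U.snd (n • (0 : Pts W)) = -0 ^ 3 * _ / _ ∧ _
    rw [nsmul_zero]
    exact ⟨trivial, hr, by simp, by simp, fun h => (h rfl).elim⟩
  · have ht := U_fst_ne_zero hU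
    have eψ := psiHat_some hn hU
    have eφ := phiHat_some n hU
    have eω := omegaHat_some hn hU hψ
    have hψ' : (W.baseChange Qbar).psiAt x y n ≠ 0 := fun h0 => hψ (by rw [eψ, h0, zero_mul])
    have hφ' : (W.baseChange Qbar).phiAt x y n ≠ 0 := fun h0 => hφ (by rw [eφ, h0, zero_mul])
    have hω' : (W.baseChange Qbar).omegaAt x y n ≠ 0 := fun h0 => hω (by rw [eω, h0, zero_mul])
    have hne : n • (Affine.Point.some x y h : Pts W) ≠ 0 := fun h0 =>
      hψ' ((nsmul_eq_zero_iff_psiAt h n).mp h0)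
    refine ⟨?_, hr, ?_, ?_, fun _ => hne⟩
    all_goals
      rcases hE : n • (Affine.Point.some x y h : Pts W) with _ | ⟨X, Y, hX⟩
      · exact absurd hE hne
    all_goals
      have hx := nsmul_X h hE
      have hy := nsmul_Y h hn hE
      obtain rfl := eq_div_of_mul_eq (pow_ne_zero 2 hψ') hx
      obtain rfl := eq_div_of_mul_eq (pow_ne_zero 3 hψ') hy
    · exact ⟨div_ne_zero hφ' (pow_ne_zero 2 hψ'), div_ne_zero hω' (pow_ne_zero 3 hψ')⟩
    all_goals
      try rw [tRatio, eφ]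
      rw [eψ, eω]
      generalize Chart.U.fst (.some x y h : Pts W) = t at *
      obtain ⟨k, hk⟩ : ∃ k, n ^ 2 = k + 1 := Nat.exists_eq_add_one.mpr (by positivity)
      rw [hk, Nat.add_sub_cancel]
    · simp only [Chart.fst]
      field_simp
      ring
    · simp only [Chart.snd]
      field_simp
      ring

/-- The coordinates of `nP` are `(φₙ / ψₙ², ωₙ / ψₙ³)` on `Y`, and `(-φₙ ψₙ / ωₙ, -ψₙ³ / ωₙ)` on
`U`. -/
lemma regMapAt_nsmul {n : ℕ} (hn : 0 < n) (P₀ : Pts W) : RegMapAt (fun P => n • P) P₀ := by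
  by_cases h0 : P₀ = 0
  · subst h0
    have e : chartAt (n • (0 : Pts W)) = .U := by rw [nsmul_zero]; rfl
    refine ⟨?_, ?_, ?_⟩ <;> simp only [e]
    · filter_upwards [eventually_nsmul_zero hn] with P h using h.1
    · refine ((regE_t.mul (regE_psiHat n)).mul (regE_tRatio hn)).congr ?_
      filter_upwards [eventually_nsmul_zero hn] with P h using h.2.2.1
    · refine ((((regE_t.pow 3).neg).mul ((regE_psiHat n).pow 3)).div (regE_omegaHat hn)
        (mem_chartAt _) (by rw [omegaHat_zero hn]; exact pow_ne_zero _ (by simp))).congr ?_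
      filter_upwards [eventually_nsmul_zero hn] with P h using h.2.2.2.1
  · obtain ⟨x₀, y₀, hxy, rfl⟩ : ∃ x y hxy, P₀ = .some x y hxy := by
      cases P₀
      · exact absurd rfl h0
      · exact ⟨_, _, _, rfl⟩
    by_cases hn0 : n • (Affine.Point.some x₀ y₀ hxy : Pts W) = 0
    · have e : chartAt (n • (Affine.Point.some x₀ y₀ hxy : Pts W)) = .U := by rw [hn0]; rfl
      have hψ := (nsmul_eq_zero_iff_psiAt hxy n).mp hn0
      have hφ := phiAt_ne_zero_of_psiAt_eq_zero hxy n hψ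
      have hω : (W.baseChange Qbar).omegaAt x₀ y₀ n ≠ 0 := by
        intro h
        have := omegaAt_sq_of_psiAt_eq_zero hxy hn hψ
        rw [h, zero_pow two_ne_zero, eq_comm, pow_eq_zero_iff three_ne_zero] at this
        exact hφ this
      have key : ∀ᶠ P in nhdsE (Affine.Point.some x₀ y₀ hxy : Pts W), Chart.U.Mem (n • P) ∧
          Chart.U.fst (n • P) = -(affineFun (fun x y => (W.baseChange Qbar).phiAt x y n) P *
            affineFun (fun x y => (W.baseChange Qbar).psiAt x y n) P) /
            affineFun (fun x y => (W.baseChange Qbar).omegaAt x y n) P ∧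
          Chart.U.snd (n • P) = -(affineFun (fun x y => (W.baseChange Qbar).psiAt x y n) P ^ 3) /
            affineFun (fun x y => (W.baseChange Qbar).omegaAt x y n) P := by
        filter_upwards [eventually_ne_zero h0,
          (regE_phiAt h0 n).eventually_ne (mem_chartAt _) hφ,
          (regE_omegaAt h0 n).eventually_ne (mem_chartAt _) hω] with P hP hφ hω
        rcases P with _ | ⟨x, y, h⟩
        · exact absurd rfl hP
        · simp only [affineFun_some] at *
          rcases hE : n • (Affine.Point.some x y h : Pts W) with _ | ⟨X, Y, hX⟩
          · rw [(nsmul_eq_zero_iff_psiAt h n).mp hE]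
            exact ⟨trivial, by simp [Chart.fst], by simp [Chart.snd]⟩
          · have hψ' := nsmul_psiAt_ne_zero h hE
            have hx := nsmul_X h hE
            have hy := nsmul_Y h hn hE
            obtain rfl := eq_div_of_mul_eq (pow_ne_zero 2 hψ') hx
            obtain rfl := eq_div_of_mul_eq (pow_ne_zero 3 hψ') hy
            refine ⟨⟨div_ne_zero hφ (pow_ne_zero 2 hψ'), div_ne_zero hω (pow_ne_zero 3 hψ')⟩,
              ?_, ?_⟩
            all_goals
              simp only [Chart.fst, Chart.snd]
              field_simp
      refine ⟨?_, ?_, ?_⟩ <;> simp only [e]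
      · filter_upwards [key] with P h using h.1
      · refine ((((regE_phiAt h0 n).mul (regE_psiAt h0 n)).neg).div (regE_omegaAt h0 n)
          (mem_chartAt _) hω).congr ?_
        filter_upwards [key] with P h using h.2.1
      · refine (((regE_psiAt h0 n).pow 3).neg.div (regE_omegaAt h0 n)
          (mem_chartAt _) hω).congr ?_
        filter_upwards [key] with P h using h.2.2
    · have hψ : (W.baseChange Qbar).psiAt x₀ y₀ n ≠ 0 := fun h =>
        hn0 ((nsmul_eq_zero_iff_psiAt hxy n).mpr h)
      have key : ∀ᶠ P in nhdsE (Affine.Point.some x₀ y₀ hxy : Pts W), n • P ≠ 0 ∧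
          Chart.Y.fst (n • P) = affineFun (fun x y => (W.baseChange Qbar).phiAt x y n) P /
            affineFun (fun x y => (W.baseChange Qbar).psiAt x y n) P ^ 2 ∧
          Chart.Y.snd (n • P) = affineFun (fun x y => (W.baseChange Qbar).omegaAt x y n) P /
            affineFun (fun x y => (W.baseChange Qbar).psiAt x y n) P ^ 3 := by
        filter_upwards [eventually_ne_zero h0,
          (regE_psiAt h0 n).eventually_ne (mem_chartAt _) hψ] with P hP hψ
        rcases P with _ | ⟨x, y, h⟩
        · exact absurd rfl hP
        · simp only [affineFun_some] at *
          have hne : n • (Affine.Point.some x y h : Pts W) ≠ 0 := fun h0 =>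
            hψ ((nsmul_eq_zero_iff_psiAt h n).mp h0)
          refine ⟨hne, ?_⟩
          rcases hE : n • (Affine.Point.some x y h : Pts W) with _ | ⟨X, Y, hX⟩
          · exact absurd hE hne
          · exact ⟨eq_div_of_mul_eq (pow_ne_zero 2 hψ) (nsmul_X h hE),
              eq_div_of_mul_eq (pow_ne_zero 3 hψ) (nsmul_Y h hn hE)⟩
      refine ⟨?_, ?_, ?_⟩ <;> simp only [chartAt_of_ne_zero hn0]
      · filter_upwards [key] with P h using Chart.mem_Y_iff.mpr h.1
      · refine ((regE_phiAt h0 n).div ((regE_psiAt h0 n).pow 2) (mem_chartAt _)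
          (pow_ne_zero 2 hψ)).congr ?_
        filter_upwards [key] with P h using h.2.1
      · refine ((regE_omegaAt h0 n).div ((regE_psiAt h0 n).pow 3) (mem_chartAt _)
          (pow_ne_zero 3 hψ)).congr ?_
        filter_upwards [key] with P h using h.2.2

end PuncturedElliptic

namespace PuncturedElliptic

open WeierstrassCurve

variable {W : WeierstrassCurve ℚ}

/-! ### Unit-valued frames -/

/-- A function with values in `ℚ̄ˣ` that is a frame of the torsor near a point: its ratio with every
frame of the presentation that is defined at the point is regular there. -/
structure IsUnitFrame (T : Torsor W) (P₀ : Pts W) (u : Pts W → Qbarˣ) : Prop where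
  exists_mem : ∃ i, P₀ ∈ T.dom i
  eventually_mem : ∀ i, P₀ ∈ T.dom i → ∀ᶠ P in nhdsE P₀, P ∈ T.dom i
  frame_ne_zero : ∀ i, P₀ ∈ T.dom i → T.frame i P₀ ≠ 0
  regE : ∀ i, P₀ ∈ T.dom i → RegE P₀ fun P => u P / T.frame i P

namespace IsUnitFrame

variable {T T' : Torsor W} {P₀ : Pts W} {u u' : Pts W → Qbarˣ}

lemma div_ne_zero (h : IsUnitFrame T P₀ u) {i : T.Idx} (hi : P₀ ∈ T.dom i) :
    (u P₀ : Qbar) / T.frame i P₀ ≠ 0 :=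
  _root_.div_ne_zero (u P₀).ne_zero (h.frame_ne_zero i hi)

lemma eventually_frame_ne_zero (h : IsUnitFrame T P₀ u) {i : T.Idx} (hi : P₀ ∈ T.dom i) :
    ∀ᶠ P in nhdsE P₀, T.frame i P ≠ 0 := by
  filter_upwards [(h.regE i hi).eventually_ne (mem_chartAt _) (h.div_ne_zero hi)] with P hP h0
  rw [h0, div_zero] at hP
  exact hP rfl

lemma tensor (h : IsUnitFrame T P₀ u) (h' : IsUnitFrame T' P₀ u') :
    IsUnitFrame (T.tensor T') P₀ (u * u') where
  exists_mem := by
    obtain ⟨i, hi⟩ := h.exists_mem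
    obtain ⟨j, hj⟩ := h'.exists_mem
    exact ⟨(i, j), hi, hj⟩
  eventually_mem i hi := by
    filter_upwards [h.eventually_mem i.1 hi.1, h'.eventually_mem i.2 hi.2] with P h1 h2
      using ⟨h1, h2⟩
  frame_ne_zero i hi := mul_ne_zero (h.frame_ne_zero i.1 hi.1) (h'.frame_ne_zero i.2 hi.2)
  regE i hi := by
    refine ((h.regE i.1 hi.1).mul (h'.regE i.2 hi.2)).congr (.of_forall fun P => ?_)
    simp only [Torsor.tensor, Pi.mul_apply, Units.val_mul]
    rw [mul_div_mul_comm]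

lemma pow (h : IsUnitFrame T P₀ u) (a : ℤ) : IsUnitFrame (T.pow a) P₀ (u ^ a) where
  exists_mem := h.exists_mem
  eventually_mem := h.eventually_mem
  frame_ne_zero i hi := zpow_ne_zero a (h.frame_ne_zero i hi)
  regE i hi := by
    refine ((h.regE i hi).zpow (mem_chartAt _) (h.div_ne_zero hi) a).congr
      (.of_forall fun P => ?_)
    simp only [Torsor.pow, Pi.pow_apply, Units.val_zpow_eq_zpow_val]
    rw [div_zpow]

lemma pullback_neg (h : IsUnitFrame T (-P₀) u) :
    IsUnitFrame (T.pullback fun x => -x) P₀ (fun P => u (-P)) where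
  exists_mem := h.exists_mem
  eventually_mem i hi := (regMapAt_neg P₀).tendsto.eventually (h.eventually_mem i hi)
  frame_ne_zero i hi := h.frame_ne_zero i hi
  regE i hi := RegE.comp (φ := fun P => -P) (h.regE i hi) (regMapAt_neg P₀)

end IsUnitFrame

/-! ### Morphisms of torsors in terms of sections -/

namespace Torsor

variable {T T' T'' : Torsor W} {a d a' d' : ℕ}

/-- The map over `[a]` and under `[d]` with prescribed values on the points with coordinate `1`. -/
noncomputable def mapOfSection (T T' : Torsor W) (a d : ℕ) (b : Pts W → Qbarˣ) (p : T.Pt) : T'.Pt :=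
  ⟨a • p.base, p.coord ^ d * b p.base⟩

lemma smul_def (c : Qbarˣ) (p : T.Pt) : c • p = ⟨p.base, c * p.coord⟩ := rfl

lemma IsMorphism.eq_mapOfSection {φ : T.Pt → T'.Pt} (h : IsMorphism a d φ) :
    φ = mapOfSection T T' a d fun P => (φ ⟨P, 1⟩).coord := by
  funext p
  have hp : p = p.coord • (⟨p.base, 1⟩ : T.Pt) := by
    rw [smul_def, mul_one]
  ext1
  · exact h.map_base p
  · conv_lhs => rw [hp, h.map_smul]
    rfl

/-- A regular function on the curve is regular on the total space of a torsor. -/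
lemma _root_.PuncturedElliptic.RegE.comp_base {i : T.ChartIdx} {p : T.Pt} (hp : p ∈ T.chartDom i)
    (hi : i.1 = chartAt p.base) {f : Pts W → Qbar} (hf : RegE p.base f) :
    RegAt (T.chartCoord i) (T.chartDom i) p fun q => f q.base := by
  refine RegAt.comp (φ := Pt.base) hf hp (fun l => ?_) ?_
  · rw [← hi]
    fin_cases l
    · exact RegAt.coord (κ := T.chartCoord i) 0
    · exact RegAt.coord (κ := T.chartCoord i) 1
  · filter_upwards [eventually_mem_domain] with q hq
    rw [← hi]
    exact hq.1

variable [W.IsElliptic]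

/-- A map over `[a]` and under `[d]` is a morphism as soon as its expression in unit-valued frames
is locally a regular function. -/
lemma isMorphism_mapOfSection (ha : 0 < a) {b : Pts W → Qbarˣ}
    (h : ∀ P₀, ∃ u u' : Pts W → Qbarˣ, IsUnitFrame T P₀ u ∧ IsUnitFrame T' (a • P₀) u' ∧
      RegE P₀ fun P => (u P : Qbar) ^ d * b P / u' (a • P)) :
    IsMorphism a d (mapOfSection T T' a d b) := by
  refine ⟨isRegular_of_regAt fun p => ?_, fun p => rfl, fun c p => ?_⟩
  · obtain ⟨u, u', hu, hu', hb⟩ := h p.base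
    obtain ⟨ι, hι⟩ := hu.exists_mem
    obtain ⟨ι', hι'⟩ := hu'.exists_mem
    have hp : p ∈ T.chartDom (chartAt p.base, ι) := ⟨mem_chartAt p.base, hι⟩
    have hm := regMapAt_nsmul ha p.base
    refine ⟨(chartAt p.base, ι), (chartAt (a • p.base), ι'), hp, ?_, ?_⟩
    · have hbase : Filter.Tendsto (Pt.base (T := T)) (zariskiNhds (T.chartCoord (chartAt p.base, ι))
          (T.chartDom (chartAt p.base, ι)) p) (nhdsE p.base) := by
        refine tendsto_zariskiNhds hp (fun l => ?_) ?_
        · fin_cases l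
          · exact RegAt.coord (κ := T.chartCoord (chartAt p.base, ι)) 0
          · exact RegAt.coord (κ := T.chartCoord (chartAt p.base, ι)) 1
        · filter_upwards [eventually_mem_domain] with q hq using hq.1
      exact hbase.eventually (hm.1.and (hm.tendsto.eventually (hu'.eventually_mem ι' hι')))
    · intro l
      fin_cases l
      · exact RegE.comp_base hp rfl hm.2.1
      · exact RegE.comp_base hp rfl hm.2.2
      · have h1 := RegE.comp_base hp rfl hb
        have h2 := RegE.comp_base hp rfl (hu.regE ι hι)
        have h3 := RegE.comp_base hp rfl (RegE.comp (hu'.regE ι' hι') hm)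
        have h4 : RegAt (T.chartCoord (chartAt p.base, ι)) (T.chartDom (chartAt p.base, ι)) p
          fun q => q.coord / T.frame ι q.base := RegAt.coord 2
        refine (((h4.pow d).mul h1).mul (((h2.pow d).inv hp
          (pow_ne_zero d (hu.div_ne_zero hι))).mul h3)).congr ?_
        have h5 := (h2.eventually_ne hp (hu.div_ne_zero hι))
        filter_upwards [h5] with q hq
        have hf : T.frame ι q.base ≠ 0 := fun h0 => hq (by rw [h0, div_zero])
        have e1 := (u q.base).ne_zero
        have e2 := (u' (a • q.base)).ne_zero
        change (↑(q.coord ^ d * b q.base) : Qbar) / T'.frame ι' (a • q.base) = _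
        simp only [Units.val_mul, Units.val_pow_eq_pow_val, div_pow]
        field_simp
  · ext1
    · rfl
    · simp only [mapOfSection, smul_def, mul_pow, mul_assoc]

/-- A morphism over `[a]` and under `[d]` is given by regular functions in any unit-valued
frames. -/
lemma IsMorphism.regE {φ : T.Pt → T'.Pt} (h : IsMorphism a d φ) (ha : 0 < a) {P₀ : Pts W}
    {u u' : Pts W → Qbarˣ} (hu : IsUnitFrame T P₀ u) (hu' : IsUnitFrame T' (a • P₀) u') :
    RegE P₀ fun P => (u P : Qbar) ^ d * (φ ⟨P, 1⟩).coord / u' (a • P) := by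
  obtain ⟨i, j, hp, hD, hl⟩ := h.regular.exists_regAt ⟨P₀, u P₀⟩
  obtain ⟨hD1, h1, h2⟩ := i.1.regE_coord hp.1
  have hs : ∀ l, RegE P₀ fun P => T.chartCoord i ⟨P, u P⟩ l := by
    intro l
    fin_cases l
    · exact h1
    · exact h2
    · exact hu.regE i.2 hp.2
  have hsD : ∀ᶠ P in nhdsE P₀, (⟨P, u P⟩ : T.Pt) ∈ T.chartDom i := by
    filter_upwards [hD1, hu.eventually_mem i.2 hp.2] with P h1 h2 using ⟨h1, h2⟩
  have h3 : RegE P₀ fun P => T'.chartCoord j (φ ⟨P, u P⟩) 2 :=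
    RegAt.comp (φ := fun P => (⟨P, u P⟩ : T.Pt)) (hl 2) (mem_chartAt P₀) hs hsD
  have hj : a • P₀ ∈ T'.dom j.2 := by
    have := (eventually_self hp hD).2
    rwa [h.map_base] at this
  have hm := regMapAt_nsmul ha P₀
  have h4 : RegE P₀ fun P => (u' (a • P) : Qbar) / T'.frame j.2 (a • P) :=
    RegE.comp (hu'.regE j.2 hj) hm
  refine (h3.div h4 (mem_chartAt _) (hu'.div_ne_zero hj)).congr ?_
  filter_upwards [hm.tendsto.eventually (hu'.eventually_frame_ne_zero hj)] with P hP
  have e2 := (u' (a • P)).ne_zero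
  rw [h.eq_mapOfSection]
  change _ = (↑(u P ^ d * (φ ⟨P, 1⟩).coord) : Qbar) / T'.frame j.2 (a • P) / _
  simp only [mapOfSection, one_pow, one_mul, Units.val_mul, Units.val_pow_eq_pow_val]
  field_simp

lemma IsMorphism.comp {φ : T.Pt → T'.Pt} {φ' : T'.Pt → T''.Pt} (h : IsMorphism a d φ)
    (h' : IsMorphism a' d' φ') (ha : 0 < a) (ha' : 0 < a') (hT : ∀ P₀, ∃ u, IsUnitFrame T P₀ u)
    (hT' : ∀ P₀, ∃ u, IsUnitFrame T' P₀ u) (hT'' : ∀ P₀, ∃ u, IsUnitFrame T'' P₀ u) :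
    IsMorphism (a * a') (d * d') fun p => φ' (φ p) := by
  have e : (fun p => φ' (φ p)) = mapOfSection T T'' (a * a') (d * d')
      fun P => (φ ⟨P, 1⟩).coord ^ d' * (φ' ⟨a • P, 1⟩).coord := by
    funext p
    rw [h.eq_mapOfSection, h'.eq_mapOfSection]
    ext1
    · simp only [mapOfSection]
      rw [mul_comm, mul_smul]
    · simp only [mapOfSection, one_pow, one_mul, mul_pow, pow_mul, mul_assoc]
  rw [e]
  refine isMorphism_mapOfSection (Nat.mul_pos ha ha') fun P₀ => ?_
  obtain ⟨u, hu⟩ := hT P₀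
  obtain ⟨u', hu'⟩ := hT' (a • P₀)
  obtain ⟨u'', hu''⟩ := hT'' (a' • a • P₀)
  have e2 : ∀ P : Pts W, (a * a') • P = a' • a • P := fun P => by rw [mul_comm, mul_smul]
  refine ⟨u, u'', hu, by rwa [e2], ?_⟩
  have h1 := h.regE ha hu hu'
  have h2 := RegE.comp (φ := fun P => a • P) (h'.regE ha' hu' hu'') (regMapAt_nsmul ha P₀)
  refine ((h1.pow d').mul h2).congr (.of_forall fun P => ?_)
  have e3 := (u' (a • P)).ne_zero
  have e4 := (u'' (a' • a • P)).ne_zero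
  simp only [e2, Units.val_mul, Units.val_pow_eq_pow_val, div_pow, mul_pow, pow_mul]
  field_simp

end Torsor

end PuncturedElliptic

namespace PuncturedElliptic

open WeierstrassCurve

variable {W : WeierstrassCurve ℚ}

/-! ### Frames of `P` and `P_n` -/

/-- A nonzero number as a unit, with the value `1` at zero. -/
noncomputable def unitOf (a : Qbar) : Qbarˣ := if h : a ≠ 0 then Units.mk0 a h else 1

lemma coe_unitOf {a : Qbar} (h : a ≠ 0) : (unitOf a : Qbar) = a := by
  rw [unitOf, dif_pos h, Units.val_mk0]

/-- A unit-valued frame of `P` near a given point: the section `1` near the points of `Y`, and `t⁻¹`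
near the origin. -/
noncomputable def frameP (P₀ Q : Pts W) : Qbarˣ :=
  if P₀ = 0 then unitOf ((P W).frame .U Q) else 1

lemma frameP_of_ne_zero {P₀ : Pts W} (h : P₀ ≠ 0) (P : Pts W) : frameP P₀ P = 1 := if_neg h

lemma frameP_zero_zero : frameP (0 : Pts W) 0 = 1 := by
  rw [frameP, if_pos rfl]
  ext
  rw [coe_unitOf] <;> simp [P]

lemma frame_U_ne_zero {P₀ : Pts W} (h : Chart.U.Mem P₀) : (P W).frame .U P₀ ≠ 0 := by
  rcases P₀ with _ | ⟨x, y, hxy⟩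
  · exact one_ne_zero
  · exact div_ne_zero (neg_ne_zero.mpr h.2) h.1

lemma frameP_zero {P₀ : Pts W} (h : Chart.U.Mem P₀) :
    (frameP 0 P₀ : Qbar) = (P W).frame .U P₀ := by
  rw [frameP, if_pos rfl, coe_unitOf (frame_U_ne_zero h)]

lemma frame_U_of_ne_zero {P₀ : Pts W} (h0 : P₀ ≠ 0) :
    (P W).frame .U P₀ = (Chart.U.fst P₀)⁻¹ := by
  rcases P₀ with _ | ⟨x, y, hxy⟩
  · exact absurd rfl h0
  · change -y / x = (-x / y)⁻¹
    rw [inv_div, div_neg, neg_div]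

lemma isUnitFrame_frameP (P₀ : Pts W) : IsUnitFrame (P W) P₀ (frameP P₀) where
  exists_mem := ⟨chartAt P₀, mem_chartAt P₀⟩
  eventually_mem i hi := (i.regE_coord hi).1
  frame_ne_zero i hi := by
    rcases i with _ | _
    · exact one_ne_zero
    · exact frame_U_ne_zero hi
  regE i hi := by
    by_cases h0 : P₀ = 0
    · subst h0
      rcases i with _ | _
      · exact hi.elim
      · refine RegAt.one.congr ?_
        filter_upwards [eventually_mem_U] with P hP
        rw [frameP_zero hP, div_self (frame_U_ne_zero hP)]
    · rcases i with _ | _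
      · refine RegAt.one.congr (.of_forall fun P => ?_)
        rw [frameP_of_ne_zero h0]
        simp [PuncturedElliptic.P]
      · refine (Chart.U.regE_coord hi).2.1.congr ?_
        filter_upwards [eventually_ne_zero h0] with P hP
        rw [frameP_of_ne_zero h0, frame_U_of_ne_zero hP]
        simp

/-- A unit-valued frame of `P_n` near a given point. -/
noncomputable def framePn (n : ℕ+) (P₀ : Pts W) : Pts W → Qbarˣ :=
  frameP P₀ ^ (1 + (n : ℤ)) * (fun P => frameP (-P₀) (-P)) ^ (1 - (n : ℤ))

lemma framePn_apply (n : ℕ+) (P₀ P : Pts W) : framePn n P₀ P =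
    frameP P₀ P ^ (1 + (n : ℤ)) * frameP (-P₀) (-P) ^ (1 - (n : ℤ)) := rfl

lemma isUnitFrame_framePn (n : ℕ+) (P₀ : Pts W) : IsUnitFrame (Pn W n) P₀ (framePn n P₀) :=
  ((isUnitFrame_frameP P₀).pow _).tensor ((isUnitFrame_frameP (-P₀)).pullback_neg.pow _)

lemma framePn_of_ne_zero (n : ℕ+) {P₀ : Pts W} (h : P₀ ≠ 0) (P : Pts W) : framePn n P₀ P = 1 := by
  rw [framePn_apply, frameP_of_ne_zero h, frameP_of_ne_zero (neg_ne_zero.mpr h), one_zpow, one_zpow,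
    one_mul]

lemma framePn_zero_zero (n : ℕ+) : framePn n (0 : Pts W) 0 = 1 := by
  rw [framePn_apply, neg_zero, frameP_zero_zero, one_zpow, one_zpow, one_mul]

/-- The frame of `P_n` at the origin in terms of the coordinate `t`: as `t(-P)` is `-t(P)` up to the
factor `negFactor`, it is a multiple of `t⁻²`. -/
lemma eventually_framePn_zero (n : ℕ+) : ∀ᶠ P in nhdsE (0 : Pts W), P ≠ 0 →
    (framePn n 0 P : Qbar) = (Chart.U.fst P ^ 2)⁻¹ * (-negFactor P) ^ ((n : ℤ) - 1) ∧
      Chart.U.fst P ≠ 0 := by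
  filter_upwards [eventually_mem_U, eventually_neg_mem_U] with P hU hn h0
  obtain ⟨hU', ht, -, hg⟩ := hn
  have ht0 : Chart.U.fst P ≠ 0 := by
    rcases P with _ | ⟨x, y, h⟩
    · exact absurd rfl h0
    · exact U_fst_ne_zero hU
  refine ⟨?_, ht0⟩
  rw [framePn_apply, neg_zero]
  simp only [Units.val_mul, Units.val_zpow_eq_zpow_val]
  rw [frameP_zero hU, frameP_zero hU', frame_U_of_ne_zero h0,
    frame_U_of_ne_zero (neg_ne_zero.mpr h0), ht]
  have e1 : -Chart.U.fst P * negFactor P = Chart.U.fst P * -negFactor P := by ring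
  have e2 : (n : ℤ) - 1 = -(1 - (n : ℤ)) := by ring
  rw [e1, mul_inv, mul_zpow, e2, zpow_neg, inv_zpow (-negFactor P), ← mul_assoc,
    ← zpow_add₀ (inv_ne_zero ht0)]
  congr 1
  rw [show 1 + (n : ℤ) + (1 - (n : ℤ)) = 2 by ring]
  norm_cast
  rw [inv_pow]

/-! ### The isogenies of torsors -/

/-- The rational section that defines a morphism to `P_N` over `[n]`. It is `ψₙ⁻²` where `nP ≠ 0`;
the other values are its limits in the frames of `P_N` at the origin. The sign in the limit at the
affine points killed by `n` is due to the factor `[-1]^* P ^ (1 - N)` of `P_N`, as `t(-P)` is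
`-t(P)` to leading order. The value `s` at the origin also depends on the source. -/
noncomputable def isogValue (n : ℕ) (N : ℕ+) (s : Qbar) : Pts W → Qbar
  | .zero => s
  | .some x y _ => if (W.baseChange Qbar).psiAt x y n = 0 then
      (-1) ^ (1 - (N : ℤ)) / (W.baseChange Qbar).phiAt x y n
    else ((W.baseChange Qbar).psiAt x y n ^ 2)⁻¹

variable [W.IsElliptic]

lemma isogValue_ne_zero {n : ℕ} {N : ℕ+} {s : Qbar} (hs : s ≠ 0) (P : Pts W) :
    isogValue n N s P ≠ 0 := by
  rcases P with _ | ⟨x, y, h⟩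
  · exact hs
  · simp only [isogValue]
    split_ifs with h0
    · exact div_ne_zero (zpow_ne_zero _ (by simp)) (phiAt_ne_zero_of_psiAt_eq_zero h n h0)
    · exact inv_ne_zero (pow_ne_zero 2 h0)

/-- The morphism to `P_N` over `[n]` and under `[d]` defined by `ψₙ⁻²`. -/
noncomputable def isog (T : Torsor W) (n d : ℕ) (N : ℕ+) (s : Qbar) : T.Pt → (Pn W N).Pt :=
  T.mapOfSection (Pn W N) n d fun P => unitOf (isogValue n N s P)

/-- Regularity at an affine point: if it is killed by `n` then the frame `t(nP)⁻²` of `P_N`, up to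
the sign and a power of `negFactor`, cancels `ψₙ⁻²` because `t(nP) = -φₙ ψₙ / ωₙ`. -/
lemma regE_isog_affine {n : ℕ} {N : ℕ+} {s : Qbar} (hn : 0 < n) (hs : s ≠ 0) {P₀ : Pts W}
    (h0 : P₀ ≠ 0) : RegE P₀ fun P =>
      (unitOf (isogValue n N s P) : Qbar) / framePn N (n • P₀) (n • P) := by
  obtain ⟨x₀, y₀, hxy, rfl⟩ : ∃ x y hxy, P₀ = .some x y hxy := by
    cases P₀
    · exact absurd rfl h0
    · exact ⟨_, _, _, rfl⟩
  by_cases hn0 : n • (Affine.Point.some x₀ y₀ hxy : Pts W) = 0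
  · have hψ := (nsmul_eq_zero_iff_psiAt hxy n).mp hn0
    have hφ := phiAt_ne_zero_of_psiAt_eq_zero hxy n hψ
    have hω : (W.baseChange Qbar).omegaAt x₀ y₀ n ≠ 0 := by
      intro h
      have := omegaAt_sq_of_psiAt_eq_zero hxy hn hψ
      rw [h, zero_pow two_ne_zero, eq_comm, pow_eq_zero_iff three_ne_zero] at this
      exact hφ this
    have hm := regMapAt_nsmul hn (Affine.Point.some x₀ y₀ hxy : Pts W)
    have hm' := hm.tendsto
    simp only [hn0] at hm'
    have hg : RegE (n • (Affine.Point.some x₀ y₀ hxy : Pts W)) negFactor := by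
      rw [hn0]; exact regE_negFactor
    have hg' : RegE (Affine.Point.some x₀ y₀ hxy : Pts W) fun P => -negFactor (n • P) :=
      (RegE.comp hg hm).neg
    have hgz := hg'.zpow (mem_chartAt _) (by rw [hn0]; simp) (1 - (N : ℤ))
    refine ((((regE_phiAt h0 n).div (regE_omegaAt h0 n) (mem_chartAt _) hω).pow 2).mul
      hgz).congr ?_
    filter_upwards [eventually_ne_zero h0,
          (regE_phiAt h0 n).eventually_ne (mem_chartAt _) hφ,
          (regE_omegaAt h0 n).eventually_ne (mem_chartAt _) hω,
          hm'.eventually (eventually_framePn_zero N)] with P hP hφ hω hF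
    rw [coe_unitOf (isogValue_ne_zero hs P), hn0]
    rcases P with _ | ⟨x, y, h⟩
    · exact absurd rfl hP
    simp only [affineFun_some, isogValue] at *
    split_ifs with hψ'
    · have hE := (nsmul_eq_zero_iff_psiAt h n).mpr hψ'
      rw [hE, framePn_zero_zero, negFactor_zero]
      have := omegaAt_sq_of_psiAt_eq_zero h hn hψ'
      simp only [Units.val_one, div_one]
      field_simp
      exact this
    · have hE : n • (Affine.Point.some x y h : Pts W) ≠ 0 := fun h0 =>
        hψ' ((nsmul_eq_zero_iff_psiAt h n).mp h0)
      obtain ⟨hF, ht⟩ := hF hE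
      rw [hF]
      have e2 : (N : ℤ) - 1 = -(1 - (N : ℤ)) := by ring
      rw [e2, zpow_neg, div_eq_mul_inv, mul_inv, inv_inv, inv_inv, ← mul_assoc]
      congr 1
      rcases hE' : n • (Affine.Point.some x y h : Pts W) with _ | ⟨X, Y, hX⟩
      · exact absurd hE' hE
      · obtain rfl := eq_div_of_mul_eq (pow_ne_zero 2 hψ') (nsmul_X h hE')
        obtain rfl := eq_div_of_mul_eq (pow_ne_zero 3 hψ') (nsmul_Y h hn hE')
        simp only [Chart.fst]
        field_simp
  · have hψ : (W.baseChange Qbar).psiAt x₀ y₀ n ≠ 0 := fun h =>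
      hn0 ((nsmul_eq_zero_iff_psiAt hxy n).mpr h)
    refine (((regE_psiAt h0 n).pow 2).inv (mem_chartAt _) (pow_ne_zero 2 hψ)).congr ?_
    filter_upwards [eventually_ne_zero h0,
          (regE_psiAt h0 n).eventually_ne (mem_chartAt _) hψ] with P hP hψ
    rw [coe_unitOf (isogValue_ne_zero hs P), framePn_of_ne_zero N hn0, Units.val_one, div_one]
    rcases P with _ | ⟨x, y, h⟩
    · exact absurd rfl hP
    · exact if_neg hψ

/-- Regularity at the origin: with `t(nP) = t ^ n² ψₙ` up to a unit, the factors `ψₙ` cancel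
and the powers of `t` are absorbed by the frame of the source. -/
lemma regE_isog_zero {n d : ℕ} {N : ℕ+} {s : Qbar} (hn : 0 < n) (hs : s ≠ 0) {u : Pts W → Qbarˣ}
    {e : Pts W → Qbar} (he : RegE 0 e) (hu0 : u 0 = 1)
    (hu : ∀ᶠ P in nhdsE (0 : Pts W), P ≠ 0 → (u P : Qbar) ^ d * Chart.U.fst P ^ (2 * n ^ 2) = e P)
    (hs' : e 0 * (-1) ^ (1 - (N : ℤ)) = s) : RegE (0 : Pts W) fun P =>
      (u P : Qbar) ^ d * unitOf (isogValue n N s P) / framePn N 0 (n • P) := by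
  have hm := regMapAt_nsmul hn (0 : Pts W)
  have hm' := hm.tendsto
  simp only [nsmul_zero] at hm'
  have hg : RegE (n • (0 : Pts W)) negFactor := by
    rw [nsmul_zero]; exact regE_negFactor
  have hg' : RegE (0 : Pts W) fun P => -negFactor (n • P) := (RegE.comp hg hm).neg
  have hgz := hg'.zpow (mem_chartAt _) (by rw [nsmul_zero]; simp) (1 - (N : ℤ))
  refine ((he.mul ((regE_tRatio hn).pow 2)).mul hgz).congr ?_
  filter_upwards [eventually_mem_U, hu, eventually_nsmul_zero hn,
    (regE_psiHat n).eventually_ne (mem_chartAt (0 : Pts W)) (psiHat_zero_ne_zero hn),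
    hm'.eventually (eventually_framePn_zero N)] with P hU hu hP hψ hF
  rw [coe_unitOf (isogValue_ne_zero hs P)]
  rcases P with _ | ⟨x, y, h⟩
  · change ((u 0 : Qbarˣ) : Qbar) ^ d * s / framePn N 0 (n • (0 : Pts W)) =
      e 0 * tRatio n 0 ^ 2 * (-negFactor (n • (0 : Pts W))) ^ (1 - (N : ℤ))
    rw [nsmul_zero, framePn_zero_zero, hu0, tRatio_zero_sq hn, negFactor_zero, ← hs']
    simp
  · have h0 : (Affine.Point.some x y h : Pts W) ≠ 0 := by simp
    have hu := hu h0
    obtain ⟨-, -, ht, -, hne⟩ := hP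
    obtain ⟨hF, ht'⟩ := hF (hne h0)
    have hψ' : (W.baseChange Qbar).psiAt x y n ≠ 0 := fun h1 =>
      hne h0 ((nsmul_eq_zero_iff_psiAt h n).mpr h1)
    have e2 : (N : ℤ) - 1 = -(1 - (N : ℤ)) := by ring
    rw [hF, e2, zpow_neg, ← hu, ht, psiHat_some hn hU]
    simp only [isogValue, if_neg hψ']
    rw [div_eq_mul_inv, mul_inv, inv_inv, inv_inv, ← mul_assoc]
    congr 1
    obtain ⟨k, hk⟩ : ∃ k, n ^ 2 = k + 1 := Nat.exists_eq_add_one.mpr (by positivity)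
    rw [hk, Nat.add_sub_cancel]
    field_simp
    ring

/-- The section `ψₙ⁻²` defines a morphism to `P_N` from every torsor with frames `1` near the affine
points and a frame `u` with `u ^ d = e t ^ (-2 n²)` near the origin, for a regular function `e`. -/
lemma isMorphism_isog {T : Torsor W} {n d : ℕ} {N : ℕ+} {s : Qbar} (hn : 0 < n) (hs : s ≠ 0)
    {u : Pts W → Pts W → Qbarˣ} (hT : ∀ P₀, IsUnitFrame T P₀ (u P₀))
    (h1 : ∀ P₀, P₀ ≠ 0 → ∀ P, u P₀ P = 1) {e : Pts W → Qbar} (he : RegE 0 e) (hu0 : u 0 0 = 1)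
    (hu : ∀ᶠ P in nhdsE (0 : Pts W), P ≠ 0 → (u 0 P : Qbar) ^ d * Chart.U.fst P ^ (2 * n ^ 2) = e P)
    (hs' : e 0 * (-1) ^ (1 - (N : ℤ)) = s) :
    Torsor.IsMorphism n d (isog T n d N s) := by
  refine Torsor.isMorphism_mapOfSection hn fun P₀ =>
    ⟨u P₀, framePn N (n • P₀), hT P₀, isUnitFrame_framePn N _, ?_⟩
  by_cases h0 : P₀ = 0
  · subst h0
    rw [nsmul_zero]
    exact regE_isog_zero hn hs he hu0 hu hs'
  · refine (regE_isog_affine (N := N) hn hs h0).congr (.of_forall fun P => ?_)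
    rw [h1 P₀ h0, Units.val_one, one_pow, one_mul]

lemma isMorphism_isog_P (n : ℕ+) :
    Torsor.IsMorphism n (2 * (n : ℕ) ^ 2) (isog (P W) n (2 * (n : ℕ) ^ 2) n
      ((-1) ^ (1 - (n : ℤ)))) := by
  refine isMorphism_isog n.pos (zpow_ne_zero _ (by simp)) isUnitFrame_frameP
    (fun P₀ h P => frameP_of_ne_zero h P) RegAt.one frameP_zero_zero ?_ (one_mul _)
  filter_upwards [eventually_mem_U] with P hU h0
  have ht : Chart.U.fst P ≠ 0 := by
    rcases P with _ | ⟨x, y, h⟩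
    · exact absurd rfl h0
    · exact U_fst_ne_zero hU
  rw [frameP_zero hU, frame_U_of_ne_zero h0, inv_pow, inv_mul_cancel₀ (pow_ne_zero _ ht)]

lemma isMorphism_isog_Pn (n m : ℕ+) :
    Torsor.IsMorphism m ((m : ℕ) ^ 2) (isog (Pn W n) m ((m : ℕ) ^ 2) (n * m)
      ((-1) ^ (((n : ℤ) - 1) * m ^ 2 + (1 - ((n * m : ℕ+) : ℤ))))) := by
  refine isMorphism_isog m.pos (zpow_ne_zero _ (by simp)) (isUnitFrame_framePn n)
    (fun P₀ h P => framePn_of_ne_zero n h P)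
    (e := fun P => (-negFactor P) ^ (((n : ℤ) - 1) * m ^ 2))
    (regE_negFactor.neg.zpow (mem_chartAt _) (by simp) _) (framePn_zero_zero n) ?_ ?_
  · filter_upwards [eventually_framePn_zero n] with P hF h0
    obtain ⟨hF, ht⟩ := hF h0
    rw [hF, mul_pow, inv_pow, ← pow_mul, zpow_mul]
    norm_cast
    field_simp
  · rw [negFactor_zero, zpow_add₀ (by simp)]

end PuncturedElliptic

namespace WeierstrassCurve

/-! ### Functions on the affine curve -/

variable {k : Type*} [Field k] {V : WeierstrassCurve k}

/-- The value at a point of an element of the coordinate ring. -/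
noncomputable def evalAt {x y : k} (h : V.toAffine.Equation x y) :
    V.toAffine.CoordinateRing →+* k := AdjoinRoot.evalEval h

@[simp] lemma evalAt_mk {x y : k} (h : V.toAffine.Equation x y) (g : k[X][X]) :
    evalAt h (Affine.CoordinateRing.mk V.toAffine g) = g.evalEval x y :=
  AdjoinRoot.evalEval_mk h g

/-- The order of the pole at the origin of a function on the affine curve. As the origin is the only
point at infinity, it is the degree of the norm to `k[x]`. -/
noncomputable def poleDegree (g : V.toAffine.CoordinateRing) : WithBot ℕ :=
  (Algebra.norm k[X] g).degree

lemma poleDegree_mul (f g : V.toAffine.CoordinateRing) :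
    poleDegree (f * g) = poleDegree f + poleDegree g := by
  rw [poleDegree, map_mul, Polynomial.degree_mul]; rfl

lemma poleDegree_zero : poleDegree (0 : V.toAffine.CoordinateRing) = ⊥ := by
  have := Affine.CoordinateRing.degree_norm_smul_basis (W' := V.toAffine) 0 0
  rw [zero_smul, zero_smul, add_zero] at this
  rw [poleDegree, this]
  simp

lemma poleDegree_add_lt {f g : V.toAffine.CoordinateRing} {m : WithBot ℕ} (hf : poleDegree f < m)
    (hg : poleDegree g < m) : poleDegree (f + g) < m := by
  obtain ⟨p, q, rfl⟩ := Affine.CoordinateRing.exists_smul_basis_eq f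
  obtain ⟨p', q', rfl⟩ := Affine.CoordinateRing.exists_smul_basis_eq g
  have e : p • (1 : V.toAffine.CoordinateRing) + q • Affine.CoordinateRing.mk V.toAffine .X +
      (p' • 1 + q' • Affine.CoordinateRing.mk V.toAffine .X) =
      (p + p') • 1 + (q + q') • Affine.CoordinateRing.mk V.toAffine .X := by
    rw [add_smul, add_smul]; abel
  rw [e]
  rw [poleDegree, Affine.CoordinateRing.degree_norm_smul_basis, max_lt_iff] at hf hg ⊢
  refine ⟨?_, ?_⟩
  · rcases le_max_iff.mp (Polynomial.degree_add_le p p') with h | h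
    · exact (nsmul_le_nsmul_right h 2).trans_lt hf.1
    · exact (nsmul_le_nsmul_right h 2).trans_lt hg.1
  · rcases le_max_iff.mp (Polynomial.degree_add_le q q') with h | h
    · exact (add_le_add_left (nsmul_le_nsmul_right h 2) 3).trans_lt hf.2
    · exact (add_le_add_left (nsmul_le_nsmul_right h 2) 3).trans_lt hg.2

lemma poleDegree_C_le (p : k[X]) :
    poleDegree (Affine.CoordinateRing.mk V.toAffine (.C p)) = 2 • p.degree := by
  have := Affine.CoordinateRing.degree_norm_smul_basis (W' := V.toAffine) p 0
  rw [zero_smul, add_zero, Affine.CoordinateRing.smul, mul_one] at this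
  rw [poleDegree, this]
  simp

lemma poleDegree_Y : poleDegree (Affine.CoordinateRing.mk V.toAffine .X) = 3 := by
  have := Affine.CoordinateRing.degree_norm_smul_basis (W' := V.toAffine) 0 1
  rw [zero_smul, zero_add, one_smul] at this
  rw [poleDegree, this]
  simp

lemma poleDegree_Y_pow (N : ℕ) :
    poleDegree (Affine.CoordinateRing.mk V.toAffine .X ^ N) = ((3 * N : ℕ) : WithBot ℕ) := by
  induction N with
  | zero => simp [poleDegree]
  | succ N ih =>
    rw [pow_succ, poleDegree_mul, ih, poleDegree_Y, mul_add]
    rfl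

/-- An invertible function on the affine curve is constant. -/
lemma exists_eq_C_of_isUnit {g : V.toAffine.CoordinateRing} (hg : IsUnit g) :
    ∃ c : k, g = Affine.CoordinateRing.mk V.toAffine (.C (.C c)) := by
  have h := Polynomial.degree_eq_zero_of_isUnit (hg.map (Algebra.norm k[X]))
  obtain ⟨p, q, rfl⟩ := Affine.CoordinateRing.exists_smul_basis_eq g
  rw [Affine.CoordinateRing.degree_norm_smul_basis] at h
  have hq : q = 0 := by
    by_contra hq
    have := (le_max_right (2 • p.degree) (2 • q.degree + 3)).trans_eq h
    rw [Polynomial.degree_eq_natDegree hq] at this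
    have h3 : q.natDegree + q.natDegree + 3 ≤ 0 := by
      rw [two_nsmul] at this
      exact_mod_cast this
    omega
  have hp : p.degree ≤ 0 := by
    by_contra hp
    have := (le_max_left (2 • p.degree) (2 • q.degree + 3)).trans_eq h
    rw [Polynomial.degree_eq_natDegree (by rintro rfl; simp at hp)] at this hp
    have h3 : p.natDegree + p.natDegree ≤ 0 := by
      rw [two_nsmul] at this
      exact_mod_cast this
    have h4 : ¬ p.natDegree ≤ 0 := by exact_mod_cast hp
    omega
  refine ⟨p.coeff 0, ?_⟩
  rw [hq, zero_smul, add_zero, Affine.CoordinateRing.smul, mul_one,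
    ← Polynomial.eq_C_of_degree_le_zero hp]

/-- The element of the coordinate ring defined by a polynomial in two variables. -/
noncomputable def coordHom (V : WeierstrassCurve k) :
    MvPolynomial (Fin 2) k →ₐ[k] V.toAffine.CoordinateRing :=
  MvPolynomial.aeval ![Affine.CoordinateRing.mk V.toAffine (.C .X),
    Affine.CoordinateRing.mk V.toAffine .X]

lemma evalAt_coordHom {x y : k} (h : V.toAffine.Equation x y) (g : MvPolynomial (Fin 2) k) :
    evalAt h (coordHom V g) = MvPolynomial.aeval ![x, y] g := by
  induction g using MvPolynomial.induction_on with
  | C c =>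
    rw [MvPolynomial.algHom_C, MvPolynomial.aeval_C]
    change evalAt h (Affine.CoordinateRing.mk V.toAffine (.C (.C c))) = _
    rw [evalAt_mk, Polynomial.evalEval_C, Polynomial.eval_C]
    rfl
  | add a b ha hb => rw [map_add, map_add, ha, hb, map_add]
  | mul_X a i ha =>
    rw [map_mul, map_mul, ha, map_mul, coordHom, MvPolynomial.aeval_X, MvPolynomial.aeval_X]
    congr 1
    fin_cases i
    · exact (evalAt_mk h _).trans (by rw [Polynomial.evalEval_C, Polynomial.eval_X]; rfl)
    · exact (evalAt_mk h _).trans (by rw [Polynomial.evalEval_X]; rfl)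

/-- A polynomial in `t = -x/y` and `u = -1/y`, multiplied by a power of `y`, is its constant term
up to a function with a pole of lower order. -/
lemma exists_clear_denominators (g : MvPolynomial (Fin 2) k) :
    ∃ (N : ℕ) (H : V.toAffine.CoordinateRing), poleDegree H < ((3 * N : ℕ) : WithBot ℕ) ∧
      ∀ x y (h : V.toAffine.Equation x y), y ≠ 0 →
        evalAt h H + MvPolynomial.aeval ![0, 0] g * y ^ N =
          y ^ N * MvPolynomial.aeval ![-x / y, -1 / y] g := by
  set X' := Affine.CoordinateRing.mk V.toAffine (.C .X) with hX
  set Y' := Affine.CoordinateRing.mk V.toAffine .X with hY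
  have pX : poleDegree (-X') = 2 := by
    rw [poleDegree, hX, ← map_neg, ← Polynomial.C_neg]
    refine (poleDegree_C_le _).trans ?_
    rw [Polynomial.degree_neg, Polynomial.degree_X]; rfl
  have p1 : poleDegree (-1 : V.toAffine.CoordinateRing) = 0 := by
    have := poleDegree_C_le (V := V) (-1)
    rw [Polynomial.degree_neg, Polynomial.degree_one] at this
    simpa using this
  have lt_of : ∀ {a b : WithBot ℕ} {c : ℕ}, a < b → a + c < b + c := fun h =>
    WithBot.add_lt_add_right WithBot.coe_ne_bot h
  have key : ∀ (N : ℕ) (H : V.toAffine.CoordinateRing) (c : k),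
      poleDegree H < ((3 * N : ℕ) : WithBot ℕ) →
      poleDegree (H + Affine.CoordinateRing.mk V.toAffine (.C (.C c)) * Y' ^ N) <
        ((3 * N + 1 : ℕ) : WithBot ℕ) := by
    intro N H c hH
    refine poleDegree_add_lt (hH.trans (Nat.cast_lt.mpr (Nat.lt_succ_self _))) ?_
    rw [poleDegree_mul, hY, poleDegree_Y_pow, poleDegree_C_le]
    by_cases hc : c = 0
    · simp only [hc, map_zero, Polynomial.degree_zero, two_nsmul, WithBot.bot_add]
      exact WithBot.bot_lt_coe _
    · rw [Polynomial.degree_C hc, nsmul_zero, zero_add]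
      exact Nat.cast_lt.mpr (Nat.lt_succ_self _)
  induction g using MvPolynomial.induction_on with
  | C c => exact ⟨1, 0, by rw [poleDegree_zero]; exact WithBot.bot_lt_coe _, fun x y h hy => by
      simp [mul_comm]⟩
  | add a b ha hb =>
    obtain ⟨N, H, hH, h1⟩ := ha
    obtain ⟨N', H', hH', h2⟩ := hb
    refine ⟨N + N', H * Y' ^ N' + H' * Y' ^ N, poleDegree_add_lt ?_ ?_, fun x y h hy => ?_⟩
    · rw [poleDegree_mul, hY, poleDegree_Y_pow, mul_add, Nat.cast_add]
      exact lt_of hH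
    · rw [poleDegree_mul, hY, poleDegree_Y_pow, mul_add, add_comm (3 * N), Nat.cast_add]
      exact lt_of hH'
    · have h1 := h1 x y h hy
      have h2 := h2 x y h hy
      simp only [map_add, map_mul, map_pow, hY, evalAt_mk, Polynomial.evalEval_X]
      linear_combination y ^ N' * h1 + y ^ N * h2
  | mul_X a i ha =>
    obtain ⟨N, H, hH, h1⟩ := ha
    set c := MvPolynomial.aeval ![(0 : k), 0] a with hc
    have hk := key N H c hH
    fin_cases i
    · refine ⟨N + 1, -X' * (H + Affine.CoordinateRing.mk V.toAffine (.C (.C c)) * Y' ^ N), ?_,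
        fun x y h hy => ?_⟩
      · rw [poleDegree_mul, pX, add_comm, mul_add]
        exact lt_of (c := 2) hk
      · have h1 := h1 x y h hy
        simp only [map_add, map_mul, map_pow, map_neg, hX, hY, evalAt_mk, Polynomial.evalEval_X,
          Polynomial.evalEval_C, Polynomial.eval_X, Polynomial.eval_C, MvPolynomial.aeval_X]
        simp only [Fin.zero_eta, Matrix.cons_val_zero]
        generalize MvPolynomial.aeval ![-x / y, -1 / y] a = A at h1 ⊢
        have e : y ^ (N + 1) * (A * (-x / y)) = -x * (y ^ N * A) := by rw [pow_succ]; field_simp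
        rw [e]
        linear_combination -x * h1
    · refine ⟨N + 1, -1 * (H + Affine.CoordinateRing.mk V.toAffine (.C (.C c)) * Y' ^ N), ?_,
        fun x y h hy => ?_⟩
      · rw [poleDegree_mul, p1, zero_add, mul_add]
        exact hk.trans (Nat.cast_lt.mpr (by omega))
      · have h1 := h1 x y h hy
        simp only [map_add, map_mul, map_pow, map_neg, map_one, hY, evalAt_mk,
          Polynomial.evalEval_X, Polynomial.evalEval_C, Polynomial.eval_C, MvPolynomial.aeval_X]
        simp only [Fin.mk_one, Matrix.cons_val_one, Matrix.cons_val_fin_one]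
        generalize MvPolynomial.aeval ![-x / y, -1 / y] a = A at h1 ⊢
        have e : y ^ (N + 1) * (A * (-1 / y)) = -1 * (y ^ N * A) := by rw [pow_succ]; field_simp
        rw [e]
        linear_combination -h1

variable [IsAlgClosed k]

/-- A function on the affine curve that vanishes at all points is zero. -/
lemma eq_zero_of_evalAt {g : V.toAffine.CoordinateRing}
    (hg : ∀ x y (h : V.toAffine.Equation x y), evalAt h g = 0) : g = 0 := by
  -- The norm of `g` at `x` is the product of the values of `g` at the two points above `x`.
  have : Algebra.norm k[X] g = 0 := by
    refine Polynomial.funext fun x => ?_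
    obtain ⟨y, hy⟩ := exists_equation (V := V) x
    have h0 := hg x y hy
    obtain ⟨p, q, rfl⟩ := Affine.CoordinateRing.exists_smul_basis_eq g
    rw [Affine.CoordinateRing.smul, Affine.CoordinateRing.smul, mul_one, map_add, map_mul,
      evalAt_mk, evalAt_mk, evalAt_mk] at h0
    simp only [Polynomial.evalEval_C, Polynomial.evalEval_X] at h0
    rw [Affine.CoordinateRing.norm_smul_basis]
    rw [Affine.equation_iff] at hy
    simp only [Polynomial.eval_sub, Polynomial.eval_mul, Polynomial.eval_pow, Polynomial.eval_add,
      Polynomial.eval_C, Polynomial.eval_X, Polynomial.eval_zero]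
    linear_combination (p.eval x - q.eval x * (y + V.a₁ * x + V.a₃)) * h0 + q.eval x ^ 2 * hy
  have := Module.Finite.of_basis (Affine.CoordinateRing.basis V.toAffine)
  have := Module.Free.of_basis (Affine.CoordinateRing.basis V.toAffine)
  exact (Algebra.norm_eq_zero_iff (R := k[X])).mp ‹_›

/-- A function on the affine curve that is locally a fraction of polynomials is a polynomial: by the
Nullstellensatz, the ideal of its possible denominators is the unit ideal. -/
lemma exists_polynomial_of_local {r : k → k → k}
    (hr : ∀ x₀ y₀, V.toAffine.Equation x₀ y₀ → ∃ a b : MvPolynomial (Fin 2) k,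
      MvPolynomial.aeval ![x₀, y₀] b ≠ 0 ∧ ∀ x y, V.toAffine.Equation x y →
        MvPolynomial.aeval ![x, y] b ≠ 0 →
          r x y = MvPolynomial.aeval ![x, y] a / MvPolynomial.aeval ![x, y] b) :
    ∃ s : MvPolynomial (Fin 2) k, ∀ x y, V.toAffine.Equation x y →
      r x y = MvPolynomial.aeval ![x, y] s := by
  -- The ideal of denominators.
  let J : Ideal (MvPolynomial (Fin 2) k) :=
    { carrier := {g | ∃ s : MvPolynomial (Fin 2) k, ∀ x y, V.toAffine.Equation x y →
        MvPolynomial.aeval ![x, y] g * r x y = MvPolynomial.aeval ![x, y] s}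
      add_mem' := by
        rintro g g' ⟨s, hs⟩ ⟨s', hs'⟩
        refine ⟨s + s', fun x y h => ?_⟩
        rw [map_add, map_add, add_mul, hs x y h, hs' x y h]
      zero_mem' := ⟨0, fun x y h => by simp⟩
      smul_mem' := by
        rintro c g ⟨s, hs⟩
        refine ⟨c * s, fun x y h => ?_⟩
        rw [smul_eq_mul, map_mul, map_mul, mul_assoc, hs x y h] }
  by_cases hJ : J = ⊤
  · obtain ⟨s, hs⟩ : (1 : MvPolynomial (Fin 2) k) ∈ J := by rw [hJ]; trivial
    exact ⟨s, fun x y h => by rw [← hs x y h, map_one, one_mul]⟩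
  exfalso
  obtain ⟨M, hM, hJM⟩ := Ideal.exists_le_maximal J hJ
  obtain ⟨z, rfl⟩ := MvPolynomial.isMaximal_iff_eq_vanishingIdeal_singleton.mp hM
  have hz : z = ![z 0, z 1] := by ext i; fin_cases i <;> rfl
  have mem : ∀ g ∈ J, MvPolynomial.aeval ![z 0, z 1] g = 0 := by
    intro g hg
    rw [← hz]
    exact hJM hg z rfl
  have heq : V.toAffine.Equation (z 0) (z 1) := by
    have := mem (.X 1 ^ 2 + .C V.a₁ * .X 0 * .X 1 + .C V.a₃ * .X 1 -
      (.X 0 ^ 3 + .C V.a₂ * .X 0 ^ 2 + .C V.a₄ * .X 0 + .C V.a₆)) ⟨0, fun x y h => by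
        rw [Affine.equation_iff'] at h
        simp [h]⟩
    rw [Affine.equation_iff']
    simpa using this
  obtain ⟨a, b, hb, hab⟩ := hr _ _ heq
  have := mem (b ^ 2) ⟨a * b, fun x y h => by
    by_cases h0 : MvPolynomial.aeval ![x, y] b = 0
    · rw [map_pow, map_mul, h0]; ring
    · rw [hab x y h h0, map_pow, map_mul]
      field_simp⟩
  rw [map_pow] at this
  exact hb (pow_eq_zero_iff two_ne_zero |>.mp this)

/-- A nowhere vanishing function on the affine curve that is locally a fraction of polynomials is
constant, since it is invertible in the coordinate ring. -/
lemma exists_const_of_local {r : k → k → k}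
    (h0 : ∀ x y, V.toAffine.Equation x y → r x y ≠ 0)
    (hr : ∀ x₀ y₀, V.toAffine.Equation x₀ y₀ → ∃ a b : MvPolynomial (Fin 2) k,
      MvPolynomial.aeval ![x₀, y₀] b ≠ 0 ∧ ∀ x y, V.toAffine.Equation x y →
        MvPolynomial.aeval ![x, y] b ≠ 0 →
          r x y = MvPolynomial.aeval ![x, y] a / MvPolynomial.aeval ![x, y] b) :
    ∃ c, ∀ x y, V.toAffine.Equation x y → r x y = c := by
  obtain ⟨s, hs⟩ := exists_polynomial_of_local hr
  obtain ⟨s', hs'⟩ := exists_polynomial_of_local (V := V) (r := fun x y => (r x y)⁻¹) (by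
    intro x₀ y₀ h
    obtain ⟨a, b, hb, hab⟩ := hr x₀ y₀ h
    have ha : MvPolynomial.aeval ![x₀, y₀] a ≠ 0 := by
      intro ha
      have := hab x₀ y₀ h hb
      rw [ha, zero_div] at this
      exact h0 x₀ y₀ h this
    -- The factor `b` excludes the points where the fraction for `r` is not valid.
    refine ⟨b * b, a * b, by rw [map_mul]; exact mul_ne_zero ha hb, fun x y h hab' => ?_⟩
    rw [map_mul] at hab'
    have hb' := right_ne_zero_of_mul hab'
    rw [hab x y h hb', inv_div, map_mul, map_mul, mul_div_mul_right _ _ hb'])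
  have h1 : coordHom V s * coordHom V s' = 1 := by
    rw [← sub_eq_zero]
    refine eq_zero_of_evalAt fun x y h => ?_
    rw [map_sub, map_mul, evalAt_coordHom, evalAt_coordHom, ← hs x y h, ← hs' x y h, map_one,
      mul_inv_cancel₀ (h0 x y h), sub_self]
  obtain ⟨c, hc⟩ := exists_eq_C_of_isUnit (IsUnit.of_mul_eq_one _ h1)
  refine ⟨c, fun x y h => ?_⟩
  rw [hs x y h, ← evalAt_coordHom h, hc, evalAt_mk, Polynomial.evalEval_C, Polynomial.eval_C]

/-- A polynomial in `t = -x/y` and `u = -1/y` that vanishes on the affine curve vanishes at the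
origin: otherwise its product with `y ^ N` has a pole of order `3 N`. -/
lemma aeval_zero_of_vanish {g : MvPolynomial (Fin 2) k}
    (hg : ∀ x y, V.toAffine.Equation x y → x ≠ 0 → y ≠ 0 →
      MvPolynomial.aeval ![-x / y, -1 / y] g = 0) : MvPolynomial.aeval ![(0 : k), 0] g = 0 := by
  obtain ⟨N, H, hH, h⟩ := exists_clear_denominators (V := V) g
  by_contra hc
  set c := MvPolynomial.aeval ![(0 : k), 0] g with hc'
  set X' := Affine.CoordinateRing.mk V.toAffine (.C .X) with hX
  set Y' := Affine.CoordinateRing.mk V.toAffine .X with hY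
  have hY0 : Y' ≠ 0 := fun h0 => by
    have := poleDegree_Y (V := V)
    rw [← hY, h0, poleDegree_zero] at this
    exact WithBot.bot_ne_coe this
  have hX0 : X' ≠ 0 := fun h0 => by
    have := poleDegree_C_le (V := V) .X
    rw [← hX, h0, poleDegree_zero, Polynomial.degree_X] at this
    exact WithBot.bot_ne_coe this
  have h1 : X' * Y' * (H + Affine.CoordinateRing.mk V.toAffine (.C (.C c)) * Y' ^ N) = 0 := by
    refine eq_zero_of_evalAt fun x y he => ?_
    simp only [map_add, map_mul, map_pow, hX, hY, evalAt_mk, Polynomial.evalEval_X,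
          Polynomial.evalEval_C, Polynomial.eval_X, Polynomial.eval_C]
    by_cases hx : x = 0
    · simp [hx]
    by_cases hy : y = 0
    · simp [hy]
    rw [h x y he hy, hg x y he hx hy, mul_zero, mul_zero]
  have h2 := (mul_eq_zero.mp h1).resolve_left (mul_ne_zero hX0 hY0)
  have h3 : H = Affine.CoordinateRing.mk V.toAffine (.C (.C (-c))) * Y' ^ N := by
    rw [Polynomial.C_neg, Polynomial.C_neg, map_neg]
    linear_combination h2
  rw [h3, poleDegree_mul, poleDegree_Y_pow, poleDegree_C_le, Polynomial.degree_C
    (neg_ne_zero.mpr hc)] at hH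
  simp at hH

end WeierstrassCurve

namespace PuncturedElliptic

open WeierstrassCurve

variable {W : WeierstrassCurve ℚ} [W.IsElliptic]

/-! ### Uniqueness of morphisms of torsors -/

/-- A nowhere vanishing regular function on the elliptic curve is constant. -/
lemma exists_const_of_regE {r : Pts W → Qbar} (hr : ∀ P₀, RegE P₀ r) (h0 : ∀ P, r P ≠ 0) :
    ∃ c, ∀ P, r P = c := by
  have hns {x y : Qbar} (h : (W.baseChange Qbar).toAffine.Equation x y) :
      (W.baseChange Qbar).toAffine.Nonsingular x y := Affine.equation_iff_nonsingular.mp h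
  -- The function in terms of the affine coordinates, with the value `0` off the curve.
  let r' (x y : Qbar) : Qbar := open scoped Classical in
    if h : (W.baseChange Qbar).toAffine.Nonsingular x y then r (.some x y h) else 0
  have hr' {x y : Qbar} (h : (W.baseChange Qbar).toAffine.Equation x y) :
      r' x y = r (.some x y (hns h)) := dif_pos _
  have hmap (g : MvPolynomial (Fin 2) ℚ) (z : Fin 2 → Qbar) :
      MvPolynomial.aeval z (g.map (algebraMap ℚ Qbar)) = MvPolynomial.aeval z g :=
    MvPolynomial.aeval_map_algebraMap ..
  obtain ⟨c, hc⟩ := exists_const_of_local (V := W.baseChange Qbar) (r := r')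
    (fun x y h => by rw [hr' h]; exact h0 _) (by
      intro x₀ y₀ h
      obtain ⟨a, b, hb, b', hb', hab⟩ := hr (.some x₀ y₀ (hns h))
      change MvPolynomial.aeval ![x₀, y₀] b ≠ 0 at hb
      change MvPolynomial.aeval ![x₀, y₀] b' ≠ 0 at hb'
      refine ⟨(a * b').map (algebraMap ℚ Qbar), (b * b').map (algebraMap ℚ Qbar), ?_,
        fun x y h' hbb => ?_⟩
      · rw [hmap, map_mul]
        exact mul_ne_zero hb hb'
      · rw [hmap, map_mul] at hbb
        rw [hmap, hmap, map_mul, map_mul, mul_div_mul_right _ _ (right_ne_zero_of_mul hbb), hr' h']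
        exact hab (.some x y (hns h')) trivial (right_ne_zero_of_mul hbb))
  refine ⟨c, fun P => ?_⟩
  rcases P with _ | ⟨x, y, h⟩
  -- Near the origin the function is a fraction of polynomials in `t, u`, which equals `c` at all
  -- affine points and hence at the origin.
  · obtain ⟨a, b, hb, b', hb', hab⟩ := hr 0
    change MvPolynomial.aeval ![0, 0] b ≠ 0 at hb
    change MvPolynomial.aeval ![0, 0] b' ≠ 0 at hb'
    have key := aeval_zero_of_vanish (V := W.baseChange Qbar)
      (g := (a.map (algebraMap ℚ Qbar) - .C c * b.map (algebraMap ℚ Qbar)) *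
        (b * b').map (algebraMap ℚ Qbar)) (fun x y h hx hy => by
        rw [map_mul, map_sub, map_mul, MvPolynomial.aeval_C, hmap, hmap, hmap, map_mul]
        by_cases h1 : MvPolynomial.aeval ![-x / y, -1 / y] b = 0
        · rw [h1]; ring
        by_cases h2 : MvPolynomial.aeval ![-x / y, -1 / y] b' = 0
        · rw [h2]; ring
        have h3 : c = MvPolynomial.aeval ![-x / y, -1 / y] a /
            MvPolynomial.aeval ![-x / y, -1 / y] b := by
          rw [← hc x y h, hr' h]
          exact hab (.some x y (hns h)) ⟨hx, hy⟩ h2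
        rw [Algebra.algebraMap_self_apply, h3, div_mul_cancel₀ _ h1, sub_self, zero_mul])
    rw [map_mul, map_sub, map_mul, MvPolynomial.aeval_C, hmap, hmap, hmap, map_mul] at key
    have h3 : r 0 = MvPolynomial.aeval ![0, 0] a / MvPolynomial.aeval ![0, 0] b :=
      hab 0 trivial hb'
    change r 0 = c
    rw [h3, div_eq_iff hb]
    exact sub_eq_zero.mp ((mul_eq_zero.mp key).resolve_right (mul_ne_zero hb hb'))
  · rw [← hc x y h.1, hr' h.1]

/-- Morphisms of torsors over `[a]` and under `[d]` are unique up to a scalar, since their ratio is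
a nowhere vanishing regular function on the curve. -/
lemma Torsor.IsMorphism.exists_eq_smul {T T' : Torsor W} {a d : ℕ} {φ φ' : T.Pt → T'.Pt}
    (h : IsMorphism a d φ) (h' : IsMorphism a d φ') (ha : 0 < a)
    (hT : ∀ P₀, ∃ u, IsUnitFrame T P₀ u) (hT' : ∀ P₀, ∃ u, IsUnitFrame T' P₀ u) :
    ∃ c : Qbarˣ, ∀ p, φ p = c • φ' p := by
  obtain ⟨c, hc⟩ := exists_const_of_regE
    (r := fun P => ((φ ⟨P, 1⟩).coord / (φ' ⟨P, 1⟩).coord : Qbarˣ)) (fun P₀ => by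
      obtain ⟨u, hu⟩ := hT P₀
      obtain ⟨u', hu'⟩ := hT' (a • P₀)
      refine ((h.regE ha hu hu').div (h'.regE ha hu hu') (mem_chartAt _) ?_).congr
        (.of_forall fun P => ?_)
      · exact div_ne_zero (mul_ne_zero (pow_ne_zero _ (Units.ne_zero _)) (Units.ne_zero _))
          (Units.ne_zero _)
      · have e1 := (u P).ne_zero
        have e2 := (u' (a • P)).ne_zero
        rw [Units.val_div_eq_div_val]
        field_simp) (fun P => Units.ne_zero _)
  refine ⟨(φ ⟨0, 1⟩).coord / (φ' ⟨0, 1⟩).coord, fun p => ?_⟩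
  have e : (φ ⟨p.base, 1⟩).coord / (φ' ⟨p.base, 1⟩).coord =
      (φ ⟨0, 1⟩).coord / (φ' ⟨0, 1⟩).coord := Units.ext ((hc _).trans (hc 0).symm)
  rw [← e, h.eq_mapOfSection, h'.eq_mapOfSection]
  simp only [mapOfSection, smul_def, one_pow, one_mul]
  rw [mul_left_comm, div_mul_cancel]

end PuncturedElliptic

namespace PuncturedElliptic

open WeierstrassCurve

variable {W : WeierstrassCurve ℚ}

/-! ### The system of isogenies given by division polynomials -/

lemma exists_isUnitFrame_P (P₀ : Pts W) : ∃ u, IsUnitFrame (P W) P₀ u :=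
  ⟨_, isUnitFrame_frameP P₀⟩

lemma exists_isUnitFrame_Pn (n : ℕ+) (P₀ : Pts W) : ∃ u, IsUnitFrame (Pn W n) P₀ u :=
  ⟨_, isUnitFrame_framePn n P₀⟩

lemma isog_basePt (n d : ℕ) (N : ℕ+) (s : Qbar) :
    isog (P W) n d N s (basePt W) = ⟨0, unitOf s⟩ := by
  change (⟨n • (0 : Pts W), 1 ^ d * unitOf s⟩ : (Pn W N).Pt) = _
  rw [nsmul_zero, one_pow, one_mul]

variable [W.IsElliptic]

variable (W) in
/-- The system of isogenies defined by the sections `ψₙ⁻²`. -/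
noncomputable def divisionSystem : IsogenySystem W where
  β n := isog (P W) n (2 * (n : ℕ) ^ 2) n ((-1) ^ (1 - (n : ℤ)))
  β_isMorphism := isMorphism_isog_P
  trans n m := isog (Pn W n) m ((m : ℕ) ^ 2) (n * m)
    ((-1) ^ (((n : ℤ) - 1) * m ^ 2 + (1 - ((n * m : ℕ+) : ℤ))))
  trans_isMorphism := isMorphism_isog_Pn
  trans_β n m := by
    have h := (isMorphism_isog_P (W := W) n).comp (isMorphism_isog_Pn n m) n.pos m.pos
      exists_isUnitFrame_P (exists_isUnitFrame_Pn n) (exists_isUnitFrame_Pn (n * m))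
    have h' := isMorphism_isog_P (W := W) (n * m)
    rw [show 2 * (n : ℕ) ^ 2 * (m : ℕ) ^ 2 = 2 * ((n * m : ℕ+) : ℕ) ^ 2 by
      rw [PNat.mul_coe]; ring, ← PNat.mul_coe] at h
    obtain ⟨c, hc⟩ := h.exists_eq_smul h' (n * m).pos exists_isUnitFrame_P
      (exists_isUnitFrame_Pn (n * m))
    -- The scalar is determined by the values at the base point.
    have h0 := congrArg (fun p => ((p.coord : Qbarˣ) : Qbar)) (hc (basePt W))
    have hne (k : ℤ) : (-1 : Qbar) ^ k ≠ 0 := zpow_ne_zero k (by simp)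
    have hs : (-1 : Qbar) ^ (1 - ((n * m : ℕ+) : ℤ)) =
        c * (-1 : Qbar) ^ (1 - ((n * m : ℕ+) : ℤ)) := by
      rw [isog_basePt, isog_basePt] at h0
      change ((unitOf _ ^ ((m : ℕ) ^ 2) * unitOf _ : Qbarˣ) : Qbar) =
        ((c * unitOf _ : Qbarˣ) : Qbar) at h0
      rw [Units.val_mul, Units.val_mul, Units.val_pow_eq_pow_val, coe_unitOf (hne _),
        coe_unitOf (hne _)] at h0
      change _ * ((unitOf ((-1) ^ (((n : ℤ) - 1) * m ^ 2 +
        (1 - ((n * m : ℕ+) : ℤ)))) : Qbarˣ) : Qbar) = _ at h0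
      rw [coe_unitOf (hne _), ← zpow_natCast, ← zpow_mul, ← zpow_add₀ (by simp)] at h0
      refine Eq.trans ?_ h0
      congr 1
      push_cast
      ring
    have hc1 : c = 1 := Units.ext (mul_right_cancel₀ (hne (1 - ((n * m : ℕ+) : ℤ)))
      (by rw [← hs, Units.val_one, one_mul]))
    intro p
    have := hc p
    rw [hc1] at this
    refine this.trans ?_
    rw [Torsor.smul_def, one_mul]

/-! ### Injectivity of the map from `ℚ ⊗ ℚ̄ˣ` to the colimit -/

lemma exists_pow_eq {d : ℕ} (hd : 0 < d) (c : Qbarˣ) : ∃ e : Qbarˣ, e ^ d = c := by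
  obtain ⟨z, hz⟩ := IsAlgClosed.exists_pow_nat_eq (c : Qbar) hd
  have hz0 : z ≠ 0 := by
    rintro rfl
    rw [zero_pow hd.ne'] at hz
    exact c.ne_zero hz.symm
  exact ⟨Units.mk0 z hz0, Units.ext hz⟩

lemma QTensorUnits.tmul_pow_sq (N M : ℕ+) (c : Qbarˣ) :
    ((2 * (((N * M : ℕ+) : ℕ) : ℚ) ^ 2)⁻¹ ⊗ₜ[ℤ] Additive.ofMul (c ^ (M : ℕ) ^ 2) : QTensorUnits) =
      (2 * (N : ℚ) ^ 2)⁻¹ ⊗ₜ[ℤ] Additive.ofMul c := by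
  rw [← zpow_natCast c, QTensorUnits.tmul_zpow]
  congr 1
  have hn : (N : ℚ) ≠ 0 := by exact_mod_cast N.ne_zero
  have hm : (M : ℚ) ≠ 0 := by exact_mod_cast M.ne_zero
  simp only [PNat.mul_coe]
  push_cast
  field_simp

namespace IsogenySystem

section

variable {W : WeierstrassCurve ℚ} (S : IsogenySystem W)

/-- The possible values in `ℚ ⊗ ℚ̄ˣ` of a point `p` of `P`: the element `c ^ (1 / (2 N²))` is a
value if `β_N` sends `p` to the multiple by `c` of the image of the base point. -/
def values (p : (P W).Pt) : Set QTensorUnits :=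
  {τ | ∃ (N : ℕ+) (c : Qbarˣ), S.β N p = c • S.β N (basePt W) ∧
    τ = (2 * (N : ℚ) ^ 2)⁻¹ ⊗ₜ[ℤ] Additive.ofMul c}

lemma β_mul_of_eq_smul {N : ℕ+} {c : Qbarˣ} {p : (P W).Pt}
    (h : S.β N p = c • S.β N (basePt W)) (M : ℕ+) :
    S.β (N * M) p = c ^ (M : ℕ) ^ 2 • S.β (N * M) (basePt W) := by
  rw [← S.trans_β, h, (S.trans_isMorphism N M).map_smul, S.trans_β]

lemma values_subset {M : ℕ+} {p p' : (P W).Pt} (h : S.β M p = S.β M p') :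
    S.values p ⊆ S.values p' := by
  rintro _ ⟨N, c, hc, rfl⟩
  refine ⟨N * M, c ^ (M : ℕ) ^ 2, ?_, (QTensorUnits.tmul_pow_sq N M c).symm⟩
  rw [← S.β_mul_of_eq_smul hc M, mul_comm N M, ← S.trans_β, ← S.trans_β, h]

lemma values_subsingleton (p : (P W).Pt) : (S.values p).Subsingleton := by
  rintro _ ⟨N, c, hc, rfl⟩ _ ⟨M, d, hd, rfl⟩
  have h1 := S.β_mul_of_eq_smul hc M
  have h2 := S.β_mul_of_eq_smul hd N
  rw [mul_comm M N, h1] at h2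
  have h3 : c ^ (M : ℕ) ^ 2 = d ^ (N : ℕ) ^ 2 := mul_right_cancel (congrArg Torsor.Pt.coord h2)
  rw [← QTensorUnits.tmul_pow_sq N M c, h3, mul_comm N M, QTensorUnits.tmul_pow_sq M N d]

end

variable (S : IsogenySystem W)

lemma β_surjective (n : ℕ+) : Function.Surjective (S.β n) := by
  intro q
  obtain ⟨Q, hQ⟩ := nsmul_surjective (V := W.baseChange Qbar) n.pos q.base
  obtain ⟨e, he⟩ := exists_pow_eq (d := 2 * (n : ℕ) ^ 2) (by positivity)
    (q.coord / (S.β n ⟨Q, 1⟩).coord)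
  refine ⟨e • ⟨Q, 1⟩, ?_⟩
  rw [(S.β_isMorphism n).map_smul, he]
  ext1
  · exact ((S.β_isMorphism n).map_base _).trans hQ
  · exact div_mul_cancel _ _

/-- The possible values in `ℚ ⊗ ℚ̄ˣ` of an element of the colimit: those of the points of `P` that
represent it. -/
def colimValues : S.Colim → Set QTensorUnits :=
  Quot.lift (fun a => {τ | ∃ p, S.β a.1 p = a.2 ∧ τ ∈ S.values p}) (by
    rintro ⟨n, q⟩ _ ⟨m, rfl⟩
    ext τ
    constructor
    · rintro ⟨p, hp, hτ⟩
      refine ⟨p, ?_, hτ⟩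
      rw [← S.trans_β]
      exact congrArg (S.trans n m) hp
    · rintro ⟨p, hp, hτ⟩
      obtain ⟨p', rfl⟩ := S.β_surjective n q
      refine ⟨p', rfl, S.values_subset (M := n * m) ?_ hτ⟩
      rw [hp]
      exact S.trans_β n m p')

lemma colimValues_subsingleton (a : S.Colim) : (S.colimValues a).Subsingleton := by
  induction a using Quot.ind with
  | mk a =>
    rintro _ ⟨p, hp, h⟩ _ ⟨p', hp', h'⟩
    exact S.values_subsingleton p' (S.values_subset (hp.trans hp'.symm) h) h'

lemma mem_colimValues_incl (τ : QTensorUnits) : τ ∈ S.colimValues (S.incl τ) := by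
  obtain ⟨n, c, rfl⟩ := τ.exists_rep
  rw [incl_tmul]
  obtain ⟨p, hp⟩ := S.β_surjective n (c • S.β n (basePt W))
  exact ⟨p, hp, n, c, hp, rfl⟩

lemma incl_injective : Function.Injective S.incl := fun τ τ' h =>
  S.colimValues_subsingleton _ (S.mem_colimValues_incl τ) (h ▸ S.mem_colimValues_incl τ')

/-! ### Values at torsion points -/

/-- At a point killed by `n`, the section that defines `β_n` has the value `±φₙ⁻¹`, with the same
sign as at the origin. By uniqueness up to a scalar, this holds for any choice of `β_n`. -/
lemma β_f_of_nsmul_eq_zero (n : ℕ+) {x y : Qbar}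
    (h : (W.baseChange Qbar).toAffine.Nonsingular x y)
    (hQ : (n : ℕ) • (Affine.Point.some x y h : Pts W) = 0) {c : Qbarˣ}
    (hc : (c : Qbar) * (W.baseChange Qbar).phiAt x y (n : ℕ) = 1) :
    S.β n (f W x y h) = c • S.β n (basePt W) := by
  obtain ⟨e, he⟩ := (S.β_isMorphism n).exists_eq_smul ((divisionSystem W).β_isMorphism n) n.pos
    exists_isUnitFrame_P (exists_isUnitFrame_Pn n)
  have hψ := (nsmul_eq_zero_iff_psiAt h n).mp hQ
  have hs : (-1 : Qbar) ^ (1 - (n : ℤ)) ≠ 0 := zpow_ne_zero _ (by simp)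
  have key : (divisionSystem W).β n (f W x y h) = c • (divisionSystem W).β n (basePt W) := by
    change isog (P W) n _ n _ _ = c • isog (P W) n _ n _ _
    rw [isog_basePt]
    ext1
    · exact hQ
    · ext
      change ((1 ^ (2 * (n : ℕ) ^ 2) * unitOf (isogValue n n _ (.some x y h)) : Qbarˣ) : Qbar) =
        ((c * unitOf _ : Qbarˣ) : Qbar)
      rw [one_pow, one_mul, Units.val_mul, coe_unitOf hs, coe_unitOf (isogValue_ne_zero hs _)]
      simp only [isogValue]
      rw [if_pos hψ, div_eq_iff (right_ne_zero_of_mul_eq_one hc)]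
      linear_combination -(-1 : Qbar) ^ (1 - (n : ℤ)) * hc
  rw [he, he, key]
  simp only [Torsor.smul_def]
  rw [mul_left_comm]

end IsogenySystem

end PuncturedElliptic

theorem mainTheorem11 (W : WeierstrassCurve ℚ) [W.IsElliptic] :
    Nonempty (PuncturedElliptic.IsogenySystem W) ∧
    ∀ S : PuncturedElliptic.IsogenySystem W,
      Function.Injective S.incl ∧
      ∀ (n : ℕ) (_ : 0 < n) (x y : PuncturedElliptic.Qbar)
        (h : (W.baseChange PuncturedElliptic.Qbar).toAffine.Nonsingular x y),
        n • (WeierstrassCurve.Affine.Point.some x y h : PuncturedElliptic.Pts W) = 0 →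
        ∀ γ : PuncturedElliptic.LocalParam (W.baseChange PuncturedElliptic.Qbar) x y,
          ∃ b : PuncturedElliptic.Qbarˣ,
            (b : PuncturedElliptic.Qbar) = (-1) ^ (n + 1) * (n : PuncturedElliptic.Qbar) *
              γ.residue (γ.eval ((W.baseChange PuncturedElliptic.Qbar).ψ (n : ℤ)))⁻¹ ∧
            S.fInfty x y h = S.incl ((1 / (n : ℚ) ^ 2) ⊗ₜ[ℤ] Additive.ofMul b) := by
  refine ⟨⟨PuncturedElliptic.divisionSystem W⟩, fun S => ⟨S.incl_injective, ?_⟩⟩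
  intro n hn x y h hQ γ
  lift n to ℕ+ using hn
  have hb := γ.residue_psi_inv_sq_mul h n.pos
    ((WeierstrassCurve.nsmul_eq_zero_iff_psiAt h n).mp hQ)
  set r := (-1) ^ ((n : ℕ) + 1) * ((n : ℕ) : PuncturedElliptic.Qbar) *
    γ.residue (γ.eval ((W.baseChange PuncturedElliptic.Qbar).ψ ((n : ℕ) : ℤ)))⁻¹
  have hr : r ≠ 0 := fun h0 => by simp [h0] at hb
  refine ⟨Units.mk0 r hr, rfl, ?_⟩
  -- The value of `f(Q)` under `β_n` is `r²` times the base point, and `(r²) ^ (1 / (2 n²))` is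
  -- `r ^ (1 / n²)`.
  rw [PuncturedElliptic.IsogenySystem.fInfty, S.betaInfty_eq n,
    S.β_f_of_nsmul_eq_zero n h hQ (c := Units.mk0 r hr ^ 2) (by simpa using hb), ← S.incl_tmul,
    ← zpow_natCast (Units.mk0 r hr), PuncturedElliptic.QTensorUnits.tmul_zpow]
  congr 2
  have hn : ((n : ℕ) : ℚ) ≠ 0 := by exact_mod_cast n.ne_zero
  push_cast
  field_simp
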